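/- **Computational model.** Algorithms are finite programs for a random access machine whose memory cells, indexed by $\mathbb N$, hold real numbers. The programs are built from the instructions: write a rational constant; $+,-,\times,\div,\lfloor\cdot\rfloor,\exp,\log$; indirect load and store; toss a coin whose bias in $[0,1]$ is the content of a cell; query an oracle; and from sequential composition, if-then-else and while (with tests "$<$" between cells). Each instruction, test and composition costs one step. Queries $q\in Q$ are given to programs by their codes under an injective encoding $Q\hookrightarrow\mathbb N$. An algorithm whose output is a function on $Q$ consists of a probabilistic oracle program, whose final memory describes the function, and a deterministic program without oracles, which computes the value of the function at any $q$ from this description; it runs in time $T$ if, on every computation path, both the first program and the evaluation of the output function at any $q\in Q$ halt within $T$ steps. **Definitions.** Let $U$ be a data universe, $Q$ a finite set of query descriptions with $|Q|\ge 2$, $\mathcal G$ a set of probability distributions on $Q$, and $P:Q\times U\to\{0,1\}$ a predicate; put $p_u(q)=P(q,u)$ and, for $D\in U^n$, $f^D(q)=\frac1n\sum_{i=1}^n P(q,D_i)$. * For $\mu\ge 1$ the $\mu$-smooth extension of $\mathcal G$ is the set of all distributions $G'$ on $Q$ such that for some $G\in\mathcal G$, $G'[q]\le\mu\, G[q]$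 for all $q\in Q$. * For a set $F$ of predicates on $Q$, an integer $n>0$ and $\theta\in[0,1]$, $F_{n,\theta}$ is the set of all functions $\mathbb I\{\frac1n\sum_{i=1}^n f_i\ge\theta\}$ with $f_1,\dots,f_n\in F$. * Approximate $G$-restricted evaluation access to $f:Q\to\{0,1\}$ with constant $c\in[1/3,3]$: a sample query is answered by a fresh labeled example $(q,f(q))$, $q\sim G$; an evaluation query at $q$ is answered by $(0,\perp)$ if $G[q]=0$ and by $(c\,G[q],f(q))$ if $G[q]>0$. * An algorithm $\mathcal L$ *learns thresholds over $(Q,\mathcal G',F)$ with $b(n,\gamma,\beta)$ queries and in time $t(n,\gamma,\beta)$* if for all real $\gamma,\beta>0$, integers $n>0$, $\theta\in[0,1]$, $f\in F_{n,\theta}$, $G\in\mathcal G'$ and $c\in[1/3,3]$, on input $(n,\theta,\gamma,\beta)$ and with approximate $G$-restricted evaluation access to $f$ with constant $c$, it makes at most $b(n,\gamma,\beta)$ queries (sample and evaluation queries together), runs in time $t(n,\gamma,\beta)$, and outputs a random hypothesis $h:Q\to\{0,1\}$ with $\Pr_h\big[\Pr_{q\sim G}[h(q)\ne f(q)]>\gamma\big]<\beta$.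 * A data release algorithm $\mathcal A$ has sampling access and exact evaluation access ($q\mapsto G[q]$) to a distribution $G\in\mathcal G$, and access to a data set $D\in U^n$ through queries $(q,i)\mapsto P(q,D_i)$; it outputs a random synopsis $S:Q\to[0,1]$. It is $\varepsilon$-differentially private if for every $G\in\mathcal G$, all $D,D'\in U^n$ that differ in at most one position and every set $\mathcal S$ of synopses, $\Pr[S_{D}\in\mathcal S]\le e^{\varepsilon}\Pr[S_{D'}\in\mathcal S]$. It is $(\alpha,\beta,\gamma)$-accurate for data sets of size $n$ if for all $G\in\mathcal G$ and $D\in U^n$, $\Pr_S\big[\Pr_{q\sim G}[|S(q)-f^D(q)|>\alpha]>\gamma\big]<\beta$. **Theorem.** There are universal constants $c_1,c_2,c_3,C>0$ and $K\in\mathbb N$ such that for every algorithm $\mathcal L$ there is a data release algorithm $\mathcal A$ with the following property. Let $U,Q,\mathcal G,P$ and the encoding of $Q$ be as above, let $\varepsilon>0$, $\alpha,\beta,\gamma\in(0,1]$ and $n\in\mathbb N$, and put $$n'=\Big\lceil \frac{c_1\log|Q|}{\alpha^2}\Big\rceil,\qquad \gamma'=c_2\gamma\alpha,\qquad \beta'=c_3\beta\alpha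 .$$ Suppose that $\mathcal L$ learns thresholds over $(Q,\mathcal G',\{p_u:u\in U\})$ with $b(n,\gamma,\beta)\in\mathbb N$ queries and in time $t(n,\gamma,\beta)\in\mathbb N$, where $\mathcal G'$ is the $(2/\gamma)$-smooth extension of $\mathcal G$, that $b(n',\gamma',\beta')\ge1$, and that $$n\ \ge\ \frac{C\cdot b(n',\gamma',\beta')\cdot\log\!\Big(\frac{b(n',\gamma',\beta')}{\alpha\gamma\beta}\Big)\cdot\log(1/\beta')}{\varepsilon\,\alpha^2\,\gamma}.$$ Then $\mathcal A$, on input $(n,\varepsilon,\alpha,\beta,\gamma,n',b(n',\gamma',\beta'),t(n',\gamma',\beta'))$, is $\varepsilon$-differentially private and $(\alpha,\beta,\gamma)$-accurate for data sets of size $n$, and it runs in time at most $$K\cdot\Big(t(n',\gamma',\beta')+n+\frac1\alpha+\log\frac1\beta+\frac1\gamma\Big)^{K}.$$ -/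

import Mathlib

noncomputable section

namespace DataRelease

/-! ## Random access machines over the reals

Programs run on a memory of real-valued cells indexed by `ℕ`.  Every instruction, every test and
every sequential composition costs one unit of time.  Cells are accessed directly (address written in the program) or
indirectly (address read from a cell and rounded down).  Constants in programs are rational. -/

/-- The arithmetic instructions.  The unary ones ignore their second argument. -/
inductive Arith
  | add | sub | mul | div | floor | exp | log

/-- The function computed by an arithmetic instruction. -/
def Arith.apply : Arith → ℝ → ℝ → ℝ
  | .add, x, y => x + y
  | .sub, x, y => x - y
  | .mul, x, y => x * y
  | .div, x, y => x / y
  | .floor, x, _ => (⌊x⌋ : ℝ)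
  | .exp, x, _ => Real.exp x
  | .log, x, _ => Real.log x

/-- Programs.  `E` is the type of the additional instructions: coin tosses and oracle queries for
probabilistic oracle programs, none at all for deterministic programs.

* `const a c`: cell `a` gets the value `c`;
* `arith o a x y`: cell `a` gets the value of `o` at the contents of the cells `x`, `y`;
* `load a x`: cell `a` gets the content of the cell whose address is in cell `x`;
* `store a x`: the cell whose address is in cell `a` gets the content of cell `x`;
* `act e`: perform the additional instruction `e`;
* `seq p r`: first `p`, then `r`;
* `ite x y p r`: if the content of `x` is less than that of `y` then `p`, else `r`;
* `loop x y p`: while the content of `x` is less than that of `y`, do `p`. -/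
inductive Prog (E : Type) : Type
  | const (a : ℕ) (c : ℚ)
  | arith (o : Arith) (a x y : ℕ)
  | load (a x : ℕ)
  | store (a x : ℕ)
  | act (e : E)
  | seq (p r : Prog E)
  | ite (x y : ℕ) (p r : Prog E)
  | loop (x y : ℕ) (p : Prog E)

/-- The state of a running program: the memory, the number of steps made so far, and the number of
oracle queries made so far. -/
structure State where
  mem : ℕ → ℝ
  time : ℕ
  queries : ℕ

/-- The state at the start of a run on a given memory. -/
def State.init (M : ℕ → ℝ) : State := ⟨M, 0, 0⟩

/-- Count one step. -/
def State.tick (s : State) : State := { s with time := s.time + 1 }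

/-- Overwrite cell `a` by `v`. -/
def State.write (s : State) (a : ℕ) (v : ℝ) : State :=
  { s with mem := Function.update s.mem a v }

/-- At most `k` rounds (tests) of a loop; `none` if the loop has not been left by then. -/
def runLoop {m : Type → Type} [Monad m] (test : State → Prop) (body : State → m (Option State)) :
    ℕ → State → m (Option State)
  | 0, _ => pure none
  | k + 1, s =>
    open Classical in
    if test s then do
      match ← body s.tick with
      | none => pure none
      | some s' => runLoop test body k s'
    else pure (some s.tick)

/-- The result of running a program from a given state, where `h` describes the effect of the
additional instructions; `none` if some loop is executed with more than `k` tests.  The monad `m`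
is `PMF` for probabilistic programs and `Id` for deterministic ones.

Each test costs one step, so a program that halts within `k` steps is never cut off by the bound
`k`, and its result is the same for all larger bounds. -/
def exec {E : Type} {m : Type → Type} [Monad m] (h : E → State → m State) (k : ℕ) :
    Prog E → State → m (Option State)
  | .const a c, s => pure (some (s.tick.write a (c : ℝ)))
  | .arith o a x y, s => pure (some (s.tick.write a (o.apply (s.mem x) (s.mem y))))
  | .load a x, s => pure (some (s.tick.write a (s.mem ⌊s.mem x⌋₊)))
  | .store a x, s => pure (some (s.tick.write ⌊s.mem a⌋₊ (s.mem x)))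
  | .act e, s => do
    let s' ← h e s
    pure (some s')
  | .seq p r, s => do
    match ← exec h k p s.tick with
    | none => pure none
    | some s' => exec h k r s'
  | .ite x y p r, s =>
    open Classical in
    if s.mem x < s.mem y then exec h k p s.tick else exec h k r s.tick
  | .loop x y p, s => runLoop (fun s => s.mem x < s.mem y) (exec h k p) k s

/-- The instructions of probabilistic programs with oracles named by `ι`.

* `toss a x`: cell `a` gets the value of a fresh coin, which is `1` with the probability in cell
  `x` (projected to `[0,1]`) and `0` otherwise;
* `query i a x y`: ask oracle `i` about the contents of cells `x`, `y`; the two components of the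
  answer are put into cells `a` and `a + 1`. -/
inductive Effect (ι : Type) : Type
  | toss (a x : ℕ)
  | query (i : ι) (a x y : ℕ)

/-- Oracles named by `ι`: a query consists of two numbers, and the answer is a random pair of
numbers, drawn afresh for every query. -/
abbrev Oracle (ι : Type) := ι → ℝ → ℝ → PMF (ℝ × ℝ)

/-- A coin that shows `true` with probability `x`, projected to `[0,1]`. -/
def coin (x : ℝ) : PMF Bool :=
  PMF.ofFintype
    (fun c => if c = true then ENNReal.ofReal (max 0 (min 1 x))
      else ENNReal.ofReal (1 - max 0 (min 1 x)))
    (by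
      have h0 : (0 : ℝ) ≤ max 0 (min 1 x) := le_max_left _ _
      have h1 : max 0 (min 1 x) ≤ (1 : ℝ) := max_le zero_le_one (min_le_left _ _)
      simp only [Fintype.sum_bool, if_true, Bool.false_eq_true, if_false]
      rw [← ENNReal.ofReal_add h0 (by linarith)]
      simp)

/-- The effect of coin tosses and oracle queries.  Each costs one step. -/
def Effect.perform {ι : Type} (O : Oracle ι) : Effect ι → State → PMF State
  | .toss a x, s => (coin (s.mem x)).map fun c => s.tick.write a (if c = true then 1 else 0)
  | .query i a x y, s => (O i (s.mem x) (s.mem y)).map fun r =>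
      { (s.tick.write a r.1).write (a + 1) r.2 with queries := s.queries + 1 }

/-- Probabilistic run with oracle `O` on the initial memory `M`. -/
def run {ι : Type} (O : Oracle ι) (k : ℕ) (p : Prog (Effect ι)) (M : ℕ → ℝ) :
    PMF (Option State) :=
  exec (m := PMF) (Effect.perform O) k p (State.init M)

/-- Deterministic run (no coins, no oracles) on the initial memory `M`. -/
def runDet (k : ℕ) (p : Prog Empty) (M : ℕ → ℝ) : Option State :=
  Id.run (exec (m := Id) (fun e _ => e.elim) k p (State.init M))

/-- The memory that holds the given numbers in its first cells and `0` elsewhere. -/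
def inputMemory (l : List ℝ) : ℕ → ℝ := fun i => l.getD i 0

/-! ## Algorithms that output a function on the query set

Such an algorithm is a pair of programs.  The probabilistic program `train` has access to the
oracles; the memory that it leaves is the description of the function that it outputs.  The
deterministic program `evaluate`, which has no access to coins or oracles, computes the values of
the function from this description: to evaluate at `q`, the code of `q` is put into cell `0` of the
memory left by `train`, and the value is what cell `0` contains after running `evaluate`. -/

/-- An algorithm with oracles named by `ι` that outputs a function. -/
structure Algorithm (ι : Type) where
  train : Prog (Effect ι)
  evaluate : Prog Empty

/-- The number computed by `evaluate` from the description `M` at the point with code `x`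
(`0` if `evaluate` does not halt). -/
def Algorithm.value {ι : Type} (A : Algorithm ι) (k : ℕ) (M : ℕ → ℝ) (x : ℕ) : ℝ :=
  match runDet k A.evaluate (Function.update M 0 (x : ℝ)) with
  | none => 0
  | some s => s.mem 0

/-- On every computation path (for all outcomes of the coins and all oracle answers that have
positive probability), `train` halts after at most `T` steps and at most `B` oracle queries, and
the function that it outputs can be evaluated at every query in at most `T` steps. -/
def Algorithm.RunsWithin {ι : Type} (A : Algorithm ι) {Q : Type*} (enc : Q ↪ ℕ) (O : Oracle ι)
    (input : List ℝ) (T : ℕ) (B : ℕ∞) : Prop :=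
  ∀ r ∈ (run O T A.train (inputMemory input)).support,
    ∃ s : State, r = some s ∧ s.time ≤ T ∧ (s.queries : ℕ∞) ≤ B ∧
      ∀ q : Q, ∃ s' : State,
        runDet T A.evaluate (Function.update s.mem 0 (enc q : ℝ)) = some s' ∧ s'.time ≤ T

/-- The distribution of the Boolean function output by an algorithm (when run for `T` steps):
a positive value stands for `true`. -/
def Algorithm.hypothesis {ι : Type} (A : Algorithm ι) {Q : Type*} (enc : Q ↪ ℕ) (O : Oracle ι)
    (input : List ℝ) (T : ℕ) : PMF (Q → Bool) :=
  open Classical in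
  (run O T A.train (inputMemory input)).map fun r q =>
    match r with
    | none => false
    | some s => decide (0 < A.value T s.mem (enc q))

/-- The distribution of the `[0,1]`-valued function output by an algorithm (when run for `T`
steps): values outside of `[0,1]` are projected to `[0,1]`. -/
def Algorithm.synopsis {ι : Type} (A : Algorithm ι) {Q : Type*} (enc : Q ↪ ℕ) (O : Oracle ι)
    (input : List ℝ) (T : ℕ) : PMF (Q → unitInterval) :=
  (run O T A.train (inputMemory input)).map fun r q =>
    match r with
    | none => 0
    | some s => Set.projIcc 0 1 zero_le_one (A.value T s.mem (enc q))

/-! ## Learning thresholds -/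

/-- The query whose code is `x`, if there is one. -/
def decode {Q : Type*} (enc : Q ↪ ℕ) (x : ℝ) : Option Q :=
  open Classical in
  if h : ∃ q : Q, (enc q : ℝ) = x then some h.choose else none

/-- The `μ`-smooth extension of a set of distributions: all distributions `G'` with
`G' q ≤ μ * G q` for all `q`, for some `G` in the given set. -/
def smoothExtension {Q : Type*} (μ : ℝ) (𝒢 : Set (PMF Q)) : Set (PMF Q) :=
  {G' | ∃ G ∈ 𝒢, ∀ q, G' q ≤ ENNReal.ofReal μ * G q}

/-- The `n`-thresholds over `F` with threshold `θ`. -/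
def nThresholds {Q : Type*} (F : Set (Q → Bool)) (n : ℕ) (θ : ℝ) : Set (Q → Bool) :=
  {f | ∃ g : Fin n → Q → Bool, (∀ i, g i ∈ F) ∧
    ∀ q, f q = true ↔ θ ≤ (∑ i, if g i q = true then (1 : ℝ) else 0) / n}

/-- The oracles of a learning algorithm: labeled examples and evaluation queries. -/
inductive LearnOracle
  | sample
  | evaluate

/-- Labels as numbers; the label `⊥` is represented by `-1`. -/
def label : Option Bool → ℝ
  | none => -1
  | some false => 0
  | some true => 1

/-- Approximate `G`-restricted evaluation access to `f`, with approximation constant `c`.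
A sample query is answered by a random labeled example `(q, f q)`, `q ∼ G`.  An evaluation query
at `q` is answered by `(0, ⊥)` if `G q = 0`, and by `(c * G q, f q)` if `G q > 0`. -/
def restrictedAccess {Q : Type*} (enc : Q ↪ ℕ) (G : PMF Q) (f : Q → Bool) (c : ℝ) :
    Oracle LearnOracle
  | .sample, _, _ => G.map fun q => ((enc q : ℝ), label (some (f q)))
  | .evaluate, x, _ => PMF.pure <|
      open Classical in
      match decode enc x with
      | none => (0, label none)
      | some q =>
        if G q = 0 then (0, label none) else (c * (G q).toReal, label (some (f q)))

/-- `L` learns thresholds over `(Q, 𝒢, F)` from approximate distribution-restricted evaluation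
access, with `b n γ β` queries (examples and evaluation queries together) and in time `t n γ β`.
The input of `L` consists of `n`, the threshold `θ`, and `γ`, `β`. -/
def LearnsThresholds (L : Algorithm LearnOracle) {Q : Type*} (enc : Q ↪ ℕ) (𝒢 : Set (PMF Q))
    (F : Set (Q → Bool)) (b t : ℕ → ℝ → ℝ → ℕ) : Prop :=
  ∀ (γ β : ℝ) (n : ℕ) (θ : ℝ), 0 < γ → 0 < β → 0 < n → θ ∈ Set.Icc (0 : ℝ) 1 →
  ∀ f ∈ nThresholds F n θ, ∀ G ∈ 𝒢, ∀ c ∈ Set.Icc (1 / 3 : ℝ) 3,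
    L.RunsWithin enc (restrictedAccess enc G f c) [n, θ, γ, β] (t n γ β) (b n γ β) ∧
    (L.hypothesis enc (restrictedAccess enc G f c) [n, θ, γ, β] (t n γ β)).toOuterMeasure
      {h | ENNReal.ofReal γ < G.toOuterMeasure {q | h q ≠ f q}} < ENNReal.ofReal β

/-! ## Private data release -/

/-- The answer of the counting query `q` on the data set `D`. -/
def countingQuery {Q U : Type*} (P : Q → U → Bool) {n : ℕ} (D : Fin n → U) (q : Q) : ℝ :=
  (∑ i, if P q (D i) = true then (1 : ℝ) else 0) / n

/-- Two data sets are adjacent if they agree in all items but at most one. -/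
def Adjacent {U : Type*} {n : ℕ} (D D' : Fin n → U) : Prop :=
  ∃ i, ∀ j, j ≠ i → D j = D' j

/-- Differential privacy (with `δ = 0`) of a randomized map on data sets. -/
def DifferentiallyPrivate {U R : Type*} {n : ℕ} (ε : ℝ) (M : (Fin n → U) → PMF R) : Prop :=
  ∀ D D' : Fin n → U, Adjacent D D' → ∀ S : Set R,
    (M D).toOuterMeasure S ≤ ENNReal.ofReal (Real.exp ε) * (M D').toOuterMeasure S

/-- The oracles of a data release algorithm: samples from the query distribution, evaluation of
the query distribution, and the data set. -/
inductive ReleaseOracle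
  | sample
  | evaluate
  | data

/-- Access to the query distribution `G` (sampling and exact evaluation) and to the data set `D`:
a data query at `(q, i)` is answered by `P q (D i)`.  The second component of the answers carries
no information. -/
def releaseAccess {Q U : Type*} (enc : Q ↪ ℕ) (P : Q → U → Bool) (G : PMF Q) {n : ℕ}
    (D : Fin n → U) : Oracle ReleaseOracle
  | .sample, _, _ => G.map fun q => ((enc q : ℝ), 0)
  | .evaluate, x, _ => PMF.pure <|
      match decode enc x with
      | none => (0, 0)
      | some q => ((G q).toReal, 0)
  | .data, x, y => PMF.pure <|
      match decode enc x with
      | none => (0, 0)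
      | some q =>
        if h : ⌊y⌋₊ < n then (if P q (D ⟨⌊y⌋₊, h⟩) = true then 1 else 0, 0) else (0, 0)

/-- A randomized synopsis `S : Q → [0,1]`, depending on the query distribution and the data set, is
`(α, β, γ)`-accurate for the query distributions in `𝒢` and the data sets of size `n`. -/
def Accurate {Q U : Type*} (P : Q → U → Bool) (𝒢 : Set (PMF Q)) (n : ℕ) (α β γ : ℝ)
    (M : PMF Q → (Fin n → U) → PMF (Q → unitInterval)) : Prop :=
  ∀ G ∈ 𝒢, ∀ D : Fin n → U,
    (M G D).toOuterMeasure
      {S | ENNReal.ofReal γ <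
        G.toOuterMeasure {q | α < |(S q : ℝ) - countingQuery P D q|}} < ENNReal.ofReal β

end DataRelease

end

open DataRelease

/-! Compare f^D(q) with about 8/α equally spaced thresholds; the number of thresholds below it
determines f^D(q) up to α (`abs_score_sub_le`). For each threshold the yes-or-no function of q is
handed to the learner. It is a threshold of the n predicates given by the items of D, but a suitable
sample of n' items has all its means within α/64 of those of D (`exists_sample`), so away from the
threshold it agrees with an n'-threshold.

The data enter only through noisy counts, drawn by an exponential mechanism on {0, ..., n}. The
learner runs on G conditioned on the queries whose noisy count is at distance at least αn/16 from
the threshold; noise of at most αn/64 cannot falsify their labels. If these queries have mass at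
least γ/2, the conditional distribution lies in the (2/γ)-smooth extension. Rejection sampling
provides its examples, and an estimate of the mass up to a factor 3 provides evaluation access with
a constant in [1/3, 3]. The thresholds for which this mass is below γ/2 need no learner: their sets
of near queries have mass above 1/2, so any two of them meet, so these thresholds are close to each
other, and outside one set of mass γ/2 they are all close to f^D(q), where wrong answers are
harmless (`prob_score_le`).

Privacy needs no property of the learner. Values are recorded and reused, a fresh one changes
likelihoods by at most exp(2η), and the number of requests is limited by force, with a clock that
stops the learner; η is chosen so that the total exponent is ε (`release_private`).

Accuracy comes from replacing the process step by step (`release_accurate`): noise by noise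
conditioned to be small, at the price of the tail probability per request; values drawn on demand by
a function drawn in advance, at no price; the clocked simulation by a genuine run with restricted
access, at an exponentially small price (`approximates_simulate`). Privacy and the first two
replacements are instances of one induction over programs: an affine inequality for a single draw
(`DrawTransfer`) passes to whole runs (`expect_aexec_lift`, `expect_learnOnce_avg`,
`expect_runAll_le`).

The other half of the proof realizes this process by a machine program. Weakest preconditions are
infinite on runs that are cut off, so upper bounds for them also prove termination and time bounds.
The learner's program is compiled into a clocked simulation on one of several interleaved streams of
memory (`wp_compile`). An upper bound for every event and for its complement fixes the law of the
output (`synopsis_eq`). -/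

noncomputable section

namespace DataRelease

open scoped ENNReal

/-! ## Expectations -/

/-- The expectation of a nonnegative function. -/
def expect {α : Type*} (μ : PMF α) (F : α → ℝ≥0∞) : ℝ≥0∞ := ∑' x, μ x * F x

section Expect
variable {α β γ : Type*}

@[simp] theorem expect_pure (a : α) (F : α → ℝ≥0∞) : expect (PMF.pure a) F = F a := by
  classical
  unfold expect
  rw [tsum_eq_single a]
  · simp
  · intro b hb; simp [PMF.pure_apply, hb]

@[simp] theorem expect_bind (μ : PMF α) (f : α → PMF β) (F : β → ℝ≥0∞) :
    expect (μ.bind f) F = expect μ fun a => expect (f a) F := by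
  unfold expect
  simp only [PMF.bind_apply, ← ENNReal.tsum_mul_right, ← ENNReal.tsum_mul_left]
  rw [ENNReal.tsum_comm]
  simp only [mul_assoc]

@[simp] theorem expect_map (μ : PMF α) (f : α → β) (F : β → ℝ≥0∞) :
    expect (μ.map f) F = expect μ fun a => F (f a) := by
  simp [PMF.map, expect_bind]

theorem expect_mono {μ : PMF α} {F G : α → ℝ≥0∞} (h : ∀ x, F x ≤ G x) :
    expect μ F ≤ expect μ G :=
  ENNReal.tsum_le_tsum fun x => mul_le_mul_right (h x) _

theorem expect_mono_support {μ : PMF α} {F G : α → ℝ≥0∞} (h : ∀ x ∈ μ.support, F x ≤ G x) :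
    expect μ F ≤ expect μ G := by
  refine ENNReal.tsum_le_tsum fun x => ?_
  by_cases hx : x ∈ μ.support
  · exact mul_le_mul_right (h x hx) _
  · simp [(PMF.apply_eq_zero_iff μ x).2 hx]

theorem expect_add (μ : PMF α) (F G : α → ℝ≥0∞) :
    expect μ (fun x => F x + G x) = expect μ F + expect μ G := by
  simp [expect, mul_add, ENNReal.tsum_add]

theorem expect_const_mul (μ : PMF α) (c : ℝ≥0∞) (F : α → ℝ≥0∞) :
    expect μ (fun x => c * F x) = c * expect μ F := by
  simp only [expect, ← ENNReal.tsum_mul_left]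
  exact tsum_congr fun x => by ring

@[simp] theorem expect_const (μ : PMF α) (c : ℝ≥0∞) : expect μ (fun _ => c) = c := by
  simp [expect, ENNReal.tsum_mul_right, PMF.tsum_coe]

theorem expect_le_of_le {μ : PMF α} {F : α → ℝ≥0∞} {c : ℝ≥0∞} (h : ∀ x, F x ≤ c) :
    expect μ F ≤ c :=
  (expect_mono h).trans (expect_const μ c).le

theorem expect_le_of_support {μ : PMF α} {F : α → ℝ≥0∞} {c : ℝ≥0∞}
    (h : ∀ x ∈ μ.support, F x ≤ c) : expect μ F ≤ c :=
  (expect_mono_support h).trans (expect_const μ c).le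

theorem expect_comm (μ : PMF α) (ν : PMF β) (F : α → β → ℝ≥0∞) :
    expect μ (fun x => expect ν (F x)) = expect ν fun y => expect μ fun x => F x y := by
  unfold expect
  simp only [← ENNReal.tsum_mul_left]
  rw [ENNReal.tsum_comm]
  exact tsum_congr fun y => tsum_congr fun x => by ring

theorem expect_indicator (μ : PMF α) (S : Set α) :
    expect μ (S.indicator 1) = μ.toOuterMeasure S := by
  rw [PMF.toOuterMeasure_apply]
  refine tsum_congr fun x => ?_
  by_cases hx : x ∈ S <;> simp [hx]

theorem expect_coin (x : ℝ) (F : Bool → ℝ≥0∞) :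
    expect (coin x) F = ENNReal.ofReal (max 0 (min 1 x)) * F true +
      ENNReal.ofReal (1 - max 0 (min 1 x)) * F false := by
  simp [expect, coin, tsum_fintype]

end Expect

/-! ## Weakest preconditions -/

/-- The expected value of `Q` at the end of a run, which is infinite unless the run halts almost
surely. -/
def wp {E : Type} (h : E → State → PMF State) (k : ℕ) (p : Prog E) (Q : State → ℝ≥0∞)
    (s : State) : ℝ≥0∞ :=
  expect (exec (m := PMF) h k p s) fun o => o.elim ⊤ Q

/-- The weakest precondition of a loop that is left after at most `j` tests. -/
def wpLoop {E : Type} (h : E → State → PMF State) (k : ℕ) (x y : ℕ) (p : Prog E)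
    (Q : State → ℝ≥0∞) (j : ℕ) (s : State) : ℝ≥0∞ :=
  expect (runLoop (m := PMF) (fun s => s.mem x < s.mem y) (exec (m := PMF) h k p) j s)
    fun o => o.elim ⊤ Q

section WP
variable {E : Type} {h : E → State → PMF State} {k : ℕ} {Q : State → ℝ≥0∞} {s : State}

theorem pmf_pure {α : Type} (a : α) : (pure a : PMF α) = PMF.pure a := rfl
theorem pmf_bind {α β : Type} (μ : PMF α) (f : α → PMF β) : (μ >>= f) = μ.bind f := rfl

@[simp] theorem wp_const (a : ℕ) (c : ℚ) :
    wp h k (.const a c) Q s = Q ⟨Function.update s.mem a (c : ℝ), s.time + 1, s.queries⟩ := by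
  simp [wp, exec, pmf_pure, State.tick, State.write]

@[simp] theorem wp_arith (o : Arith) (a x y : ℕ) :
    wp h k (.arith o a x y) Q s =
      Q ⟨Function.update s.mem a (o.apply (s.mem x) (s.mem y)), s.time + 1, s.queries⟩ := by
  simp [wp, exec, pmf_pure, State.tick, State.write]

@[simp] theorem wp_load (a x : ℕ) :
    wp h k (.load a x) Q s =
      Q ⟨Function.update s.mem a (s.mem ⌊s.mem x⌋₊), s.time + 1, s.queries⟩ := by
  simp [wp, exec, pmf_pure, State.tick, State.write]

@[simp] theorem wp_store (a x : ℕ) :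
    wp h k (.store a x) Q s =
      Q ⟨Function.update s.mem ⌊s.mem a⌋₊ (s.mem x), s.time + 1, s.queries⟩ := by
  simp [wp, exec, pmf_pure, State.tick, State.write]

theorem wp_act (e : E) : wp h k (.act e) Q s = expect (h e s) Q := by
  simp [wp, exec, pmf_pure, pmf_bind]

@[simp] theorem wp_seq (p r : Prog E) :
    wp h k (.seq p r) Q s = wp h k p (wp h k r Q) ⟨s.mem, s.time + 1, s.queries⟩ := by
  simp only [wp, exec, pmf_pure, pmf_bind, expect_bind, State.tick]
  congr 1
  funext o
  cases o with
  | none => simp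
  | some s' => rfl

@[simp] theorem wp_ite (x y : ℕ) (p r : Prog E) :
    wp h k (.ite x y p r) Q s =
      if s.mem x < s.mem y then wp h k p Q ⟨s.mem, s.time + 1, s.queries⟩
      else wp h k r Q ⟨s.mem, s.time + 1, s.queries⟩ := by
  simp only [wp, exec, State.tick]
  split_ifs <;> rfl

theorem wp_loop (x y : ℕ) (p : Prog E) :
    wp h k (.loop x y p) Q s = wpLoop h k x y p Q k s := by
  simp only [wp, wpLoop, exec]

theorem wpLoop_succ (x y : ℕ) (p : Prog E) (j : ℕ) :
    wpLoop h k x y p Q (j + 1) s =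
      if s.mem x < s.mem y then wp h k p (wpLoop h k x y p Q j) ⟨s.mem, s.time + 1, s.queries⟩
      else Q ⟨s.mem, s.time + 1, s.queries⟩ := by
  simp only [wpLoop, runLoop, wp, State.tick]
  split_ifs with hs
  · simp only [pmf_bind, expect_bind]
    congr 1
    funext o
    cases o with
    | none => simp [pmf_pure]
    | some s' => rfl
  · simp [pmf_pure]

@[simp] theorem wpLoop_zero (x y : ℕ) (p : Prog E) : wpLoop h k x y p Q 0 s = ⊤ := by
  simp [wpLoop, runLoop, pmf_pure]

theorem wp_mono {Q' : State → ℝ≥0∞} (hQ : ∀ s, Q s ≤ Q' s) (p : Prog E) :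
    wp h k p Q s ≤ wp h k p Q' s :=
  expect_mono fun o => by cases o <;> simp [hQ]

end WP

/-! ## Runs only move forward, and deterministic runs are a special case -/

/-- The order in which states can be reached: time passes, and every query takes time. -/
def State.Reaches (s s' : State) : Prop :=
  s.time < s'.time ∧ s.queries ≤ s'.queries ∧ s'.queries + s.time ≤ s.queries + s'.time

theorem State.Reaches.trans {s s' s'' : State} (h : s.Reaches s') (h' : s'.Reaches s'') :
    s.Reaches s'' := by
  obtain ⟨h1, h2, h3⟩ := h
  obtain ⟨h4, h5, h6⟩ := h'
  exact ⟨by omega, by omega, by omega⟩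

theorem State.reaches_tick (s : State) : s.Reaches s.tick :=
  ⟨by simp [State.tick], by simp [State.tick], by simp [State.tick]⟩

theorem reaches_of_mem_support_runLoop {test : State → Prop} {body : State → PMF (Option State)}
    (hb : ∀ s s', some s' ∈ (body s).support → s.Reaches s') :
    ∀ (j : ℕ) (s s' : State), some s' ∈ (runLoop (m := PMF) test body j s).support → s.Reaches s'
  | 0, s, s', hs => by simp [runLoop, pmf_pure] at hs
  | j + 1, s, s', hs => by
    rw [runLoop] at hs
    split_ifs at hs
    · simp only [pmf_bind, PMF.mem_support_bind_iff] at hs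
      obtain ⟨o, ho, hs⟩ := hs
      cases o with
      | none => simp [pmf_pure] at hs
      | some s₁ =>
        exact (s.reaches_tick.trans (hb _ _ ho)).trans (reaches_of_mem_support_runLoop hb j _ _ hs)
    · simp [pmf_pure] at hs
      subst hs; exact s.reaches_tick

/-- This has two uses: a run that has exceeded a limit on time or queries cannot return below it,
and the number of queries of a run is at most its time. -/
theorem reaches_of_mem_support_exec {E : Type} {h : E → State → PMF State}
    (hh : ∀ e s s', s' ∈ (h e s).support → s.Reaches s') (k : ℕ) (p : Prog E) :
    ∀ s s' : State, some s' ∈ (exec (m := PMF) h k p s).support → s.Reaches s' := by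
  induction p with
  | const | arith | load | store =>
    intro s s' hs
    simp [exec, pmf_pure] at hs
    subst hs
    exact s.reaches_tick
  | act e =>
    intro s s' hs
    simp [exec, pmf_pure, pmf_bind] at hs
    exact hh _ _ _ ((PMF.mem_support_iff _ _).2 hs)
  | seq p r ihp ihr =>
    intro s s' hs
    simp only [exec, pmf_bind, PMF.mem_support_bind_iff] at hs
    obtain ⟨o, ho, hs⟩ := hs
    cases o with
    | none => simp [pmf_pure] at hs
    | some s₁ => exact (s.reaches_tick.trans (ihp _ _ ho)).trans (ihr _ _ hs)
  | ite x y p r ihp ihr =>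
    intro s s' hs
    rw [exec] at hs
    split_ifs at hs
    · exact s.reaches_tick.trans (ihp _ _ hs)
    · exact s.reaches_tick.trans (ihr _ _ hs)
  | loop x y p ih => exact fun s s' hs => reaches_of_mem_support_runLoop ih k s s' hs

theorem reaches_of_mem_support_perform {ι : Type} (O : Oracle ι) (e : Effect ι) (s s' : State)
    (hs : s' ∈ (e.perform O s).support) : s.Reaches s' := by
  cases e with
  | toss a x =>
    simp only [Effect.perform, PMF.support_map, Set.mem_image] at hs
    obtain ⟨c, -, rfl⟩ := hs
    exact s.reaches_tick
  | query i a x y =>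
    simp only [Effect.perform, PMF.support_map, Set.mem_image] at hs
    obtain ⟨c, -, rfl⟩ := hs
    exact ⟨by simp [State.tick, State.write], by simp, by simp [State.tick, State.write]; omega⟩

/-- Deterministic programs thereby fall under the calculus of `wp` and under the comparison with
clocked runs, both of which are set up for `PMF`. -/
theorem exec_eq_pure (k : ℕ) (p : Prog Empty) (s : State) :
    exec (m := PMF) (fun e _ => e.elim) k p s =
      PMF.pure (Id.run (exec (m := Id) (fun e _ => e.elim) k p s)) := by
  induction p generalizing s with
  | const | arith | load | store => rfl
  | act e => exact e.elim
  | seq p r ihp ihr =>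
    simp only [exec, pmf_bind, ihp, PMF.pure_bind]
    cases hx : Id.run (exec (m := Id) (fun e _ => e.elim) k p s.tick) with
    | none => simp only [pmf_pure]; congr 1; simp_all [Id.run, bind]; rfl
    | some s' => simp only [ihr]; congr 1; simp_all [Id.run, bind]
  | ite x y p r ihp ihr =>
    simp only [exec]
    split_ifs
    · exact ihp _
    · exact ihr _
  | loop x y p ih =>
    simp only [exec]
    suffices H : ∀ j s, runLoop (m := PMF) (fun s => s.mem x < s.mem y)
        (exec (m := PMF) (fun e _ => e.elim) k p) j s =
        PMF.pure (Id.run (runLoop (m := Id) (fun s => s.mem x < s.mem y)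
          (exec (m := Id) (fun e _ => e.elim) k p) j s)) from H k s
    intro j
    induction j with
    | zero => intro s; rfl
    | succ j ihj =>
      intro s
      rw [runLoop, runLoop]
      split_ifs
      · simp only [pmf_bind, ih, PMF.pure_bind]
        cases hx : Id.run (exec (m := Id) (fun e _ => e.elim) k p s.tick) with
        | none => simp only [pmf_pure]; congr 1; simp_all [Id.run, bind]; rfl
        | some s' => simp only [ihj]; congr 1; simp_all [Id.run, bind]
      · rfl

/-! ## Clocked runs

A clocked run stops quietly when its clock has run out.  Besides the memory and the clock its state
has an auxiliary component, which only the additional instructions use. -/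

/-- The state of a clocked run. -/
structure AS (X : Type*) where
  mem : ℕ → ℝ
  clock : ℕ
  aux : X

/-- Continue after a tick of the clock, or stop if the clock has run out. -/
def AS.step {X : Type*} (σ : AS X) (f : AS X → PMF (AS X)) : PMF (AS X) :=
  if σ.clock = 0 then PMF.pure σ else f ⟨σ.mem, σ.clock - 1, σ.aux⟩

/-- Overwrite a cell. -/
def AS.write {X : Type*} (σ : AS X) (a : ℕ) (v : ℝ) : AS X :=
  ⟨Function.update σ.mem a v, σ.clock, σ.aux⟩

/-- A clocked loop with at most `c` tests. -/
def aloop {X : Type*} (test : (ℕ → ℝ) → Prop) (body : AS X → PMF (AS X)) :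
    ℕ → AS X → PMF (AS X)
  | 0, σ => PMF.pure σ
  | c + 1, σ => σ.step fun σ =>
    open Classical in
    if test σ.mem then (body σ).bind (aloop test body c) else PMF.pure σ

/-- The clocked run of a program. -/
def aexec {E : Type} {X : Type*} (h : E → AS X → PMF (AS X)) : Prog E → AS X → PMF (AS X)
  | .const a c, σ => σ.step fun σ => PMF.pure (σ.write a (c : ℝ))
  | .arith o a x y, σ => σ.step fun σ => PMF.pure (σ.write a (o.apply (σ.mem x) (σ.mem y)))
  | .load a x, σ => σ.step fun σ => PMF.pure (σ.write a (σ.mem ⌊σ.mem x⌋₊))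
  | .store a x, σ => σ.step fun σ => PMF.pure (σ.write ⌊σ.mem a⌋₊ (σ.mem x))
  | .act e, σ => σ.step (h e)
  | .seq p r, σ => σ.step fun σ => (aexec h p σ).bind (aexec h r)
  | .ite x y p r, σ => σ.step fun σ =>
    open Classical in
    if σ.mem x < σ.mem y then aexec h p σ else aexec h r σ
  | .loop x y p, σ => aloop (fun M => M x < M y) (aexec h p) σ.clock σ

/-! ### Inequalities for single instructions pass to whole clocked runs. -/

section Transfer
variable {E : Type} {X Y : Type*}

/-- Averaging a function of the auxiliary component over a kernel, followed by an affine map. -/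
def AS.lift (κ : X → PMF Y) (C D : X → ℝ≥0∞) (F : AS Y → ℝ≥0∞) (σ : AS X) : ℝ≥0∞ :=
  C σ.aux * expect (κ σ.aux) (fun y => F ⟨σ.mem, σ.clock, y⟩) + D σ.aux

variable {κ : X → PMF Y} {C D : X → ℝ≥0∞}

theorem expect_step_lift {f : AS X → PMF (AS X)} {g : AS Y → PMF (AS Y)} {F : AS Y → ℝ≥0∞}
    (h : ∀ σ, expect (f σ) (AS.lift κ C D F) ≤ AS.lift κ C D (fun σ => expect (g σ) F) σ)
    (σ : AS X) :
    expect (σ.step f) (AS.lift κ C D F) ≤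
      AS.lift κ C D (fun σ => expect (σ.step g) F) σ := by
  by_cases hc : σ.clock = 0
  · simp [AS.step, AS.lift, hc]
  · simpa [AS.step, AS.lift, hc] using h ⟨σ.mem, σ.clock - 1, σ.aux⟩

/-- Both runs have the same memory and clock, so their tests agree. The hypothesis is needed for all
`F` bounded by one, because in the induction `F` is replaced by the expectation over the remaining
rounds. -/
theorem expect_aloop_lift {test : (ℕ → ℝ) → Prop} {f : AS X → PMF (AS X)}
    {g : AS Y → PMF (AS Y)}
    (h : ∀ F : AS Y → ℝ≥0∞, (∀ σ, F σ ≤ 1) → ∀ σ,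
      expect (f σ) (AS.lift κ C D F) ≤ AS.lift κ C D (fun σ => expect (g σ) F) σ)
    {F : AS Y → ℝ≥0∞} (hF : ∀ σ, F σ ≤ 1) (c : ℕ) :
    ∀ σ : AS X, expect (aloop test f c σ) (AS.lift κ C D F) ≤
      AS.lift κ C D (fun σ => expect (aloop test g c σ) F) σ := by
  induction c with
  | zero => intro σ; simp [aloop, AS.lift]
  | succ c ih =>
    refine expect_step_lift fun σ => ?_
    by_cases ht : test σ.mem
    · simp only [AS.lift, ht, if_true, expect_bind]
      exact (expect_mono ih).trans (h _ (fun σ => expect_le_of_le hF) σ)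
    · simp [AS.lift, ht]

/-- An inequality between two kinds of additional instructions carries over to programs. -/
theorem expect_aexec_lift {hA : E → AS X → PMF (AS X)} {hB : E → AS Y → PMF (AS Y)}
    (h : ∀ e, ∀ F : AS Y → ℝ≥0∞, (∀ σ, F σ ≤ 1) → ∀ σ,
      expect (hA e σ) (AS.lift κ C D F) ≤ AS.lift κ C D (fun σ => expect (hB e σ) F) σ)
    (p : Prog E) : ∀ F : AS Y → ℝ≥0∞, (∀ σ, F σ ≤ 1) → ∀ σ,
      expect (aexec hA p σ) (AS.lift κ C D F) ≤
        AS.lift κ C D (fun σ => expect (aexec hB p σ) F) σ := by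
  induction p with
  | const | arith | load | store =>
    intro F _
    simp only [aexec]
    exact expect_step_lift fun σ => by simp [AS.lift, AS.write]
  | act e =>
    intro F hF
    simp only [aexec]
    exact expect_step_lift (h e F hF)
  | seq p r ihp ihr =>
    intro F hF
    simp only [aexec]
    refine expect_step_lift fun σ => ?_
    simp only [expect_bind]
    exact (expect_mono (ihr F hF)).trans (ihp _ (fun σ => expect_le_of_le hF) σ)
  | ite x y p r ihp ihr =>
    intro F hF
    simp only [aexec]
    refine expect_step_lift fun σ => ?_
    by_cases ht : σ.mem x < σ.mem y
    · simpa [AS.lift, ht] using ihp F hF σ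
    · simpa [AS.lift, ht] using ihr F hF σ
  | loop x y p ih =>
    intro F hF σ
    simp only [aexec]
    exact expect_aloop_lift ih hF σ.clock σ

end Transfer

/-! ## Simulated access to a restricted query distribution

The noisy values of the queries are supplied by a kernel `dr`, which may keep a record of type `X`
of the values that it has given.  The number of values that may be requested is limited. -/

section Access
variable {Q V X : Type*}

/-- Draw queries until one with a good value appears. -/
def trySample (G : PMF Q) (dr : Q → X → PMF (V × X)) (good : V → Prop) :
    ℕ → X → PMF (Option (Q × V) × ℕ × X)
  | 0, x => PMF.pure (none, 0, x)
  | r + 1, x => G.bind fun q => (dr q x).bind fun o =>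
    open Classical in
    if good o.1 then PMF.pure (some (q, o.1), r, o.2) else trySample G dr good r o.2

/-- Count the queries with good values in a sample. -/
def countGood (G : PMF Q) (dr : Q → X → PMF (V × X)) (good : V → Prop) :
    ℕ → ℕ → X → PMF (ℕ × X)
  | 0, c, x => PMF.pure (c, x)
  | m + 1, c, x => G.bind fun q => (dr q x).bind fun o =>
    open Classical in
    countGood G dr good m (if good o.1 then c + 1 else c) o.2

/-- Store the answer to a query. -/
def AS.answer {X : Type*} (σ : AS X) (a : ℕ) (v w : ℝ) (x : X) : AS X :=
  ⟨Function.update (Function.update σ.mem a v) (a + 1) w, σ.clock, x⟩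

/-- The effect of the additional instructions of a learning algorithm with access to the
distribution of the queries with good values.  The auxiliary component consists of the number
of values that may still be requested, and of the record of values. -/
def simulate (enc : Q ↪ ℕ) (G : PMF Q) (dr : Q → X → PMF (V × X)) (good : V → Prop)
    (lab : V → ℝ) (η : ℝ) : Effect LearnOracle → AS (ℕ × X) → PMF (AS (ℕ × X))
  | .toss a x, σ => (coin (σ.mem x)).map fun c => σ.write a (if c = true then 1 else 0)
  | .query .sample a _ _, σ => (trySample G dr good σ.aux.1 σ.aux.2).map fun o =>
    match o.1 with
    | none => σ.answer a 0 (-1) o.2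
    | some qv => σ.answer a (enc qv.1) (lab qv.2) o.2
  | .query .evaluate a x _, σ =>
    match decode enc (σ.mem x) with
    | none => PMF.pure (σ.answer a 0 (-1) σ.aux)
    | some q =>
      open Classical in
      if G q = 0 then PMF.pure (σ.answer a 0 (-1) σ.aux) else
      match σ.aux with
      | (0, x) => PMF.pure (σ.answer a 0 (-1) (0, x))
      | (r + 1, x) => (dr q x).map fun o =>
        if good o.1 then σ.answer a ((G q).toReal / η) (lab o.1) (r, o.2)
        else σ.answer a 0 (-1) (r, o.2)

/-- The memory left by a clocked run of a learning algorithm, together with the new record: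
`m` queries are used to estimate the mass of the good queries, and `r` values may be requested
during the run. -/
def learnOnce (enc : Q ↪ ℕ) (G : PMF Q) (dr : Q → X → PMF (V × X)) (good : V → Prop)
    (lab : V → ℝ) (p : Prog (Effect LearnOracle)) (M : ℕ → ℝ) (t m r : ℕ) (x : X) :
    PMF ((ℕ → ℝ) × X) :=
  (countGood G dr good m 0 x).bind fun o =>
    (aexec (simulate enc G dr good lab (o.1 / m)) p ⟨M, t, (r, o.2)⟩).map fun σ =>
      (σ.mem, σ.aux.2)

/-- Consecutive runs that pass on a record. -/
def runAll (run : ℕ → X → PMF ((ℕ → ℝ) × X)) : ℕ → X → PMF ((ℕ → ℕ → ℝ) × X)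
  | 0, x => PMF.pure (fun _ _ => 0, x)
  | j + 1, x => (runAll run j x).bind fun o => (run j o.2).map fun o' =>
    (Function.update o.1 j o'.1, o'.2)

end Access

/-! ### From the cost of a single draw to the cost of all runs of the learner. -/

section AccessTransfer
variable {Q V X Y : Type*} {κ : X → PMF Y} {c d : ℕ → ℝ≥0∞} {drA : Q → X → PMF (V × X)}
  {drB : Q → Y → PMF (V × Y)}

/-- Averaging over a kernel, followed by an affine map that depends on the number of values that
may still be requested. -/
def avg (κ : X → PMF Y) (c d : ℕ → ℝ≥0∞) (r : ℕ) (F : Y → ℝ≥0∞) (x : X) : ℝ≥0∞ :=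
  c r * expect (κ x) F + d r

theorem avg_mono {r : ℕ} {F F' : Y → ℝ≥0∞} (h : ∀ y, F y ≤ F' y) (x : X) :
    avg κ c d r F x ≤ avg κ c d r F' x :=
  add_le_add (mul_le_mul_right (expect_mono h) _) le_rfl

theorem expect_avg {ι : Type*} (μ : PMF ι) (r : ℕ) (F : ι → Y → ℝ≥0∞) (x : X) :
    expect μ (fun i => avg κ c d r (F i) x) = avg κ c d r (fun y => expect μ fun i => F i y) x := by
  simp only [avg]
  rw [expect_add, expect_const_mul, expect_const, expect_comm]

/-- Every request for a value costs one unit. -/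
def DrawTransfer (κ : X → PMF Y) (c d : ℕ → ℝ≥0∞) (drA : Q → X → PMF (V × X))
    (drB : Q → Y → PMF (V × Y)) : Prop :=
  ∀ (q : Q) (r : ℕ) (x : X) (F : V → Y → ℝ≥0∞), (∀ v y, F v y ≤ 1) →
    expect (drA q x) (fun o => avg κ c d r (F o.1) o.2) ≤
      avg κ c d (r + 1) (fun y => expect (drB q y) fun o => F o.1 o.2) x

/-- Each attempt requests one value and lowers the remaining number by one, which is what
`DrawTransfer` charges. The number left at the end is random, so `F` depends on it. -/
theorem expect_trySample_avg (hd : DrawTransfer κ c d drA drB) (G : PMF Q) (good : V → Prop)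
    (r : ℕ) : ∀ (x : X) (F : Option (Q × V) → ℕ → Y → ℝ≥0∞), (∀ o r y, F o r y ≤ 1) →
    expect (trySample G drA good r x) (fun o => avg κ c d o.2.1 (F o.1 o.2.1) o.2.2) ≤
      avg κ c d r (fun y => expect (trySample G drB good r y) fun o => F o.1 o.2.1 o.2.2) x := by
  classical
  induction r with
  | zero => intro x F _; simp [trySample, avg]
  | succ r ih =>
    intro x F hF
    simp only [trySample, expect_bind]
    rw [← expect_avg]
    refine expect_mono fun q => ?_
    refine le_trans (expect_mono fun o => ?_) ((hd q r x (fun v y => if good v then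
      F (some (q, v)) r y else expect (trySample G drB good r y) fun o => F o.1 o.2.1 o.2.2)
      ?_).trans (avg_mono (fun y => expect_mono fun o => ?_) x))
    · by_cases hg : good o.1
      · simp [hg]
      · simpa [hg] using ih o.2 F hF
    · intro v y
      split_ifs
      · exact hF _ _ _
      · exact expect_le_of_le fun _ => hF _ _ _
    · by_cases hg : good o.1 <;> simp [hg]

theorem expect_countGood_avg (hd : DrawTransfer κ c d drA drB) (G : PMF Q) (good : V → Prop)
    (r m : ℕ) : ∀ (i : ℕ) (x : X) (F : ℕ → Y → ℝ≥0∞), (∀ i y, F i y ≤ 1) →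
    expect (countGood G drA good m i x) (fun o => avg κ c d r (F o.1) o.2) ≤
      avg κ c d (r + m) (fun y => expect (countGood G drB good m i y) fun o => F o.1 o.2) x := by
  classical
  induction m with
  | zero => intro i x F _; simp [countGood, avg]
  | succ m ih =>
    intro i x F hF
    simp only [countGood, expect_bind]
    rw [← expect_avg]
    refine expect_mono fun q => le_trans (expect_mono fun o => ih _ o.2 F hF) ?_
    exact hd q (r + m) x (fun v y => expect (countGood G drB good m (if good v then i + 1 else i) y)
      fun o => F o.1 o.2) fun v y => expect_le_of_le fun _ => hF _ _

/-- The kernel acts on the record only and leaves the remaining number alone; that number determines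
the coefficients of the affine map. Tosses and unanswerable queries cost nothing. -/
theorem expect_simulate_lift (hd : DrawTransfer κ c d drA drB) (enc : Q ↪ ℕ) (G : PMF Q)
    (good : V → Prop) (lab : V → ℝ) (η : ℝ) (e : Effect LearnOracle) (F : AS (ℕ × Y) → ℝ≥0∞)
    (hF : ∀ σ, F σ ≤ 1) (σ : AS (ℕ × X)) :
    expect (simulate enc G drA good lab η e σ)
      (AS.lift (fun x => (κ x.2).map (Prod.mk x.1)) (fun x => c x.1) (fun x => d x.1) F) ≤
    AS.lift (fun x => (κ x.2).map (Prod.mk x.1)) (fun x => c x.1) (fun x => d x.1)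
      (fun σ => expect (simulate enc G drB good lab η e σ) F) σ := by
  classical
  obtain ⟨M, cl, r, x⟩ := σ
  cases e with
  | toss a b =>
    simp only [simulate, AS.lift, expect_map, AS.write]
    exact (expect_avg (coin (M b)) r (fun i y =>
      F ⟨Function.update M a (if i = true then 1 else 0), cl, (r, y)⟩) x).le
  | query i a b b' =>
    cases i with
    | sample =>
      simp only [simulate, AS.lift, expect_map]
      refine le_trans (expect_mono fun o => ?_) ((expect_trySample_avg hd G good r x
        (fun o r y => F (match o with
          | none => AS.answer (⟨M, cl, (r, y)⟩ : AS (ℕ × Y)) a 0 (-1) (r, y)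
          | some qv => AS.answer (⟨M, cl, (r, y)⟩ : AS (ℕ × Y)) a (enc qv.1) (lab qv.2) (r, y)))
        (fun _ _ _ => hF _)).trans (avg_mono (fun y => expect_mono fun o => ?_) x))
      · obtain ⟨o, r', x'⟩ := o
        cases o <;> simp [avg, AS.answer]
      · obtain ⟨o, r', x'⟩ := o
        cases o <;> simp [AS.answer]
    | evaluate =>
      simp only [simulate, AS.lift, expect_map]
      cases hq : decode enc (M b) with
      | none => simp [AS.answer, AS.lift]
      | some q =>
        by_cases hG : G q = 0
        · simp [hG, AS.answer, AS.lift]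
        · cases r with
          | zero => simp [hG, AS.answer, AS.lift]
          | succ r =>
            simp only [hG, if_false, expect_map]
            refine le_trans (expect_mono fun o => ?_) ((hd q r x (fun v y => F (if good v then
              AS.answer (⟨M, cl, (r, y)⟩ : AS (ℕ × Y)) a ((G q).toReal / η) (lab v) (r, y) else
              AS.answer (⟨M, cl, (r, y)⟩ : AS (ℕ × Y)) a 0 (-1) (r, y)))
              (fun _ _ => hF _)).trans (avg_mono (fun y => expect_mono fun o => ?_) x))
            · by_cases hg : good o.1 <;> simp [hg, avg, AS.answer, AS.lift]
            · by_cases hg : good o.1 <;> simp [hg, AS.answer]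

/-- The estimate of the mass takes `m` values and the run at most `r`. Values left over at the end
are given up, which is where `1 ≤ c r` enters. -/
theorem expect_learnOnce_avg (hd : DrawTransfer κ c d drA drB) (hc : ∀ r, 1 ≤ c r) (enc : Q ↪ ℕ)
    (G : PMF Q) (good : V → Prop) (lab : V → ℝ) (p : Prog (Effect LearnOracle)) (M : ℕ → ℝ)
    (t m r : ℕ) (x : X) (F : (ℕ → ℝ) → Y → ℝ≥0∞) (hF : ∀ M y, F M y ≤ 1) :
    expect (learnOnce enc G drA good lab p M t m r x) (fun o => expect (κ o.2) (F o.1)) ≤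
      avg κ c d (r + m)
        (fun y => expect (learnOnce enc G drB good lab p M t m r y) fun o => F o.1 o.2) x := by
  simp only [learnOnce, expect_bind, expect_map]
  refine le_trans (expect_mono fun o => ?_) (expect_countGood_avg hd G good r m 0 x (fun i y =>
    expect (aexec (simulate enc G drB good lab (i / m)) p ⟨M, t, (r, y)⟩)
      fun σ => F σ.mem σ.aux.2) fun i y => expect_le_of_le fun _ => hF _ _)
  refine le_trans (expect_mono fun σ => ?_) ((expect_aexec_lift
    (expect_simulate_lift hd enc G good lab (o.1 / m)) p (fun σ => F σ.mem σ.aux.2)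
    (fun _ => hF _ _) ⟨M, t, (r, o.2)⟩).trans ?_)
  · simp only [AS.lift, expect_map]
    exact le_trans (le_mul_of_one_le_left zero_le (hc _)) le_self_add
  · simp [AS.lift, avg]

/-- The last run is replaced first; the expectation over it is again a function bounded by one, to
which the induction hypothesis applies. Factors multiply and additive losses form a geometric sum.
-/
theorem expect_runAll_le {runA : ℕ → X → PMF ((ℕ → ℝ) × X)} {runB : ℕ → Y → PMF ((ℕ → ℝ) × Y)}
    {C D : ℝ≥0∞}
    (h : ∀ (j : ℕ) (x : X) (F : (ℕ → ℝ) → Y → ℝ≥0∞), (∀ M y, F M y ≤ 1) →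
      expect (runA j x) (fun o => expect (κ o.2) (F o.1)) ≤
        C * expect (κ x) (fun y => expect (runB j y) fun o => F o.1 o.2) + D) (j : ℕ) :
    ∀ (x : X) (F : (ℕ → ℕ → ℝ) → Y → ℝ≥0∞), (∀ M y, F M y ≤ 1) →
      expect (runAll runA j x) (fun o => expect (κ o.2) (F o.1)) ≤
        C ^ j * expect (κ x) (fun y => expect (runAll runB j y) fun o => F o.1 o.2) +
          (∑ i ∈ Finset.range j, C ^ i) * D := by
  induction j with
  | zero => intro x F _; simp [runAll]
  | succ j ih =>
    intro x F hF
    simp only [runAll, expect_bind, expect_map]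
    refine le_trans (expect_mono fun o => h j o.2 (fun M y => F (Function.update o.1 j M) y)
      fun _ _ => hF _ _) ?_
    rw [expect_add, expect_const_mul, expect_const]
    refine (add_le_add (mul_le_mul_right (ih x (fun S y => expect (runB j y)
      fun o => F (Function.update S j o.1) o.2) fun _ _ => expect_le_of_le fun _ => hF _ _) C)
      le_rfl).trans_eq ?_
    rw [geom_sum_succ]
    ring

end AccessTransfer

/-! ## Lazily drawn random functions -/

section Lazy
variable {Q V : Type*}

/-- The value at `q` of a random function with independent values, given a record of the values
that have been drawn before. -/
def lazyDraw (μ : Q → PMF V) (q : Q) (T : Q → Option V) : PMF (V × (Q → Option V)) :=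
  open Classical in
  match T q with
  | some v => PMF.pure (v, T)
  | none => (μ q).map fun v => (v, Function.update T q (some v))

/-- The value at `q` of a given function. -/
def fixedDraw (q : Q) (a : Q → V) : PMF (V × (Q → V)) := PMF.pure (a q, a)

/-- A random function with independent values. -/
def piPMF [Fintype Q] [Fintype V] (ν : Q → PMF V) : PMF (Q → V) :=
  open Classical in
  PMF.ofFintype (fun a => ∏ q, ν q (a q)) (by
    classical
    have h := Finset.prod_univ_sum (fun _ : Q => (Finset.univ : Finset V)) (fun q v => ν q v)
    rw [Fintype.piFinset_univ] at h
    rw [← h]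
    refine Finset.prod_eq_one fun q _ => ?_
    rw [← (ν q).tsum_coe, tsum_fintype])

/-- The law of a random function given the values on record. -/
def completion [Fintype Q] [Fintype V] (μ : Q → PMF V) (T : Q → Option V) : PMF (Q → V) :=
  piPMF fun q => (T q).elim (μ q) PMF.pure

theorem piPMF_apply [Fintype Q] [Fintype V] (ν : Q → PMF V) (a : Q → V) :
    piPMF ν a = ∏ q, ν q (a q) := rfl

theorem lazyDraw_some {μ : Q → PMF V} {q : Q} {T : Q → Option V} {v : V} (h : T q = some v) :
    lazyDraw μ q T = PMF.pure (v, T) := by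
  simp only [lazyDraw]; split <;> simp_all

open Classical in
theorem lazyDraw_none {μ : Q → PMF V} {q : Q} {T : Q → Option V} (h : T q = none) :
    lazyDraw μ q T = (μ q).map fun v => (v, Function.update T q (some v)) := by
  simp only [lazyDraw]; split <;> simp_all

/-- The instance for privacy. A fresh value costs a factor `C`; a value on record is the same on
both sides, and charging for it is harmless as `1 ≤ C`. -/
theorem drawTransfer_of_le_mul {μ μ' : Q → PMF V} {C : ℝ≥0∞} (hC : 1 ≤ C)
    (h : ∀ q v, μ q v ≤ C * μ' q v) :
    DrawTransfer PMF.pure (fun r => C ^ r) (fun _ => 0) (lazyDraw μ) (lazyDraw μ') := by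
  classical
  intro q r T F _
  cases hT : T q with
  | some v =>
    simp only [avg, lazyDraw_some hT, expect_pure, add_zero]
    exact mul_le_mul_left (pow_le_pow_right₀ hC (Nat.le_succ r)) _
  | none =>
    simp only [avg, lazyDraw_none hT, expect_pure, expect_map, add_zero]
    rw [expect_const_mul, pow_succ, mul_assoc]
    refine mul_le_mul_right ?_ _
    unfold expect
    rw [← ENNReal.tsum_mul_left]
    refine ENNReal.tsum_le_tsum fun v => ?_
    rw [← mul_assoc]
    exact mul_le_mul_left (h q v) _

/-- The instance for conditioning the noise to be small: each request loses at most `δ`. -/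
theorem drawTransfer_of_le_add {μ μ' : Q → PMF V} {δ : ℝ≥0∞}
    (h : ∀ q, ∀ F : V → ℝ≥0∞, (∀ v, F v ≤ 1) → expect (μ q) F ≤ expect (μ' q) F + δ) :
    DrawTransfer PMF.pure (fun _ => 1) (fun r => r * δ) (lazyDraw μ) (lazyDraw μ') := by
  classical
  intro q r T F hF
  cases hT : T q with
  | some v =>
    simp only [avg, lazyDraw_some hT, expect_pure, one_mul]
    gcongr
    simp
  | none =>
    simp only [avg, lazyDraw_none hT, expect_pure, expect_map, one_mul]
    rw [expect_add, expect_const]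
    refine (add_le_add (h q _ fun v => hF _ _) le_rfl).trans_eq ?_
    push_cast
    ring

/-- The principle of deferred decisions: drawing the value at `q` now and completing the function
later has the same law as drawing the whole function and reading it at `q`. -/
theorem drawTransfer_completion [Fintype Q] [Fintype V] (μ : Q → PMF V) :
    DrawTransfer (completion μ) (fun _ => 1) (fun _ => 0) (lazyDraw μ) fixedDraw := by
  classical
  intro q r T F _
  simp only [avg, fixedDraw, expect_pure, one_mul, add_zero]
  cases hT : T q with
  | some v =>
    simp only [lazyDraw_some hT, expect_pure]
    refine (tsum_congr fun a => ?_).le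
    by_cases ha : a q = v
    · simp only [ha]
    -- A function that contradicts the record has probability zero.
    · have : completion μ T a = 0 := by
        rw [completion, piPMF_apply]
        refine Finset.prod_eq_zero (Finset.mem_univ q) ?_
        simp [hT, PMF.pure_apply, ha]
      simp [this]
  | none =>
    simp only [lazyDraw_none hT, expect_map]
    unfold expect
    simp only [← ENNReal.tsum_mul_left]
    rw [ENNReal.tsum_comm]
    refine (tsum_congr fun a => ?_).le
    -- The function `a` can only be completed from the draw `v = a q`.
    rw [tsum_eq_single (a q)]
    · rw [← mul_assoc]
      congr 1
      simp only [completion, piPMF_apply]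
      rw [← Finset.mul_prod_erase _ _ (Finset.mem_univ q),
        ← Finset.mul_prod_erase (a := q) _ _ (Finset.mem_univ q)]
      simp only [Function.update_self, Option.elim, PMF.pure_apply, hT, if_true, one_mul]
      congr 1
      refine Finset.prod_congr rfl fun q' hq' => ?_
      rw [Function.update_of_ne (Finset.ne_of_mem_erase hq')]
    · intro v hv
      have : completion μ (Function.update T q (some v)) a = 0 := by
        rw [completion, piPMF_apply]
        refine Finset.prod_eq_zero (Finset.mem_univ q) ?_
        simp [PMF.pure_apply, hv.symm]
      simp [this]

theorem mem_support_of_completion [Fintype Q] [Fintype V] {μ : Q → PMF V} {a : Q → V}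
    (ha : a ∈ (completion μ fun _ => none).support) (q : Q) : a q ∈ (μ q).support := by
  classical
  rw [PMF.mem_support_iff] at ha ⊢
  rw [completion, piPMF_apply, Finset.prod_ne_zero_iff] at ha
  simpa using ha q (Finset.mem_univ q)

end Lazy

/-! ## Noisy counts -/

/-- The weight of `i` as a noisy version of the count `c`. -/
def countWeight (η c : ℝ) (i : ℕ) : ℝ := Real.exp (-(η * |(i : ℝ) - c|))

theorem countWeight_pos (η c : ℝ) (i : ℕ) : 0 < countWeight η c i := Real.exp_pos _

/-- The exponential mechanism for a count between `0` and `n`. -/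
def noisyCount (n : ℕ) (η c : ℝ) : PMF (Fin (n + 1)) :=
  PMF.normalize (fun i => ENNReal.ofReal (countWeight η c i))
    (by
      rw [tsum_fintype]
      refine (Finset.sum_pos_iff.2 ⟨0, Finset.mem_univ _, ?_⟩).ne'
      simpa using countWeight_pos η c _)
    (by rw [tsum_fintype]; exact ENNReal.sum_ne_top.2 fun _ _ => ENNReal.ofReal_ne_top)

theorem noisyCount_apply (n : ℕ) (η c : ℝ) (i : Fin (n + 1)) :
    noisyCount n η c i = ENNReal.ofReal (countWeight η c i) *
      (∑ i : Fin (n + 1), ENNReal.ofReal (countWeight η c i))⁻¹ := by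
  rw [noisyCount, PMF.normalize_apply, tsum_fintype]

theorem countWeight_le {η c c' : ℝ} (hη : 0 ≤ η) (hc : |c - c'| ≤ 1) (i : ℕ) :
    ENNReal.ofReal (countWeight η c i) ≤
      ENNReal.ofReal (Real.exp η) * ENNReal.ofReal (countWeight η c' i) := by
  rw [← ENNReal.ofReal_mul (Real.exp_pos _).le]
  refine ENNReal.ofReal_le_ofReal ?_
  rw [countWeight, countWeight, ← Real.exp_add]
  refine Real.exp_le_exp.2 ?_
  have h : |(i : ℝ) - c'| ≤ |(i : ℝ) - c| + 1 := by
    have := abs_sub_le (i : ℝ) c c'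
    linarith
  nlinarith

/-- The weights change by a factor of at most exp η, and so does the normalizing sum; together this
is exp(2η). -/
theorem noisyCount_le {n : ℕ} {η c c' : ℝ} (hη : 0 ≤ η) (hc : |c - c'| ≤ 1) (i : Fin (n + 1)) :
    noisyCount n η c i ≤ ENNReal.ofReal (Real.exp (2 * η)) * noisyCount n η c' i := by
  rw [noisyCount_apply, noisyCount_apply, two_mul, Real.exp_add,
    ENNReal.ofReal_mul (Real.exp_pos _).le]
  have h1 := countWeight_le hη hc i
  have h2 : (∑ i : Fin (n + 1), ENNReal.ofReal (countWeight η c i))⁻¹ ≤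
      ENNReal.ofReal (Real.exp η) *
        (∑ i : Fin (n + 1), ENNReal.ofReal (countWeight η c' i))⁻¹ := by
    have h3 : (∑ i : Fin (n + 1), ENNReal.ofReal (countWeight η c' i)) ≤
        ENNReal.ofReal (Real.exp η) * ∑ i : Fin (n + 1), ENNReal.ofReal (countWeight η c i) := by
      rw [Finset.mul_sum]
      exact Finset.sum_le_sum fun i _ => countWeight_le hη (by rwa [abs_sub_comm]) i
    have h4 := ENNReal.inv_le_inv.2 h3
    rw [ENNReal.mul_inv (Or.inl (by simpa using Real.exp_pos η)) (Or.inl ENNReal.ofReal_ne_top)]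
      at h4
    calc _ = ENNReal.ofReal (Real.exp η) * ((ENNReal.ofReal (Real.exp η))⁻¹ *
          (∑ i : Fin (n + 1), ENNReal.ofReal (countWeight η c i))⁻¹) := by
          rw [← mul_assoc, ENNReal.mul_inv_cancel (by simpa using Real.exp_pos η)
            ENNReal.ofReal_ne_top, one_mul]
      _ ≤ _ := mul_le_mul_right h4 _
  calc _ ≤ (ENNReal.ofReal (Real.exp η) * ENNReal.ofReal (countWeight η c' i)) *
        (ENNReal.ofReal (Real.exp η) *
          (∑ i : Fin (n + 1), ENNReal.ofReal (countWeight η c' i))⁻¹) := mul_le_mul' h1 h2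
    _ = _ := by ring

/-- If the members of `S` can be moved injectively closer to `c` by `r`, their total weight is at
most exp(-ηr) times the weight of their images, hence of everything. Applied to shifts, this bounds
each tail without computing the normalizing sum. -/
theorem sum_countWeight_le_of_injOn {n : ℕ} {η c r : ℝ} (hη : 0 ≤ η) (S : Finset (Fin (n + 1)))
    (f : Fin (n + 1) → Fin (n + 1)) (hf : Set.InjOn f S)
    (h : ∀ i ∈ S, |((f i : ℕ) : ℝ) - c| + r ≤ |((i : ℕ) : ℝ) - c|) :
    ∑ i ∈ S, ENNReal.ofReal (countWeight η c i) ≤ ENNReal.ofReal (Real.exp (-(η * r))) *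
      ∑ i : Fin (n + 1), ENNReal.ofReal (countWeight η c i) := by
  classical
  calc _ ≤ ∑ i ∈ S, ENNReal.ofReal (Real.exp (-(η * r))) *
        ENNReal.ofReal (countWeight η c (f i)) := by
        refine Finset.sum_le_sum fun i hi => ?_
        rw [← ENNReal.ofReal_mul (Real.exp_pos _).le, countWeight, countWeight, ← Real.exp_add]
        refine ENNReal.ofReal_le_ofReal (Real.exp_le_exp.2 ?_)
        nlinarith [mul_le_mul_of_nonneg_left (h i hi) hη]
    _ = ENNReal.ofReal (Real.exp (-(η * r))) *
        ∑ i ∈ S.image f, ENNReal.ofReal (countWeight η c i) := by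
        rw [← Finset.mul_sum, Finset.sum_image hf]
    _ ≤ _ := mul_le_mul_right (Finset.sum_le_univ_sum_of_nonneg fun _ => zero_le) _

/-- Noisy counts are close to the count with high probability. -/
theorem noisyCount_tail {n c : ℕ} {η r : ℝ} (hη : 0 ≤ η) (hr : 0 ≤ r) (hc : c ≤ n) :
    (noisyCount n η c).toOuterMeasure {i | r < |((i : ℕ) : ℝ) - c|} ≤
      2 * ENNReal.ofReal (Real.exp (-(η * r))) := by
  classical
  -- Counts are integers, so a distance above `r` is a distance of at least `R`; shifting by the
  -- integer `R` stays among the counts.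
  set R : ℕ := ⌊r⌋₊ + 1 with hR
  have hrR : r ≤ R := by rw [hR]; push_cast; exact (Nat.lt_floor_add_one r).le
  have key : ∀ (m k : ℕ), r < (m : ℝ) - k → k + R ≤ m := by
    intro m k h
    have h1 : (0 : ℝ) ≤ (m : ℝ) - k := by linarith
    have h2 : k ≤ m := by exact_mod_cast (by linarith : (k : ℝ) ≤ m)
    have h3 : ⌊r⌋₊ < m - k := by
      rw [Nat.floor_lt hr, Nat.cast_sub h2]; exact h
    omega
  set Z := ∑ i : Fin (n + 1), ENNReal.ofReal (countWeight η c i) with hZ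
  have hZ0 : Z ≠ 0 := by
    refine (Finset.sum_pos_iff.2 ⟨0, Finset.mem_univ _, ?_⟩).ne'
    simpa using countWeight_pos η c _
  have hZt : Z ≠ ⊤ := ENNReal.sum_ne_top.2 fun _ _ => ENNReal.ofReal_ne_top
  have up := sum_countWeight_le_of_injOn (n := n) (c := c) (r := r) hη
    (Finset.univ.filter fun i : Fin (n + 1) => c + R ≤ (i : ℕ))
    (fun i => ⟨i - R, by omega⟩) (by
      intro i hi j hj hij
      simp only [Finset.coe_filter, Finset.mem_univ, true_and, Set.mem_ofPred_eq,
        Fin.mk.injEq] at hi hj hij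
      exact Fin.ext (by omega)) (by
      intro i hi
      simp only [Finset.mem_filter, Finset.mem_univ, true_and] at hi
      have h1 : ((c : ℝ) + R) ≤ (i : ℕ) := by exact_mod_cast hi
      simp only
      rw [Nat.cast_sub (by omega), abs_of_nonneg (by linarith), abs_of_nonneg (by linarith)]
      linarith)
  have down := sum_countWeight_le_of_injOn (n := n) (c := c) (r := r) hη
    (Finset.univ.filter fun i : Fin (n + 1) => (i : ℕ) + R ≤ c)
    -- The minimum only makes the shift total; on the set in question `i + R ≤ c ≤ n`.
    (fun i => ⟨min (i + R) n, by omega⟩) (by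
      intro i hi j hj hij
      simp only [Finset.coe_filter, Finset.mem_univ, true_and, Set.mem_ofPred_eq,
        Fin.mk.injEq] at hi hj hij
      exact Fin.ext (by omega)) (by
      intro i hi
      simp only [Finset.mem_filter, Finset.mem_univ, true_and] at hi
      have h1 : (((i : ℕ) : ℝ) + R) ≤ c := by exact_mod_cast hi
      simp only
      rw [min_eq_left (by omega), Nat.cast_add, abs_of_nonpos (by linarith),
        abs_of_nonpos (by linarith)]
      linarith)
  have hsum : (noisyCount n η c).toOuterMeasure {i | r < |((i : ℕ) : ℝ) - c|} ≤
      (∑ i ∈ Finset.univ.filter (fun i : Fin (n + 1) => c + R ≤ (i : ℕ)),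
        ENNReal.ofReal (countWeight η c i)) * Z⁻¹ +
      (∑ i ∈ Finset.univ.filter (fun i : Fin (n + 1) => (i : ℕ) + R ≤ c),
        ENNReal.ofReal (countWeight η c i)) * Z⁻¹ := by
    rw [PMF.toOuterMeasure_apply, tsum_fintype, Finset.sum_mul, Finset.sum_mul,
      Finset.sum_filter, Finset.sum_filter, ← Finset.sum_add_distrib]
    refine Finset.sum_le_sum fun i _ => ?_
    by_cases hi : r < |((i : ℕ) : ℝ) - c|
    · rw [Set.indicator_of_mem (by exact hi), noisyCount_apply]
      rcases lt_abs.1 hi with h | h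
      · rw [if_pos (key _ _ h)]
        exact le_self_add
      · rw [if_pos (key c i (by linarith))]
        exact le_add_self
    · rw [Set.indicator_of_notMem (by exact hi)]
      exact zero_le
  refine hsum.trans ((add_le_add (mul_le_mul_left up _) (mul_le_mul_left down _)).trans_eq ?_)
  rw [mul_assoc, ENNReal.mul_inv_cancel hZ0 hZt]
  ring

/-- Conditioning on a likely event changes expectations only slightly. -/
theorem expect_le_expect_filter {V : Type*} (μ : PMF V) (S : Set V) (h : ∃ v ∈ S, v ∈ μ.support)
    {δ : ℝ≥0∞} (hS : μ.toOuterMeasure Sᶜ ≤ δ) (F : V → ℝ≥0∞) (hF : ∀ v, F v ≤ 1) :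
    expect μ F ≤ expect (μ.filter S h) F + δ := by
  refine le_trans ?_ (add_le_add le_rfl hS)
  unfold expect
  rw [PMF.toOuterMeasure_apply, ← ENNReal.tsum_add]
  refine ENNReal.tsum_le_tsum fun v => ?_
  rw [PMF.filter_apply]
  -- On `S` conditioning divides by a mass of at most one and so only raises weights. Off `S` the
  -- weight is charged to `δ`.
  by_cases hv : v ∈ S
  · rw [Set.indicator_of_mem hv, Set.indicator_of_notMem (fun h : v ∈ Sᶜ => h hv), add_zero, mul_right_comm]
    refine le_mul_of_one_le_right zero_le ?_
    rw [ENNReal.one_le_inv]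
    refine (ENNReal.tsum_le_tsum fun v => ?_).trans_eq μ.tsum_coe
    exact Set.indicator_le_self _ _ _
  · rw [Set.indicator_of_mem (show v ∈ Sᶜ from hv)]
    exact (mul_le_of_le_one_right zero_le (hF v)).trans le_add_self

/-! ## Comparison of clocked runs with ordinary runs -/

/-- The function `H` on states within the limits on time and queries, and infinity elsewhere. -/
def cap (t B : ℕ) (H : State → ℝ≥0∞) (s : State) : ℝ≥0∞ :=
  open Classical in
  if s.time ≤ t ∧ s.queries ≤ B then H s else ⊤

theorem expect_eq_top {α : Type*} {μ : PMF α} {F : α → ℝ≥0∞} (h : ∀ x ∈ μ.support, F x = ⊤) :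
    expect μ F = ⊤ :=
  top_le_iff.1 ((expect_const μ ⊤).symm.le.trans (expect_mono_support fun x hx => (h x hx).ge))

theorem cap_of_le {t B : ℕ} {H : State → ℝ≥0∞} {s : State} (h : s.time ≤ t) (h' : s.queries ≤ B) :
    cap t B H s = H s := if_pos ⟨h, h'⟩

theorem cap_eq_top {t B : ℕ} {H : State → ℝ≥0∞} {s : State} (h : t < s.time ∨ B < s.queries) :
    cap t B H s = ⊤ := if_neg (by omega)

section Compare
variable {E : Type} {X : Type*} {hI : E → State → PMF State}
  {hA : E → AS X → PMF (AS X)} {t B : ℕ} {W : X → ℕ → ℝ≥0∞}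

/-- Every program takes at least one step, so at time `t` it is already too late to finish within
the limit. -/
theorem wp_cap_eq_top (hh : ∀ e s s', s' ∈ (hI e s).support → s.Reaches s') {k : ℕ}
    {H : State → ℝ≥0∞} {s : State} (h : t ≤ s.time ∨ B < s.queries) (p : Prog E) :
    wp hI k p (cap t B H) s = ⊤ := by
  refine expect_eq_top fun o ho => ?_
  cases o with
  | none => rfl
  | some s' =>
    obtain ⟨h1, h2, -⟩ := reaches_of_mem_support_exec hh k p s s' ho
    exact cap_eq_top (by omega)

theorem wpLoop_cap_eq_top (hh : ∀ e s s', s' ∈ (hI e s).support → s.Reaches s') {k : ℕ}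
    {H : State → ℝ≥0∞} {s : State} (h : t ≤ s.time ∨ B < s.queries) (x y : ℕ) (p : Prog E)
    (j : ℕ) : wpLoop hI k x y p (cap t B H) j s = ⊤ := by
  refine expect_eq_top fun o ho => ?_
  cases o with
  | none => rfl
  | some s' =>
    obtain ⟨h1, h2, -⟩ :=
      reaches_of_mem_support_runLoop (reaches_of_mem_support_exec hh k p) j s s' ho
    exact cap_eq_top (by omega)

/-- The states of a clocked and an ordinary run agree. -/
def AS.Matches (t : ℕ) (σ : AS X) (s : State) : Prop := σ.mem = s.mem ∧ σ.clock + s.time = t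

/-- The clocked version `f` of a process is as likely to end well as the process itself, up to an
error `W`, if there is time for at least `d` more steps. -/
def Approximates (t B : ℕ) (W : X → ℕ → ℝ≥0∞) (d : ℕ) (f : AS X → PMF (AS X))
    (g : (State → ℝ≥0∞) → State → ℝ≥0∞) : Prop :=
  ∀ (F : AS X → ℝ≥0∞) (H : State → ℝ≥0∞) (σ : AS X) (s : State), (∀ σ, F σ ≤ 1) →
    σ.mem = s.mem → σ.clock + s.time + d = t → s.queries ≤ B →
    (∀ σ' s', σ'.Matches t s' → s.time + d ≤ s'.time → s'.time ≤ t → s'.queries ≤ B →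
      F σ' ≤ H s' + W σ'.aux s'.queries) →
    expect (f σ) F ≤ g (cap t B H) s + W σ.aux s.queries

/-- A clocked process stops only when the ordinary one has reached time `t`. The bound for the
latter is then infinite, so stopping early needs no argument. -/
theorem Approximates.step {f : AS X → PMF (AS X)} {g : (State → ℝ≥0∞) → State → ℝ≥0∞}
    (hg : ∀ H s, t ≤ s.time → g (cap t B H) s = ⊤) (h : Approximates t B W 1 f g) :
    Approximates t B W 0 (fun σ => σ.step f) g := by
  intro F H σ s hF hm hc hq hFH
  simp only [AS.step]
  split_ifs with h0
  · rw [hg H s (by omega)]; simp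
  · exact h F H ⟨σ.mem, σ.clock - 1, σ.aux⟩ s hF hm (by simp only; omega) hq
      fun σ' s' h1 h2 h3 h4 => hFH σ' s' h1 (by omega) h3 h4

/-- The bound `c` of the clocked loop is no smaller than the clock, so the clock runs out first. The
bound `j` of the ordinary loop may be anything, since a loop that is cut off counts as infinite. -/
theorem approximates_loop (hh : ∀ e s s', s' ∈ (hI e s).support → s.Reaches s') {k : ℕ}
    {p : Prog E} {x y : ℕ} {f : AS X → PMF (AS X)}
    (h : Approximates t B W 0 f (wp hI k p)) (F : AS X → ℝ≥0∞) (H : State → ℝ≥0∞)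
    (hF : ∀ σ, F σ ≤ 1) (j : ℕ) : ∀ (c : ℕ) (σ : AS X) (s : State),
    σ.mem = s.mem → σ.clock + s.time = t → t ≤ c + s.time → s.queries ≤ B →
    (∀ σ' s', σ'.Matches t s' → s.time ≤ s'.time → s'.time ≤ t → s'.queries ≤ B →
      F σ' ≤ H s' + W σ'.aux s'.queries) →
    expect (aloop (fun M => M x < M y) f c σ) F ≤
      wpLoop hI k x y p (cap t B H) j s + W σ.aux s.queries := by
  induction j with
  | zero => intro c σ s _ _ _ _ _; simp
  | succ j ih =>
    intro c σ s hm hc hct hq hFH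
    by_cases h0 : σ.clock = 0
    · rw [wpLoop_cap_eq_top hh (by omega)]; simp
    obtain ⟨c, rfl⟩ : ∃ c', c = c' + 1 := ⟨c - 1, by omega⟩
    simp only [aloop, AS.step, h0, if_false]
    rw [wpLoop_succ, ← hm]
    split_ifs with ht
    · rw [expect_bind]
      refine (h _ (wpLoop hI k x y p (cap t B H) j) ⟨σ.mem, σ.clock - 1, σ.aux⟩
        ⟨s.mem, s.time + 1, s.queries⟩ (fun σ => expect_le_of_le hF) hm (by simp only; omega) hq
        ?_).trans (add_le_add ((wp_mono (fun s' => ?_) p).trans_eq (by rw [hm])) le_rfl)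
      · intro σ' s' h1 h2 h3 h4
        simp only at h2
        exact ih c σ' s' h1.1 h1.2 (by omega) h4 fun σ'' s'' h5 h6 h7 h8 =>
          hFH σ'' s'' h5 (by omega) h7 h8
      · simp only [cap]
        split_ifs with hs
        · exact le_rfl
        · exact (wpLoop_cap_eq_top hh (by omega) x y p j).ge
    · rw [expect_pure, cap_of_le (t := t) (s := ⟨σ.mem, s.time + 1, s.queries⟩) (by simp only; omega) hq]
      exact hFH ⟨σ.mem, σ.clock - 1, σ.aux⟩ ⟨σ.mem, s.time + 1, s.queries⟩
        ⟨rfl, by simp only; omega⟩ (by simp only; omega) (by simp only; omega) hq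

theorem approximates_aexec (hh : ∀ e s s', s' ∈ (hI e s).support → s.Reaches s')
    (hact : ∀ e, Approximates t B W 1 (hA e) (fun Q s => expect (hI e s) Q)) (k : ℕ)
    (p : Prog E) : Approximates t B W 0 (aexec hA p) (wp hI k p) := by
  have htop : ∀ (p : Prog E) (H : State → ℝ≥0∞) (s : State), t ≤ s.time →
      wp hI k p (cap t B H) s = ⊤ := fun p H s h => wp_cap_eq_top hh (Or.inl h) p
  -- Instructions that only transform the memory act by the same function on both sides, and one
  -- tick of the clock matches one step.
  have hins : ∀ {p : Prog E} (f : (ℕ → ℝ) → ℕ → ℝ),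
      (∀ H s, wp hI k p H s = H ⟨f s.mem, s.time + 1, s.queries⟩) →
      Approximates t B W 0
        (fun σ => σ.step fun σ => PMF.pure ⟨f σ.mem, σ.clock, σ.aux⟩) (wp hI k p) := by
    intro p f hp
    refine Approximates.step (htop p) fun F H σ s _ hm hc hq hFH => ?_
    rw [expect_pure, hp, cap_of_le (t := t) (s := ⟨f s.mem, s.time + 1, s.queries⟩) (by simp only; omega) hq]
    exact hFH _ _ ⟨by rw [hm], by simp only; omega⟩ le_rfl (by simp only; omega) hq
  induction p with
  | const a c => exact hins (fun M => Function.update M a c) fun H s => wp_const ..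
  | arith o a x y =>
    exact hins (fun M => Function.update M a (o.apply (M x) (M y))) fun H s => wp_arith ..
  | load a x => exact hins (fun M => Function.update M a (M ⌊M x⌋₊)) fun H s => wp_load ..
  | store a x => exact hins (fun M => Function.update M ⌊M a⌋₊ (M x)) fun H s => wp_store ..
  | act e =>
    have := (hact e).step (fun H s hs => by simpa [wp_act] using htop (.act e) H s hs)
    simpa only [Approximates, aexec, wp_act] using this
  | seq p r ihp ihr =>
    refine Approximates.step (htop _) fun F H σ s hF hm hc hq hFH => ?_
    rw [expect_bind, wp_seq]
    refine (ihp _ (wp hI k r (cap t B H)) σ ⟨s.mem, s.time + 1, s.queries⟩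
      (fun σ => expect_le_of_le hF) hm (by simp only; omega) hq ?_).trans
      (add_le_add (wp_mono (fun s' => ?_) p) le_rfl)
    · intro σ' s' h1 h2 h3 h4
      simp only at h2
      exact ihr F H σ' s' hF h1.1 h1.2 h4 fun σ'' s'' h5 h6 h7 h8 =>
        hFH σ'' s'' h5 (by omega) h7 h8
    · simp only [cap]
      split_ifs with hs
      · exact le_rfl
      · exact (wp_cap_eq_top hh (by omega) r).ge
  | ite x y p r ihp ihr =>
    refine Approximates.step (htop _) fun F H σ s hF hm hc hq hFH => ?_
    rw [wp_ite, ← hm]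
    split_ifs
    · exact ihp F H σ ⟨σ.mem, s.time + 1, s.queries⟩ hF rfl (by simp only; omega) hq
        fun σ' s' h1 h2 => hFH σ' s' h1 h2
    · exact ihr F H σ ⟨σ.mem, s.time + 1, s.queries⟩ hF rfl (by simp only; omega) hq
        fun σ' s' h1 h2 => hFH σ' s' h1 h2
  | loop x y p ih =>
    intro F H σ s hF hm hc hq hFH
    rw [wp_loop]
    exact approximates_loop hh ih F H hF k _ σ s hm hc (by omega) hq
      fun σ' s' h1 h2 => hFH σ' s' h1 (by omega)

end Compare

/-! ## Simulated access with a fixed function approximates restricted access -/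

section Restricted
variable {Q V : Type*}

/-- The probability of an event as an expectation. -/
def prob (G : PMF Q) (S : Set Q) : ℝ≥0∞ := expect G (S.indicator 1)

theorem prob_eq (G : PMF Q) (S : Set Q) : prob G S = G.toOuterMeasure S := expect_indicator G S

theorem prob_add_compl (G : PMF Q) (S : Set Q) : prob G S + prob G Sᶜ = 1 := by
  rw [prob, prob, ← expect_add]
  refine (tsum_congr fun q => ?_).trans (expect_const G 1)
  by_cases hq : q ∈ S <;> simp [hq]

theorem prob_le_one (G : PMF Q) (S : Set Q) : prob G S ≤ 1 :=
  (prob_add_compl G S) ▸ le_self_add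

theorem prob_mono (G : PMF Q) {S S' : Set Q} (h : S ⊆ S') : prob G S ≤ prob G S' :=
  expect_mono fun q => Set.indicator_le_indicator_of_subset h (fun _ => zero_le) q

theorem prob_eq_tsum (G : PMF Q) (S : Set Q) : prob G S = ∑' q, S.indicator G q := by
  rw [prob_eq, PMF.toOuterMeasure_apply]

theorem exists_of_prob_ne_zero {G : PMF Q} {S : Set Q} (h : prob G S ≠ 0) :
    ∃ q ∈ S, q ∈ G.support := by
  by_contra! hc
  refine h ?_
  rw [prob_eq_tsum, ENNReal.tsum_eq_zero]
  intro q
  by_cases hq : q ∈ S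
  · simpa [hq] using hc q hq
  · simp [hq]

theorem prob_ne_zero {G : PMF Q} {S : Set Q} (h : ∃ q ∈ S, q ∈ G.support) : prob G S ≠ 0 := by
  obtain ⟨q, hq, hG⟩ := h
  rw [prob_eq_tsum]
  intro h0
  rw [ENNReal.tsum_eq_zero] at h0
  have := h0 q
  rw [Set.indicator_of_mem hq] at this
  exact hG this

theorem filter_apply_eq (G : PMF Q) (S : Set Q) (h : ∃ q ∈ S, q ∈ G.support) (q : Q) :
    G.filter S h q = S.indicator G q * (prob G S)⁻¹ := by
  rw [PMF.filter_apply, prob_eq_tsum]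

theorem expect_indicator_mul (G : PMF Q) (S : Set Q) (h : ∃ q ∈ S, q ∈ G.support)
    (F : Q → ℝ≥0∞) :
    expect G (S.indicator F) = prob G S * expect (G.filter S h) F := by
  unfold expect
  rw [← ENNReal.tsum_mul_left]
  refine tsum_congr fun q => ?_
  rw [filter_apply_eq]
  by_cases hq : q ∈ S
  · rw [Set.indicator_of_mem hq, Set.indicator_of_mem hq]
    calc G q * F q = prob G S * (prob G S)⁻¹ * (G q * F q) := by
          rw [ENNReal.mul_inv_cancel (prob_ne_zero h)
            ((prob_le_one G S).trans_lt ENNReal.one_lt_top).ne, one_mul]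
      _ = _ := by ring
  · simp [hq]

/-- The factor by which the weight of failure shrinks with every attempt. -/
def decay (G : PMF Q) (S : Set Q) : ℝ≥0∞ := prob G S / 2 + prob G Sᶜ

theorem two_mul_decay (G : PMF Q) (S : Set Q) :
    2 * decay G S = prob G S + 2 * prob G Sᶜ := by
  rw [decay, mul_add, ENNReal.mul_div_cancel (by norm_num) (by norm_num)]

theorem one_le_two_mul_decay (G : PMF Q) (S : Set Q) : 1 ≤ 2 * decay G S := by
  rw [two_mul_decay, two_mul, ← add_assoc, prob_add_compl]
  exact le_self_add

/-- With success probability p, the probability that a binomial number of successes in r attempts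
falls short is controlled by the moment E[2^(-successes)] = (1 - p/2)^r. The bound 2^y · `decay`^r
is kept as a potential with `y` queries still to come, so that it can be carried through an adaptive
run; `H` is the value of a genuine sample from the conditional distribution. -/
theorem expect_trySample_fixed_le {G : PMF Q} {a : Q → V} {good : V → Prop}
    (h : ∃ q ∈ {q | good (a q)}, q ∈ G.support) (y : ℕ)
    (F : Option (Q × V) × ℕ × (Q → V) → ℝ≥0∞) (H : Q → ℝ≥0∞) (hF : ∀ o, F o ≤ 1)
    (hFH : ∀ q r, good (a q) →
      F (some (q, a q), r, a) ≤ H q + 2 ^ y * decay G {q | good (a q)} ^ r) (r : ℕ) :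
    expect (trySample G fixedDraw good r a) F ≤
      expect (G.filter {q | good (a q)} h) H + 2 ^ (y + 1) * decay G {q | good (a q)} ^ r := by
  classical
  set S : Set Q := {q | good (a q)} with hS
  set d := decay G S with hd
  induction r with
  | zero =>
    rw [trySample, expect_pure, pow_zero, mul_one]
    exact (hF _).trans ((one_le_pow₀ (by norm_num)).trans le_add_self)
  | succ r ih =>
    simp only [trySample, expect_bind, fixedDraw, expect_pure]
    set E' := expect (G.filter S h) H with hE'
    have h1 : ∀ q, expect (if good (a q) then PMF.pure (some (q, a q), r, a)
        else trySample G fixedDraw good r a) F ≤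
        S.indicator H q + ((2 ^ y * d ^ r) * S.indicator 1 q +
          (E' + 2 ^ (y + 1) * d ^ r) * Sᶜ.indicator 1 q) := by
      intro q
      by_cases hq : good (a q)
      · have hq' : q ∈ S := hq
        simpa [hq, hq'] using hFH q r hq
      · have hq' : q ∉ S := hq
        simpa [hq, hq'] using ih
    refine (expect_mono h1).trans ?_
    rw [expect_add, expect_add, expect_const_mul, expect_const_mul, expect_indicator_mul G S h]
    change prob G S * E' + ((2 ^ y * d ^ r) * prob G S +
      (E' + 2 ^ (y + 1) * d ^ r) * prob G Sᶜ) ≤ _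
    -- A success halves the potential and a failure keeps it: p + 2(1 - p) is twice the decay, which
    -- makes the step an identity.
    have h2 := two_mul_decay G S
    refine le_of_eq ?_
    calc _ = (prob G S + prob G Sᶜ) * E' + 2 ^ y * d ^ r * (prob G S + 2 * prob G Sᶜ) := by ring
      _ = E' + 2 ^ (y + 1) * d ^ (r + 1) := by
        rw [prob_add_compl, ← h2, ← hd]; ring

/-- The error of simulated access to the good queries: the probability that the simulation of the
remaining queries takes more than `r` attempts is bounded exponentially. -/
def failure (G : PMF Q) (S : Set Q) (B : ℕ) (a : Q → V) (x : ℕ × (Q → V)) (i : ℕ) : ℝ≥0∞ :=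
  open Classical in
  if x.2 = a then 2 ^ (B - i) * decay G S ^ x.1 else ⊤

/-- For a fixed function the simulated answers are those of restricted access to the conditional
distribution, unless the supply of values runs out. That event is paid for by `failure`, which must
not increase along the run on average. -/
theorem approximates_simulate {enc : Q ↪ ℕ} {G : PMF Q} {a : Q → V} {good : V → Prop}
    {lab : V → ℝ} {η c : ℝ} {f : Q → Bool} (h : ∃ q ∈ {q | good (a q)}, q ∈ G.support)
    (hlab : ∀ q, good (a q) → lab (a q) = label (some (f q)))
    (hc : ∀ q, good (a q) → (G q).toReal / η = c * (G.filter {q | good (a q)} h q).toReal)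
    (t B : ℕ) (e : Effect LearnOracle) :
    Approximates t B (failure G {q | good (a q)} B a)
      1 (simulate enc G fixedDraw good lab η e)
      (fun Q' s => expect
        (e.perform (restrictedAccess enc (G.filter {q | good (a q)} h) f c) s) Q') := by
  classical
  intro F H σ s hF hm hcl hq hFH
  obtain ⟨M, cl, r, a'⟩ := σ
  by_cases ha : a' = a
  swap
  · simp [failure, ha]
  subst ha
  simp only at hm hcl
  subst hm
  have hfail : ∀ r i, failure G {q | good (a' q)} B a' (r, a') i = 2 ^ (B - i) * decay G {q | good (a' q)} ^ r :=
    fun r i => by simp [failure]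
  cases e with
  | toss x y =>
    simp only [simulate, Effect.perform, expect_map]
    rw [← expect_const (coin (s.mem y)) (failure G {q | good (a' q)} B a' (r, a') s.queries), ← expect_add]
    refine expect_mono fun b => ?_
    rw [cap_of_le (t := t) (s := s.tick.write _ _) (by simp [State.tick, State.write]; omega)
      (by simpa [State.tick, State.write])]
    exact hFH _ _ ⟨rfl, by simp [AS.write, State.tick, State.write]; omega⟩
      (by simp [State.tick, State.write]) (by simp [State.tick, State.write]; omega)
      (by simpa [State.tick, State.write])
  | query i x y z =>
    -- One more query would exceed the limit, so the right-hand side is infinite.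
    by_cases hq' : s.queries = B
    · refine le_top.trans (top_le_iff.2 ?_)
      rw [ENNReal.add_eq_top]
      left
      refine expect_eq_top fun s' hs' => ?_
      simp only [Effect.perform, PMF.support_map, Set.mem_image] at hs'
      obtain ⟨v, -, rfl⟩ := hs'
      exact cap_eq_top (Or.inr (by simp only; omega))
    obtain ⟨b, hb⟩ : ∃ b, B = s.queries + 1 + b := ⟨B - s.queries - 1, by omega⟩
    have hB1 : B - (s.queries + 1) = b := by omega
    have hB2 : B - s.queries = b + 1 := by omega
    -- the effect of an answer
    have hans : ∀ (v w : ℝ) (r' : ℕ),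
        F (AS.answer (⟨s.mem, cl, (r, a')⟩ : AS (ℕ × (Q → V))) x v w (r', a')) ≤
        cap t B H { (s.tick.write x v).write (x + 1) w with queries := s.queries + 1 } +
          2 ^ b * decay G {q | good (a' q)} ^ r' := by
      intro v w r'
      rw [cap_of_le (t := t) (s := { (s.tick.write x v).write (x + 1) w with queries := s.queries + 1 })
        (by simp [State.tick, State.write]; omega) (by simp only; omega)]
      have := hFH (AS.answer (⟨s.mem, cl, (r, a')⟩ : AS (ℕ × (Q → V))) x v w (r', a'))
        { (s.tick.write x v).write (x + 1) w with queries := s.queries + 1 }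
        ⟨rfl, by simp [AS.answer, State.tick, State.write]; omega⟩
        (by simp [State.tick, State.write]) (by simp [State.tick, State.write]; omega)
        (by simp only; omega)
      simpa only [AS.answer, hfail, hB1] using this
    have hmore : ∀ r, (2 : ℝ≥0∞) ^ b * decay G {q | good (a' q)} ^ r ≤ 2 ^ (b + 1) * decay G {q | good (a' q)} ^ r := fun r =>
      mul_le_mul_left (pow_le_pow_right₀ (by norm_num) (Nat.le_succ b)) _
    cases i with
    | sample =>
      simp only [simulate, Effect.perform, expect_map, restrictedAccess, hfail, hB2]
      refine expect_trySample_fixed_le h b _ _ (fun o => hF _) (fun q r' hgood => ?_) r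
      rw [← hlab q hgood]
      exact hans _ _ r'
    | evaluate =>
      simp only [simulate, Effect.perform, restrictedAccess, hfail, hB2, PMF.pure_map, expect_pure]
      cases hdec : decode enc (s.mem y) with
      | none =>
        simp only [expect_pure]
        exact (hans _ _ r).trans (add_le_add le_rfl (hmore r))
      | some q =>
        by_cases hG : G q = 0
        · have hG' : G.filter {q | good (a' q)} h q = 0 := by
            rw [filter_apply_eq]
            by_cases hqS : q ∈ {q | good (a' q)} <;> simp [hqS, hG]
          simp only [hG, hG', if_true, expect_pure]
          exact (hans _ _ r).trans (add_le_add le_rfl (hmore r))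
        · cases r with
          | zero =>
            simp only [hG, if_false, expect_pure, pow_zero, mul_one]
            exact (hF _).trans ((one_le_pow₀ (by norm_num)).trans le_add_self)
          | succ r =>
            -- An evaluation query uses one value and one query, good or not. The potential suffices
            -- because the decay is at least 1/2.
            have hmore' : (2 : ℝ≥0∞) ^ b * decay G {q | good (a' q)} ^ r ≤
                2 ^ (b + 1) * decay G {q | good (a' q)} ^ (r + 1) := by
              calc (2 : ℝ≥0∞) ^ b * decay G {q | good (a' q)} ^ r = 2 ^ b * decay G {q | good (a' q)} ^ r * 1 := by ring
                _ ≤ 2 ^ b * decay G {q | good (a' q)} ^ r * (2 * decay G {q | good (a' q)}) :=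
                  mul_le_mul_right (one_le_two_mul_decay G {q | good (a' q)}) _
                _ = _ := by ring
            simp only [hG, if_false, fixedDraw, PMF.pure_map, expect_pure]
            by_cases hgood : good (a' q)
            · have hqS : q ∈ {q | good (a' q)} := hgood
              have hG' : G.filter {q | good (a' q)} h q ≠ 0 := by
                rw [filter_apply_eq, Set.indicator_of_mem hqS]
                exact mul_ne_zero hG (ENNReal.inv_ne_zero.2
                  ((prob_le_one G {q | good (a' q)}).trans_lt ENNReal.one_lt_top).ne)
              simp only [hgood, if_true, hG', if_false]
              rw [← hlab q hgood, ← hc q hgood]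
              exact (hans _ _ r).trans (add_le_add le_rfl hmore')
            · have hqS : q ∉ {q | good (a' q)} := hgood
              have hG' : G.filter {q | good (a' q)} h q = 0 := by
                rw [filter_apply_eq, Set.indicator_of_notMem hqS, zero_mul]
              simp only [hgood, if_false, hG', if_true]
              exact (hans _ _ r).trans (add_le_add le_rfl hmore')

end Restricted

/-! ## Clocked evaluation -/

theorem exists_aloop_eq_pure {X : Type*} {test : (ℕ → ℝ) → Prop} {f : AS X → PMF (AS X)}
    (h : ∀ σ, ∃ σ', f σ = PMF.pure σ') (c : ℕ) : ∀ σ, ∃ σ', aloop test f c σ = PMF.pure σ' := by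
  induction c with
  | zero => exact fun σ => ⟨σ, rfl⟩
  | succ c ih =>
    intro σ
    simp only [aloop, AS.step]
    split_ifs
    · exact ⟨_, rfl⟩
    · obtain ⟨σ', h'⟩ := h ⟨σ.mem, σ.clock - 1, σ.aux⟩
      rw [h', PMF.pure_bind]
      exact ih σ'
    · exact ⟨_, rfl⟩

theorem exists_aexec_eq_pure {X : Type*} (p : Prog Empty) :
    ∀ σ : AS X, ∃ σ', aexec (fun e => e.elim) p σ = PMF.pure σ' := by
  have hstep : ∀ {f : AS X → PMF (AS X)} (_ : ∀ σ, ∃ σ', f σ = PMF.pure σ') (σ : AS X),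
      ∃ σ', σ.step f = PMF.pure σ' := by
    intro f h σ
    simp only [AS.step]
    split_ifs
    · exact ⟨_, rfl⟩
    · exact h _
  induction p with
  | const | arith | load | store => exact hstep fun σ => ⟨_, rfl⟩
  | act e => exact e.elim
  | seq p r ihp ihr =>
    refine hstep fun σ => ?_
    obtain ⟨σ', h'⟩ := ihp σ
    rw [h', PMF.pure_bind]
    exact ihr σ'
  | ite x y p r ihp ihr =>
    refine hstep fun σ => ?_
    split_ifs
    · exact ihp σ
    · exact ihr σ
  | loop x y p ih => exact fun σ => exists_aloop_eq_pure ih _ σ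

/-- The memory after a clocked run of a deterministic program. -/
def clockedRun (p : Prog Empty) (t : ℕ) (M : ℕ → ℝ) : ℕ → ℝ :=
  (exists_aexec_eq_pure p (⟨M, t, ()⟩ : AS Unit)).choose.mem

theorem expect_aexec_empty (p : Prog Empty) (t : ℕ) (M : ℕ → ℝ) (F : (ℕ → ℝ) → ℝ≥0∞) :
    expect (aexec (fun e => e.elim) p (⟨M, t, ()⟩ : AS Unit)) (fun σ => F σ.mem) =
      F (clockedRun p t M) := by
  conv_lhs => rw [(exists_aexec_eq_pure p (⟨M, t, ()⟩ : AS Unit)).choose_spec, expect_pure]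
  rfl

/-- The comparison of clocked and ordinary runs, with error zero, is applied to the indicator of a
memory different from `s.mem`. -/
theorem clockedRun_eq {p : Prog Empty} {t : ℕ} {M : ℕ → ℝ} {s : State}
    (h : runDet t p M = some s) (hs : s.time ≤ t) : clockedRun p t M = s.mem := by
  classical
  by_contra hne
  have key := approximates_aexec (X := Unit) (t := t) (B := s.queries) (W := fun _ _ => 0)
    (hI := fun e _ => e.elim) (hA := fun e => e.elim) (fun e => e.elim) (fun e => e.elim) t p
    (fun σ => if σ.mem = s.mem then 0 else 1) (fun s' => if s'.mem = s.mem then 0 else 1)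
    ⟨M, t, ()⟩ (State.init M) (fun σ => by split_ifs <;> simp) rfl
    (by simp [State.init]) (by simp [State.init])
    (fun σ' s' hm _ _ _ => by simp [hm.1])
  rw [expect_aexec_empty p t M (fun M' => if M' = s.mem then 0 else 1), if_neg hne, wp,
    exec_eq_pure, expect_pure] at key
  rw [runDet] at h
  rw [h] at key
  simp [cap_of_le hs] at key

/-- The Boolean function computed by a clocked program from the description `M`. -/
def clockedHypothesis {Q : Type*} (enc : Q ↪ ℕ) (p : Prog Empty) (t : ℕ) (M : ℕ → ℝ) (q : Q) :
    Bool :=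
  open Classical in
  decide (0 < clockedRun p t (Function.update M 0 (enc q : ℝ)) 0)

/-! ## Estimating the mass of the good queries -/

section Estimate
variable {Q V : Type*} {G : PMF Q} {a : Q → V} {good : V → Prop}

theorem expect_countGood_fixed (F : ℕ → (Q → V) → ℝ≥0∞) (m : ℕ) : ∀ i,
    expect (countGood G fixedDraw good m i a) (fun o => F o.1 o.2) =
      expect (countGood G fixedDraw good m i a) (fun o => F o.1 a) := by
  induction m with
  | zero => intro i; simp [countGood]
  | succ m ih =>
    intro i
    simp only [countGood, expect_bind, fixedDraw, expect_pure]
    exact congrArg _ (funext fun q => ih _)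

/-- The generating function of a binomial law. It is used at 2 and 1/2, for the two Chernoff bounds
on the estimate. -/
theorem expect_pow_countGood (z : ℝ≥0∞) (m : ℕ) : ∀ i,
    expect (countGood G fixedDraw good m i a) (fun o => z ^ o.1) =
      z ^ i * (z * prob G {q | good (a q)} + prob G {q | good (a q)}ᶜ) ^ m := by
  classical
  induction m with
  | zero => intro i; simp [countGood]
  | succ m ih =>
    intro i
    simp only [countGood, expect_bind, fixedDraw, expect_pure, ih]
    set w := (z * prob G {q | good (a q)} + prob G {q | good (a q)}ᶜ) with hw
    have h1 : ∀ q, z ^ (if good (a q) then i + 1 else i) * w ^ m =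
        (z ^ i * w ^ m) * (z * Set.indicator {q | good (a q)} 1 q +
          Set.indicator {q | good (a q)}ᶜ 1 q) := by
      intro q
      by_cases hq : good (a q)
      · have : q ∈ {q | good (a q)} := hq
        simp [hq]; ring
      · have : q ∉ {q | good (a q)} := hq
        simp [hq]
    simp only [h1]
    rw [expect_const_mul, expect_add, expect_const_mul]
    change z ^ i * w ^ m * w = _
    ring

theorem prob_eq_ofReal (G : PMF Q) (S : Set Q) : prob G S = ENNReal.ofReal (prob G S).toReal :=
  (ENNReal.ofReal_toReal ((prob_le_one G S).trans_lt ENNReal.one_lt_top).ne).symm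

theorem prob_toReal_le_one (G : PMF Q) (S : Set Q) : (prob G S).toReal ≤ 1 :=
  ENNReal.toReal_le_of_le_ofReal zero_le_one (by simpa using prob_le_one G S)

theorem prob_compl_eq (G : PMF Q) (S : Set Q) :
    prob G Sᶜ = ENNReal.ofReal (1 - (prob G S).toReal) := by
  have h := prob_add_compl G S
  have h1 : prob G Sᶜ = 1 - prob G S := by
    rw [← h, ENNReal.add_sub_cancel_left ((prob_le_one G S).trans_lt ENNReal.one_lt_top).ne]
  rw [h1, ENNReal.ofReal_sub _ ENNReal.toReal_nonneg, ← prob_eq_ofReal, ENNReal.ofReal_one]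

theorem decay_eq (G : PMF Q) (S : Set Q) :
    decay G S = ENNReal.ofReal (1 - (prob G S).toReal / 2) := by
  have h1 := prob_toReal_le_one G S
  have h0 : 0 ≤ (prob G S).toReal := ENNReal.toReal_nonneg
  rw [decay, prob_compl_eq, prob_eq_ofReal]
  rw [show (2 : ℝ≥0∞) = ENNReal.ofReal 2 by simp, ← ENNReal.ofReal_div_of_pos (by norm_num),
    ENNReal.toReal_ofReal h0, ← ENNReal.ofReal_add (by positivity) (by linarith)]
  congr 1
  ring

theorem decay_pow_le (G : PMF Q) (S : Set Q) (r : ℕ) :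
    decay G S ^ r ≤ ENNReal.ofReal (Real.exp (-(r * (prob G S).toReal / 2))) := by
  have h1 := prob_toReal_le_one G S
  have h0 : 0 ≤ (prob G S).toReal := ENNReal.toReal_nonneg
  rw [decay_eq, ← ENNReal.ofReal_pow (by linarith)]
  refine ENNReal.ofReal_le_ofReal ?_
  calc _ ≤ Real.exp (-((prob G S).toReal / 2)) ^ r := by
        refine pow_le_pow_left₀ (by linarith) ?_ r
        linarith [Real.add_one_le_exp (-((prob G S).toReal / 2))]
    _ = _ := by rw [← Real.exp_nat_mul]; congr 1; ring

/-- The relative frequency of the good queries in a large sample is not far off their mass. -/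
theorem expect_countGood_le {m : ℕ} {l γ : ℝ} (hγ : 0 < γ)
    (hp : γ / 2 ≤ (prob G {q | good (a q)}).toReal) (hm : 16 * l / γ ≤ m) (hl : 0 < l)
    (F : ℕ → ℝ≥0∞) (hF : ∀ i, F i ≤ 1) {δ : ℝ≥0∞}
    (hδ : ∀ i : ℕ, (prob G {q | good (a q)}).toReal / 3 ≤ (i : ℝ) / m →
      (i : ℝ) / m ≤ 3 * (prob G {q | good (a q)}).toReal → F i ≤ δ) :
    expect (countGood G fixedDraw good m 0 a) (fun o => F o.1) ≤
      δ + 2 * ENNReal.ofReal (Real.exp (-l)) := by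
  set S : Set Q := {q | good (a q)} with hS
  set p := (prob G S).toReal with hpdef
  have hm0 : (0 : ℝ) < m := lt_of_lt_of_le (by positivity) hm
  -- The expected number of good queries in the sample is at least 8l, as p ≥ γ/2.
  have hmp : 8 * l ≤ m * p := by
    have h1 : 16 * l ≤ m * γ := by rwa [div_le_iff₀ hγ] at hm
    nlinarith
  have hlog1 := Real.log_two_gt_d9
  have hlog2 := Real.log_two_lt_d9
  -- Markov's inequality for exponentials: `A` is 2^(mp/3) and `A'` is 2^(-3mp), so one of the two
  -- added terms is at least one when the count is below mp/3 or above 3mp.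
  set A := ENNReal.ofReal (Real.exp (m * p / 3 * Real.log 2)) with hA
  set A' := ENNReal.ofReal (Real.exp (-(3 * (m * p) * Real.log 2))) with hA'
  have hpow2 : ∀ i : ℕ, (2 : ℝ≥0∞) ^ i = ENNReal.ofReal (Real.exp (i * Real.log 2)) := by
    intro i
    rw [Real.exp_nat_mul, Real.exp_log (by norm_num), ENNReal.ofReal_pow (by norm_num)]
    simp
  have hpow2' : ∀ i : ℕ, ((2 : ℝ≥0∞)⁻¹) ^ i = ENNReal.ofReal (Real.exp (-(i * Real.log 2))) := by
    intro i
    rw [← ENNReal.inv_pow, hpow2, Real.exp_neg, ENNReal.ofReal_inv_of_pos (Real.exp_pos _)]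
  have h1 : ∀ i, F i ≤ δ + (A * 2⁻¹ ^ i + A' * 2 ^ i) := by
    intro i
    by_cases hlow : p / 3 ≤ (i : ℝ) / m
    · by_cases hhigh : (i : ℝ) / m ≤ 3 * p
      · exact (hδ i hlow hhigh).trans le_self_add
      · refine (hF i).trans (le_trans ?_ (le_add_self.trans le_add_self))
        rw [hpow2, hA', ← ENNReal.ofReal_mul (Real.exp_pos _).le, ← Real.exp_add,
          ENNReal.one_le_ofReal, Real.one_le_exp_iff]
        rw [not_le, lt_div_iff₀ hm0] at hhigh
        nlinarith
    · refine (hF i).trans (le_trans ?_ (le_self_add.trans le_add_self))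
      rw [hpow2', hA, ← ENNReal.ofReal_mul (Real.exp_pos _).le, ← Real.exp_add,
        ENNReal.one_le_ofReal, Real.one_le_exp_iff]
      rw [not_le, div_lt_iff₀ hm0] at hlow
      nlinarith
  refine (expect_mono fun o : ℕ × (Q → V) => h1 o.1).trans ?_
  rw [expect_add, expect_add, expect_const, expect_const_mul, expect_const_mul,
    expect_pow_countGood, expect_pow_countGood, pow_zero, pow_zero, one_mul, one_mul,
    two_mul (ENNReal.ofReal (Real.exp (-l)))]
  -- The exponents are mp(log 2/3 - 1/2) and mp(1 - 3 log 2). Both are below -mp/8, hence at most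
  -- -l.
  refine add_le_add le_rfl (add_le_add ?_ ?_)
  · have : 2⁻¹ * prob G S + prob G Sᶜ = decay G S := by
      rw [decay, mul_comm, ENNReal.div_eq_inv_mul, mul_comm]
    rw [this]
    refine (mul_le_mul_right (decay_pow_le G S m) _).trans ?_
    rw [hA, ← ENNReal.ofReal_mul (Real.exp_pos _).le, ← Real.exp_add]
    refine ENNReal.ofReal_le_ofReal (Real.exp_le_exp.2 ?_)
    rw [← hpdef]
    nlinarith
  · have : 2 * prob G S + prob G Sᶜ ≤ ENNReal.ofReal (Real.exp p) := by
      rw [two_mul, add_assoc, prob_add_compl, prob_eq_ofReal, ← hpdef, ← ENNReal.ofReal_one,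
        ← ENNReal.ofReal_add ENNReal.toReal_nonneg zero_le_one]
      exact ENNReal.ofReal_le_ofReal (Real.add_one_le_exp p)
    refine (mul_le_mul_right (pow_le_pow_left₀ zero_le this m) _).trans ?_
    rw [hA', ← ENNReal.ofReal_pow (Real.exp_pos _).le, ← Real.exp_nat_mul,
      ← ENNReal.ofReal_mul (Real.exp_pos _).le, ← Real.exp_add]
    refine ENNReal.ofReal_le_ofReal (Real.exp_le_exp.2 ?_)
    nlinarith

/-- With p the mass of S, the potential at the start of a run is at most exp(B - rp/2), and rp/2 ≥
4l(B + 1) ≥ B + l. This is why a supply of m(B + 1) values is enough for B queries. -/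
theorem two_pow_mul_decay_pow_le {B r m : ℕ} {l γ : ℝ} {S : Set Q} (hγ : 0 < γ)
    (hp : γ / 2 ≤ (prob G S).toReal) (hm : 16 * l / γ ≤ m) (hl : 1 ≤ l) (hr : m * (B + 1) ≤ r) :
    2 ^ B * decay G S ^ r ≤ ENNReal.ofReal (Real.exp (-l)) := by
  set p := (prob G S).toReal with hpdef
  have hmp : 8 * l ≤ m * p := by
    have h1 : 16 * l ≤ m * γ := by rwa [div_le_iff₀ hγ] at hm
    have hm0 : (0 : ℝ) ≤ m := Nat.cast_nonneg m
    nlinarith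
  have hp0 : 0 ≤ p := ENNReal.toReal_nonneg
  have hr' : (m : ℝ) * (B + 1) ≤ r := by exact_mod_cast hr
  have h2 : (2 : ℝ≥0∞) ^ B ≤ ENNReal.ofReal (Real.exp B) := by
    rw [← mul_one (B : ℝ), Real.exp_nat_mul, ENNReal.ofReal_pow (Real.exp_pos _).le]
    refine pow_le_pow_left₀ zero_le ?_ B
    rw [show (2 : ℝ≥0∞) = ENNReal.ofReal 2 by simp]
    exact ENNReal.ofReal_le_ofReal (by linarith [Real.add_one_le_exp (1 : ℝ)])
  refine (mul_le_mul' h2 (decay_pow_le G S r)).trans ?_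
  rw [← ENNReal.ofReal_mul (Real.exp_pos _).le, ← Real.exp_add]
  refine ENNReal.ofReal_le_ofReal (Real.exp_le_exp.2 ?_)
  rw [← hpdef]
  have hB : (0 : ℝ) ≤ B := Nat.cast_nonneg B
  have h3 : 8 * l * (B + 1) ≤ m * p * (B + 1) := mul_le_mul_of_nonneg_right hmp (by linarith)
  have h4 : m * p * (B + 1) ≤ r * p := by nlinarith
  nlinarith

end Estimate

/-! ## One run of a learning algorithm -/

/-- The indicator of the failure of a condition. -/
def failing (c : Prop) : ℝ≥0∞ :=
  open Classical in
  if c then 0 else 1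

theorem failing_le_one (c : Prop) : failing c ≤ 1 := by
  unfold failing; split_ifs <;> simp

theorem failing_of {c : Prop} (h : c) : failing c = 0 := if_pos h

theorem failing_of_not {c : Prop} (h : ¬c) : failing c = 1 := if_neg h

/-- The learner itself fails with probability below β'. The estimate of the mass is off by more than
a factor 3 with probability at most 2 exp(-l), and the values run out with probability at most
exp(-l). Reserving values for `min b t` queries instead of `b` keeps the running time independent of
`b`. -/
theorem expect_learnOnce_fixed_le {Q V : Type*} {L : Algorithm LearnOracle} {enc : Q ↪ ℕ}
    {G : PMF Q} {a : Q → V} {good : V → Prop} {lab : V → ℝ} {f : Q → Bool} {input : List ℝ}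
    {t b m r : ℕ} {γ l γ' β' : ℝ} (hγ : 0 < γ) (hl : 1 ≤ l)
    (hp : γ / 2 ≤ (prob G {q | good (a q)}).toReal) (hm : 16 * l / γ ≤ m)
    (hr : m * (min b t + 1) ≤ r)
    (h : ∃ q ∈ {q | good (a q)}, q ∈ G.support)
    (hlab : ∀ q, good (a q) → lab (a q) = label (some (f q)))
    (hL : ∀ c ∈ Set.Icc (1 / 3 : ℝ) 3,
      L.RunsWithin enc (restrictedAccess enc (G.filter {q | good (a q)} h) f c) input t b ∧
      (L.hypothesis enc (restrictedAccess enc (G.filter {q | good (a q)} h) f c) input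
        t).toOuterMeasure {h' | ENNReal.ofReal γ' <
          (G.filter {q | good (a q)} h).toOuterMeasure {q | h' q ≠ f q}} < ENNReal.ofReal β') :
    expect (learnOnce enc G fixedDraw good lab L.train (inputMemory input) t m r a)
      (fun o => failing (o.2 = a ∧ prob G {q | good (a q) ∧
        clockedHypothesis enc L.evaluate t o.1 q ≠ f q} ≤ ENNReal.ofReal γ')) ≤
      ENNReal.ofReal β' + 3 * ENNReal.ofReal (Real.exp (-l)) := by
  classical
  set fine : (ℕ → ℝ) → Prop := fun M => prob G {q | good (a q) ∧
        clockedHypothesis enc L.evaluate t M q ≠ f q} ≤ ENNReal.ofReal γ' with hfine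
  set p := (prob G {q | good (a q)}).toReal with hpdef
  have hp0 : 0 < p := by linarith
  simp only [learnOnce, expect_bind, expect_map]
  rw [expect_countGood_fixed (fun i a' => expect (aexec (simulate enc G fixedDraw good lab (i / m))
    L.train ⟨inputMemory input, t, (r, a')⟩) fun σ => failing (σ.aux.2 = a ∧ fine σ.mem))]
  refine (expect_countGood_le hγ hp hm (by linarith) (fun i => expect (aexec (simulate enc G
    fixedDraw good lab (i / m)) L.train ⟨inputMemory input, t, (r, a)⟩)
    fun σ => failing (σ.aux.2 = a ∧ fine σ.mem)) (fun i => expect_le_of_le fun _ => failing_le_one _)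
    (δ := ENNReal.ofReal β' + ENNReal.ofReal (Real.exp (-l))) ?_).trans_eq (by ring)
  intro i hi1 hi2
  set η : ℝ := (i : ℝ) / m with hη
  have hη0 : 0 < η := lt_of_lt_of_le (by positivity) hi1
  -- Dividing G(q) by the estimate η instead of the true mass p gives evaluation access with
  -- constant p/η.
  have hc : p / η ∈ Set.Icc (1 / 3 : ℝ) 3 := by
    constructor
    · rw [le_div_iff₀ hη0]; linarith
    · rw [div_le_iff₀ hη0]; linarith
  obtain ⟨hruns, hacc⟩ := hL _ hc
  have happ := approximates_aexec (fun e s s' => reaches_of_mem_support_perform _ e s s')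
    (approximates_simulate (enc := enc) (η := η) (c := p / η) h hlab (fun q hq => by
      rw [filter_apply_eq, Set.indicator_of_mem (show q ∈ {q | good (a q)} from hq),
        ENNReal.toReal_mul, ENNReal.toReal_inv, ← hpdef]
      field_simp) t (min b t)) t L.train
    (fun σ => failing (σ.aux.2 = a ∧ fine σ.mem))
    -- The value is infinite where the hypothesis cannot be evaluated in time; the learner's
    -- guarantee excludes this on the support of its runs.
    (fun s => if ∀ q, ∃ s', runDet t L.evaluate (Function.update s.mem 0 (enc q : ℝ)) = some s' ∧
      s'.time ≤ t then failing (fine s.mem) else ⊤)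
    ⟨inputMemory input, t, (r, a)⟩ (State.init (inputMemory input)) (fun σ => failing_le_one _) rfl
    (by simp [State.init]) (by simp [State.init]) (fun σ' s' hmt _ _ _ => by
      by_cases ha : σ'.aux.2 = a
      · split_ifs
        · simp only [ha, true_and, hmt.1]; exact le_self_add
        · simp
      · simp [failure, ha])
  refine happ.trans (add_le_add (le_trans ?_ hacc.le) ?_)
  · rw [Algorithm.hypothesis, ← expect_indicator, expect_map]
    refine expect_mono_support fun o ho => ?_
    obtain ⟨s, rfl, ht, hq, hev⟩ := hruns o ho
    have hq' : s.queries ≤ b := by exact_mod_cast hq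
    -- Every query takes a step, so the limit on time is also a limit on queries.
    have hqt : s.queries ≤ s.time := by
      have := (reaches_of_mem_support_exec
        (fun e s s' => reaches_of_mem_support_perform _ e s s') t L.train _ _ ho).2.2
      simpa [State.init] using this
    simp only [Option.elim]
    rw [cap_of_le ht (by omega), if_pos hev]
    by_cases hM : fine s.mem
    · rw [failing_of hM]
      exact zero_le
    · rw [failing_of_not hM, Set.indicator_of_mem]
      · exact le_rfl
      · refine lt_of_lt_of_le (not_le.1 hM) ?_
        rw [← prob_eq]
        have hset : prob G {q | good (a q) ∧ clockedHypothesis enc L.evaluate t s.mem q ≠ f q} =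
            expect G (Set.indicator {q | good (a q)} (Set.indicator
              {q | clockedHypothesis enc L.evaluate t s.mem q ≠ f q} 1)) := by
          rw [prob, Set.indicator_indicator]; rfl
        rw [hset, expect_indicator_mul G _ h]
        refine (mul_le_of_le_one_left zero_le (prob_le_one G _)).trans (prob_mono _ fun q hne => ?_)
        obtain ⟨s', hs', ht'⟩ := hev q
        have hval : L.value t s.mem (enc q) =
            clockedRun L.evaluate t (Function.update s.mem 0 (enc q : ℝ)) 0 := by
          simp only [Algorithm.value, hs', clockedRun_eq hs' ht']
        simpa only [Set.mem_ofPred_eq, clockedHypothesis, hval] using hne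
  · simp only [failure, if_true, State.init, Nat.sub_zero]
    exact two_pow_mul_decay_pow_le hγ hp hm hl hr

/-! ## Small samples represent counting queries -/

/-- As exp(y) ≤ 1 + y + y² for |y| ≤ 1 and the deviations from the mean sum to zero, only the
quadratic term remains. -/
theorem sum_exp_le {n : ℕ} (x : Fin n → ℝ) (f s : ℝ) (hf : ∑ i, x i = n * f)
    (hs : |s| ≤ 1) (hx : ∀ i, |x i - f| ≤ 1) :
    ∑ i, Real.exp (s * (x i - f)) ≤ n * Real.exp (s ^ 2) := by
  have h1 : ∀ i, Real.exp (s * (x i - f)) ≤ 1 + s * (x i - f) + s ^ 2 := by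
    intro i
    have hy : |s * (x i - f)| ≤ 1 := by
      rw [abs_mul]; exact mul_le_one₀ hs (abs_nonneg _) (hx i)
    have h2 := (abs_le.1 (Real.abs_exp_sub_one_sub_id_le hy)).2
    have h3 : (x i - f) ^ 2 ≤ 1 := by
      rw [← sq_abs]; exact pow_le_one₀ (abs_nonneg _) (hx i)
    nlinarith [sq_nonneg s]
  calc _ ≤ ∑ i, (1 + s * (x i - f) + s ^ 2) := Finset.sum_le_sum fun i _ => h1 i
    _ = n * (1 + s ^ 2) := by
      rw [Finset.sum_add_distrib, Finset.sum_add_distrib, ← Finset.mul_sum,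
        Finset.sum_sub_distrib, hf]
      simp
      ring
    _ ≤ _ := by
      refine mul_le_mul_of_nonneg_left ?_ (Nat.cast_nonneg n)
      linarith [Real.add_one_le_exp (s ^ 2)]

/-- Some small sample has approximately the right mean for all of finitely many functions. -/
theorem exists_sample {Q : Type*} [Fintype Q] {n m : ℕ} (hn : 0 < n) (hm : 0 < m)
    (x : Q → Fin n → ℝ) (f : Q → ℝ) (hf : ∀ q, ∑ i, x q i = n * f q)
    (hx : ∀ q i, |x q i - f q| ≤ 1) {s : ℝ} (hs0 : 0 < s) (hs1 : s ≤ 1) (hQ : 0 < Fintype.card Q)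
    (hms : Real.log (2 * Fintype.card Q) ≤ s ^ 2 * m) :
    ∃ g : Fin m → Fin n, ∀ q, |(∑ i, x q (g i)) / m - f q| ≤ 2 * s := by
  classical
  have : Nonempty (Fin n) := ⟨⟨0, hn⟩⟩
  set w : ℝ → Q → Fin n → ℝ := fun σ q i => Real.exp (σ * (x q i - f q)) with hw
  have hn' : (0 : ℝ) < n := by exact_mod_cast hn
  have hm' : (0 : ℝ) < m := by exact_mod_cast hm
  have hpow : ∀ σ q, |σ| = s → (∑ i, w σ q i) ^ m ≤ (n : ℝ) ^ m * Real.exp (m * s ^ 2) := by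
    intro σ q hσ
    have := sum_exp_le (x q) (f q) σ (hf q) (by rw [hσ]; exact hs1) (hx q)
    rw [← sq_abs, hσ] at this
    refine (pow_le_pow_left₀ (Finset.sum_nonneg fun i _ => (Real.exp_pos _).le) this m).trans_eq ?_
    rw [mul_pow, ← Real.exp_nat_mul]
  have hsum : ∑ g : Fin m → Fin n, ∑ q, (∏ i, w s q (g i) + ∏ i, w (-s) q (g i)) ≤
      ∑ _g : Fin m → Fin n, 2 * Fintype.card Q * Real.exp (m * s ^ 2) := by
    rw [Finset.sum_comm]
    calc _ ≤ ∑ _q : Q, 2 * ((n : ℝ) ^ m * Real.exp (m * s ^ 2)) := by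
          refine Finset.sum_le_sum fun q _ => ?_
          rw [Finset.sum_add_distrib, ← Fintype.sum_pow, ← Fintype.sum_pow, two_mul]
          exact add_le_add (hpow s q (abs_of_pos hs0)) (hpow (-s) q (by rw [abs_neg, abs_of_pos hs0]))
      _ = _ := by
          simp only [Finset.sum_const, Finset.card_univ, Fintype.card_fun, Fintype.card_fin,
            nsmul_eq_mul, Nat.cast_pow]
          ring
  -- The first moment method: some sample does not exceed the average, taken over all samples, of
  -- the sum of both exponential moments over all queries.
  obtain ⟨g, -, hg⟩ := Finset.exists_le_of_sum_le Finset.univ_nonempty hsum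
  refine ⟨g, fun q => ?_⟩
  have hprod : ∀ σ, ∏ i, w σ q (g i) = Real.exp (σ * (∑ i, x q (g i) - m * f q)) := by
    intro σ
    rw [hw, ← Real.exp_sum, ← Finset.mul_sum, Finset.sum_sub_distrib]
    simp
  have hq : ∏ i, w s q (g i) + ∏ i, w (-s) q (g i) ≤
      2 * Fintype.card Q * Real.exp (m * s ^ 2) :=
    le_trans (Finset.single_le_sum (f := fun q => ∏ i, w s q (g i) + ∏ i, w (-s) q (g i))
      (fun q _ => add_nonneg (Finset.prod_nonneg fun _ _ => (Real.exp_pos _).le)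
        (Finset.prod_nonneg fun _ _ => (Real.exp_pos _).le)) (Finset.mem_univ q)) hg
  rw [hprod, hprod] at hq
  have hcard : (0 : ℝ) < 2 * Fintype.card Q := by
    have : (0 : ℝ) < Fintype.card Q := by exact_mod_cast hQ
    linarith
  -- Since log(2|Q|) ≤ s²m, the union over queries and signs only doubles the exponent s²m. Dividing
  -- by s m gives the deviation 2s.
  have hbound : ∀ σ, Real.exp (σ * (∑ i, x q (g i) - m * f q)) ≤
      2 * Fintype.card Q * Real.exp (m * s ^ 2) →
      σ * (∑ i, x q (g i) - m * f q) ≤ 2 * s * (s * m) := by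
    intro σ h
    rw [← Real.exp_log hcard, ← Real.exp_add, Real.exp_le_exp] at h
    nlinarith
  have h1 := hbound s (le_trans (by linarith [Real.exp_pos (-s * (∑ i, x q (g i) - m * f q))]) hq)
  have h2 := hbound (-s) (le_trans (by linarith [Real.exp_pos (s * (∑ i, x q (g i) - m * f q))]) hq)
  rw [div_sub' hm'.ne', abs_div, abs_of_pos hm', div_le_iff₀ hm', abs_le]
  constructor
  · have : s * -(2 * s * m) ≤ s * (∑ i, x q (g i) - m * f q) := by linarith
    have := le_of_mul_le_mul_left this hs0
    linarith
  · have : s * (∑ i, x q (g i) - m * f q) ≤ s * (2 * s * m) := by linarith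
    exact le_of_mul_le_mul_left this hs0

/-! ## Thresholds and scores -/

/-- The threshold with index `j`, if there are `k` thresholds. -/
def thr (k j : ℕ) : ℝ := ((j : ℝ) + 1) / ((k : ℝ) + 1)

/-- The value that is read off from the answers to the threshold questions. -/
def score (k : ℕ) (h : ℕ → Bool) : ℝ :=
  ((∑ j ∈ Finset.range k, if h j = true then (1 : ℝ) else 0) + 1 / 2) / ((k : ℝ) + 1)

theorem thr_mem {k j : ℕ} (hj : j < k) : thr k j ∈ Set.Icc (0 : ℝ) 1 := by
  have h1 : (j : ℝ) + 1 ≤ k := by exact_mod_cast hj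
  refine ⟨by unfold thr; positivity, ?_⟩
  unfold thr
  rw [div_le_one (by positivity)]
  linarith

theorem score_mem (k : ℕ) (h : ℕ → Bool) : score k h ∈ Set.Icc (0 : ℝ) 1 := by
  have h0 : 0 ≤ ∑ j ∈ Finset.range k, (if h j = true then (1 : ℝ) else 0) :=
    Finset.sum_nonneg fun j _ => by split_ifs <;> norm_num
  have h1 : ∑ j ∈ Finset.range k, (if h j = true then (1 : ℝ) else 0) ≤ k := by
    refine (Finset.sum_le_card_nsmul _ _ 1 fun j _ => by split_ifs <;> norm_num).trans ?_
    simp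
  refine ⟨by unfold score; positivity, ?_⟩
  unfold score
  rw [div_le_one (by positivity)]
  linarith

/-- The score is accurate if the answers for all thresholds that are not close are correct. -/
theorem abs_score_sub_le {k : ℕ} {h : ℕ → Bool} {f α : ℝ} (hf0 : 0 ≤ f) (hf1 : f ≤ 1) (hα : 0 < α)
    (hk : 8 / α ≤ (k : ℝ) + 1)
    (hh : ∀ j < k, α / 4 ≤ |thr k j - f| → (h j = true ↔ thr k j ≤ f)) :
    |score k h - f| ≤ α := by
  classical
  set N : ℝ := (k : ℝ) + 1 with hN
  have hN0 : 0 < N := by positivity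
  have hNα : 8 ≤ N * α := by rwa [div_le_iff₀ hα] at hk
  have hcnt : ∑ j ∈ Finset.range k, (if h j = true then (1 : ℝ) else 0) =
      (((Finset.range k).filter fun j => h j = true).card : ℝ) := by
    rw [Finset.sum_ite]; simp
  rw [score, hcnt]
  -- A positive answer at j forces thr ≤ f + α/4, that is j + 1 ≤ N(f + α/4).
  have hup : (((Finset.range k).filter fun j => h j = true).card : ℝ) ≤ N * (f + α / 4) := by
    refine le_trans ?_ (Nat.floor_le (by positivity : 0 ≤ N * (f + α / 4)))
    have : (Finset.range k).filter (fun j => h j = true) ⊆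
        Finset.range ⌊N * (f + α / 4)⌋₊ := by
      intro j hj
      rw [Finset.mem_filter, Finset.mem_range] at hj
      rw [Finset.mem_range, ← Nat.succ_le_iff]
      refine Nat.le_floor ?_
      by_contra! hc
      have h1 : f + α / 4 < thr k j := by
        rw [thr, lt_div_iff₀ hN0]
        push_cast at hc
        linarith
      have := (hh j hj.1 (by rw [abs_of_pos (by linarith)]; linarith)).1 hj.2
      linarith
    exact_mod_cast (Finset.card_le_card this).trans_eq (Finset.card_range _)
  -- All thresholds up to f - α/4 get a positive answer. The minimum with `k` is harmless: k = N - 1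
  -- and f ≤ 1. The loss of one comes from the floor and is absorbed by Nα ≥ 8.
  have hlow : N * (f - α / 4) - 1 ≤ (((Finset.range k).filter fun j => h j = true).card : ℝ) := by
    have hsub : Finset.range (min k ⌊N * (f - α / 4)⌋₊) ⊆
        (Finset.range k).filter (fun j => h j = true) := by
      intro j hj
      rw [Finset.mem_range, lt_min_iff] at hj
      rw [Finset.mem_filter, Finset.mem_range]
      refine ⟨hj.1, ?_⟩
      have h1 : ((j + 1 : ℕ) : ℝ) ≤ N * (f - α / 4) := by
        have h2 : j + 1 ≤ ⌊N * (f - α / 4)⌋₊ := hj.2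
        exact (Nat.le_floor_iff' (Nat.succ_ne_zero j)).1 h2
      have h3 : thr k j ≤ f - α / 4 := by
        rw [thr, div_le_iff₀ hN0]
        push_cast at h1
        linarith
      exact (hh j hj.1 (by rw [abs_of_nonpos (by linarith)]; linarith)).2 (by linarith)
    have h1 := Finset.card_le_card hsub
    rw [Finset.card_range] at h1
    have h2 : ((min k ⌊N * (f - α / 4)⌋₊ : ℕ) : ℝ) ≤
        (((Finset.range k).filter fun j => h j = true).card : ℝ) := by exact_mod_cast h1
    refine le_trans ?_ h2
    rw [Nat.cast_min, le_min_iff]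
    constructor
    · nlinarith
    · linarith [Nat.lt_floor_add_one (N * (f - α / 4))]
  have e1 : N * ((((Finset.range k).filter fun j => h j = true).card + 1 / 2) / N) =
      ((Finset.range k).filter fun j => h j = true).card + 1 / 2 := mul_div_cancel₀ _ hN0.ne'
  rw [abs_le]
  constructor
  · refine le_of_mul_le_mul_left ?_ hN0
    rw [mul_sub, e1]
    linarith
  · refine le_of_mul_le_mul_left ?_ hN0
    rw [mul_sub, e1]
    linarith

/-- A count is far from the threshold with index `j`. -/
def farFrom (n k : ℕ) (α : ℝ) (j : ℕ) (v : Fin (n + 1)) : Prop :=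
  α / 16 * n ≤ |((v : ℕ) : ℝ) - thr k j * n|

/-- The label of a count with respect to the threshold with index `j`. -/
def thrLabel (n k j : ℕ) (v : Fin (n + 1)) : ℝ :=
  open Classical in
  if ((v : ℕ) : ℝ) < thr k j * n then 0 else 1

theorem prob_union_le {Q : Type*} (G : PMF Q) (S T : Set Q) :
    prob G (S ∪ T) ≤ prob G S + prob G T := by
  rw [prob, prob, prob, ← expect_add]
  refine expect_mono fun q => ?_
  by_cases h1 : q ∈ S <;> by_cases h2 : q ∈ T <;> simp [h1, h2]

theorem prob_biUnion_le {Q : Type*} (G : PMF Q) (S : ℕ → Set Q) {δ : ℝ≥0∞} (k : ℕ)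
    (h : ∀ j < k, prob G (S j) ≤ δ) : prob G {q | ∃ j < k, q ∈ S j} ≤ k * δ := by
  induction k with
  | zero => simp [prob, expect]
  | succ k ih =>
    have hset : {q | ∃ j < k + 1, q ∈ S j} ⊆ {q | ∃ j < k, q ∈ S j} ∪ S k := by
      rintro q ⟨j, hj, hq⟩
      rcases Nat.lt_succ_iff_lt_or_eq.1 hj with h' | rfl
      · exact Or.inl ⟨j, h', hq⟩
      · exact Or.inr hq
    refine (prob_mono G hset).trans ((prob_union_le G _ _).trans ?_)
    refine (add_le_add (ih fun j hj => h j (by omega)) (h k (by omega))).trans_eq ?_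
    push_cast; ring

/-- Hypotheses that are mostly correct for the thresholds with many far counts give mostly
accurate scores. -/
theorem prob_score_le {Q : Type*} {G : PMF Q} {n k : ℕ} {α γ γ' : ℝ} {a : Q → Fin (n + 1)}
    {f : Q → ℝ} {h : ℕ → Q → Bool} {f' : ℕ → Q → Bool} (hn : 0 < n) (hα : 0 < α)
    (hγ : 0 < γ) (hγ1 : γ ≤ 1) (hγ' : 0 ≤ γ') (hk : 8 / α ≤ (k : ℝ) + 1) (hkγ : k * γ' ≤ γ / 2)
    (hf : ∀ q, 0 ≤ f q ∧ f q ≤ 1) (ha : ∀ q, |((a q : ℕ) : ℝ) - n * f q| ≤ α / 64 * n)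
    (hf' : ∀ j q, farFrom n k α j (a q) → (f' j q = true ↔ thr k j ≤ f q))
    (hh : ∀ j < k, γ / 2 ≤ (prob G {q | farFrom n k α j (a q)}).toReal →
      prob G {q | farFrom n k α j (a q) ∧ h j q ≠ f' j q} ≤ ENNReal.ofReal γ') :
    prob G {q | α < |score k (fun j => h j q) - f q|} ≤ ENNReal.ofReal γ := by
  classical
  have hn' : (0 : ℝ) < n := by exact_mod_cast hn
  set far : ℕ → Set Q := fun j => {q | farFrom n k α j (a q)} with hfar
  -- counts that are not far from two thresholds
  have hnear : ∀ j q, q ∉ far j → |((a q : ℕ) : ℝ) / n - thr k j| < α / 16 := by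
    intro j q hq
    have h1 : |((a q : ℕ) : ℝ) - thr k j * n| < α / 16 * n := not_le.1 hq
    have h2 : ((a q : ℕ) : ℝ) / n - thr k j = (((a q : ℕ) : ℝ) - thr k j * n) / n := by
      field_simp
    rwa [h2, abs_div, abs_of_pos hn', div_lt_iff₀ hn']
  have hnoise : ∀ q, |((a q : ℕ) : ℝ) / n - f q| ≤ α / 64 := by
    intro q
    have h2 : ((a q : ℕ) : ℝ) / n - f q = (((a q : ℕ) : ℝ) - n * f q) / n := by
      field_simp
    rw [h2, abs_div, abs_of_pos hn', div_le_iff₀ hn']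
    exact ha q
  -- A single exceptional set serves all thresholds whose far queries are light; a union over them
  -- would cost a factor k.
  obtain ⟨S₀, hS₀, hS₀'⟩ : ∃ S₀ : Set Q, prob G S₀ ≤ ENNReal.ofReal (γ / 2) ∧
      ∀ q ∉ S₀, ∀ j, (prob G (far j)).toReal < γ / 2 →
        |((a q : ℕ) : ℝ) / n - thr k j| < 3 * (α / 16) := by
    by_cases hex : ∃ j, (prob G (far j)).toReal < γ / 2
    · obtain ⟨j₀, hj₀⟩ := hex
      refine ⟨far j₀, ?_, fun q hq j hj => ?_⟩
      · rw [prob_eq_ofReal]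
        exact ENNReal.ofReal_le_ofReal hj₀.le
      -- Two sets of mass below γ/2 ≤ 1/2 cannot cover everything. The common near query shows that
      -- the two thresholds differ by less than α/8, so a query near the one is within 3α/16 of the
      -- other.
      · obtain ⟨q', hq'⟩ : ∃ q', q' ∉ far j ∪ far j₀ := by
          by_contra! hall
          have h1 : (1 : ℝ≥0∞) ≤ prob G (far j) + prob G (far j₀) := by
            refine le_trans ?_ (prob_union_le G _ _)
            rw [Set.eq_univ_of_forall hall, prob, Set.indicator_univ]
            exact (expect_const G 1).ge
          rw [prob_eq_ofReal G (far j), prob_eq_ofReal G (far j₀),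
            ← ENNReal.ofReal_add ENNReal.toReal_nonneg ENNReal.toReal_nonneg,
            ENNReal.one_le_ofReal] at h1
          linarith
        rw [Set.mem_union, not_or] at hq'
        have h1 := abs_lt.1 (hnear j q' hq'.1)
        have h2 := abs_lt.1 (hnear j₀ q' hq'.2)
        have h3 := abs_lt.1 (hnear j₀ q hq)
        rw [abs_lt]
        constructor <;> linarith
    · push Not at hex
      refine ⟨∅, by simp [prob, expect], fun q _ j hj => absurd hj (not_lt.2 (hex j))⟩
  set W : ℕ → Set Q := fun j => if γ / 2 ≤ (prob G (far j)).toReal then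
    {q | farFrom n k α j (a q) ∧ h j q ≠ f' j q} else ∅ with hW
  have hW' : ∀ j < k, prob G (W j) ≤ ENNReal.ofReal γ' := by
    intro j hj
    simp only [hW]
    split_ifs with hp
    · exact hh j hj hp
    · simp [prob, expect]
  have hsub : {q | α < |score k (fun j => h j q) - f q|} ⊆ {q | ∃ j < k, q ∈ W j} ∪ S₀ := by
    intro q hq
    by_contra hc
    rw [Set.mem_union, not_or] at hc
    -- Only thresholds at distance at least α/4 from f matter. Near queries and light thresholds are
    -- excluded, because 1/16 + 1/64 and 3/16 + 1/64 are both below 1/4.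
    refine absurd (abs_score_sub_le (hf q).1 (hf q).2 hα hk fun j hj hfarj => ?_) (not_le.2 hq)
    have hnq := abs_le.1 (hnoise q)
    by_cases hp : γ / 2 ≤ (prob G (far j)).toReal
    · have hfq : farFrom n k α j (a q) := by
        by_contra hnf
        have h1 := abs_lt.1 (hnear j q hnf)
        have h2 : |thr k j - f q| < α / 4 := by
          rw [abs_lt]; constructor <;> linarith
        linarith
      have hWq : q ∉ W j := fun hq => hc.1 ⟨j, hj, hq⟩
      simp only [hW, hp, if_true, Set.mem_ofPred_eq, not_and, not_not] at hWq
      rw [hWq hfq]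
      exact hf' j q hfq
    · have h1 := abs_lt.1 (hS₀' q hc.2 j (not_le.1 hp))
      have h2 : |thr k j - f q| < α / 4 := by
        rw [abs_lt]; constructor <;> linarith
      linarith
  refine (prob_mono G hsub).trans ((prob_union_le G _ _).trans ?_)
  refine (add_le_add (prob_biUnion_le G W k hW') hS₀).trans ?_
  rw [← ENNReal.ofReal_natCast, ← ENNReal.ofReal_mul (Nat.cast_nonneg k),
    ← ENNReal.ofReal_add (by positivity) (by positivity)]
  exact ENNReal.ofReal_le_ofReal (by linarith)

/-! ## The release algorithm -/

/-- The parameters of the release algorithm: the size `n` of the data set, the number `k` of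
thresholds, the size `n'` of the thresholds that are learned, the time limit `t` of the learning
algorithm, the number `m` of queries used for estimation, the number `r` of values that are available
during a run of the learning algorithm, and the scale `η` of the noise. -/
structure Params where
  (n k n' t m r : ℕ)
  (α γ' β' η : ℝ)

/-- The number of thresholds.  There is nothing to do if the required accuracy is at least `1/2`. -/
def numThresholds (α : ℝ) : ℕ :=
  open Classical in
  if α < 1 / 2 then ⌊8 / α⌋₊ else 0

/-- The number of queries used to estimate the mass of the good queries. -/
def sampleSize (γ β' : ℝ) : ℕ := ⌊16 * Real.log (1 / β') / γ⌋₊ + 1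

/-- The parameters chosen by the release algorithm. -/
def chooseParams (n n' b t : ℕ) (ε α γ γ' β' : ℝ) : Params where
  n := n
  k := numThresholds α
  n' := n'
  t := t
  m := sampleSize γ β'
  r := sampleSize γ β' * (min b t + 1)
  α := α
  γ' := γ'
  β' := β'
  η := ε / (2 * (numThresholds α * (sampleSize γ β' * (min b t + 2))))

/-- The number of items that satisfy a query. -/
def trueCount {Q U : Type*} (P : Q → U → Bool) {n : ℕ} (D : Fin n → U) (q : Q) : ℝ :=
  ∑ i, if P q (D i) = true then (1 : ℝ) else 0

/-- The law of the noisy count of a query. -/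
def noisyAnswer {Q U : Type*} (P : Q → U → Bool) (π : Params) (D : Fin π.n → U) (q : Q) :
    PMF (Fin (π.n + 1)) :=
  noisyCount π.n π.η (trueCount P D q)

/-- The input of the learning algorithm for the threshold with index `j`. -/
def Params.input (π : Params) (j : ℕ) : List ℝ := [(π.n' : ℝ), thr π.k j, π.γ', π.β']

/-- The run for the threshold with index `j`. -/
def releaseStep {Q X : Type*} (L : Algorithm LearnOracle) (enc : Q ↪ ℕ) (G : PMF Q) (π : Params)
    (dr : Q → X → PMF (Fin (π.n + 1) × X)) (j : ℕ) (x : X) : PMF ((ℕ → ℝ) × X) :=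
  learnOnce enc G dr (farFrom π.n π.k π.α j) (thrLabel π.n π.k j) L.train
    (inputMemory (π.input j)) π.t π.m π.r x

/-- The descriptions of all hypotheses. -/
def release {Q U : Type*} (L : Algorithm LearnOracle) (enc : Q ↪ ℕ) (G : PMF Q) (P : Q → U → Bool)
    (π : Params) (D : Fin π.n → U) : PMF ((ℕ → ℕ → ℝ) × (Q → Option (Fin (π.n + 1)))) :=
  runAll (releaseStep L enc G π (lazyDraw (noisyAnswer P π D))) π.k fun _ => none

/-- The value of the synopsis at `q`. -/
def releaseValue {Q : Type*} (L : Algorithm LearnOracle) (enc : Q ↪ ℕ) (π : Params)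
    (S : ℕ → ℕ → ℝ) (q : Q) : ℝ :=
  score π.k fun j => clockedHypothesis enc L.evaluate π.t (S j) q

/-! ### Privacy -/

section
variable {Q U : Type*} {L : Algorithm LearnOracle} {enc : Q ↪ ℕ} {G : PMF Q} {P : Q → U → Bool}

theorem abs_trueCount_sub_le {n : ℕ} {D D' : Fin n → U} (h : Adjacent D D') (q : Q) :
    |trueCount P D q - trueCount P D' q| ≤ 1 := by
  obtain ⟨i, hi⟩ := h
  rw [trueCount, trueCount, ← Finset.sum_sub_distrib, Finset.sum_eq_single i]
  · split_ifs <;> simp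
  · intro j _ hj
    rw [hi j hj, sub_self]
  · simp

/-- There are `k` rounds with at most `r + m` requests each, and a request costs a factor exp(2η).
Nothing about the learner is used: the clock and the limits hold on every path. -/
theorem release_private {π : Params} (hη : 0 ≤ π.η) {D D' : Fin π.n → U} (h : Adjacent D D')
    (F : (ℕ → ℕ → ℝ) → ℝ≥0∞) (hF : ∀ S, F S ≤ 1) :
    expect (release L enc G P π D) (fun o => F o.1) ≤
      ENNReal.ofReal (Real.exp (2 * π.η * (π.k * (π.r + π.m)))) *
        expect (release L enc G P π D') (fun o => F o.1) := by
  have hC : 1 ≤ ENNReal.ofReal (Real.exp (2 * π.η)) := by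
    rw [ENNReal.one_le_ofReal, Real.one_le_exp_iff]; positivity
  have hd := drawTransfer_of_le_mul hC (μ := noisyAnswer P π D) (μ' := noisyAnswer P π D')
    fun q v => noisyCount_le hη (abs_trueCount_sub_le h q) v
  have key := expect_runAll_le (κ := PMF.pure)
    (runA := releaseStep L enc G π (lazyDraw (noisyAnswer P π D)))
    (runB := releaseStep L enc G π (lazyDraw (noisyAnswer P π D')))
    (fun j x F hF => expect_learnOnce_avg hd (fun r => one_le_pow₀ hC) enc G
      (farFrom π.n π.k π.α j) (thrLabel π.n π.k j) L.train (inputMemory (π.input j)) π.t π.m π.r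
      x F hF) π.k (fun _ => none) (fun S _ => F S) fun S _ => hF S
  simp only [expect_pure, mul_zero, add_zero] at key
  refine key.trans_eq ?_
  rw [← pow_mul, ← ENNReal.ofReal_pow (Real.exp_pos _).le, ← Real.exp_nat_mul]
  congr 3
  push_cast
  ring_nf

/-! ### Accuracy -/

theorem exists_trueCount_eq {n : ℕ} (D : Fin n → U) (q : Q) :
    ∃ c : ℕ, c ≤ n ∧ trueCount P D q = c := by
  classical
  refine ⟨(Finset.univ.filter fun i => P q (D i) = true).card, ?_, ?_⟩
  · exact (Finset.card_le_univ _).trans_eq (Fintype.card_fin n)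
  · rw [trueCount, Finset.sum_ite]; simp

theorem expect_runAll_failing_le {Y : Type*} {run : ℕ → Y → PMF ((ℕ → ℝ) × Y)} {a : Y}
    {fine : ℕ → (ℕ → ℝ) → Prop} {δ : ℝ≥0∞} (k : ℕ)
    (h : ∀ j < k, expect (run j a) (fun o => failing (o.2 = a ∧ fine j o.1)) ≤ δ) :
    expect (runAll run k a) (fun o => failing (o.2 = a ∧ ∀ j < k, fine j (o.1 j))) ≤ k * δ := by
  induction k with
  | zero => simp [runAll, failing]
  | succ k ih =>
    simp only [runAll, expect_bind, expect_map]
    refine (expect_mono fun o => (?_ : _ ≤ failing (o.2 = a ∧ ∀ j < k, fine j (o.1 j)) + δ)).trans ?_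
    · by_cases ho : o.2 = a ∧ ∀ j < k, fine j (o.1 j)
      · rw [ho.1]
        refine (expect_mono fun o' => ?_).trans ((h k (Nat.lt_succ_self k)).trans le_add_self)
        by_cases ho' : o'.2 = a ∧ fine k o'.1
        · rw [failing_of]
          · exact zero_le
          · refine ⟨ho'.1, fun j hj => ?_⟩
            rcases Nat.lt_succ_iff_lt_or_eq.1 hj with h' | rfl
            · rw [Function.update_of_ne h'.ne]; exact ho.2 j h'
            · rw [Function.update_self]; exact ho'.2
        · rw [failing_of_not ho']; exact failing_le_one _
      · rw [failing_of_not ho]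
        exact (expect_le_of_le fun _ => failing_le_one _).trans le_self_add
    · rw [expect_add, expect_const]
      refine (add_le_add (ih fun j hj => h j (by omega)) le_rfl).trans_eq ?_
      push_cast; ring

/-- A count at distance α/16 from the threshold, moved by α/64 of noise and by another α/64 of
sampling error, stays on its side. So the noisy label is right for D (with `x`) and for the small
sample (with `y`). -/
theorem label_eq_thrLabel {n k j : ℕ} {α : ℝ} {v : Fin (n + 1)} {x y : ℝ} (hn : 0 < n)
    (hα : 0 < α) (hv : farFrom n k α j v) (hx : |((v : ℕ) : ℝ) - n * x| ≤ α / 64 * n)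
    (hy : |y - x| ≤ α / 64) :
    (thrLabel n k j v = 0 ∧ ¬ thr k j ≤ y ∧ ¬ thr k j ≤ x) ∨
      (thrLabel n k j v = 1 ∧ thr k j ≤ y ∧ thr k j ≤ x) := by
  have hn' : (0 : ℝ) < n := by exact_mod_cast hn
  have h1 := abs_le.1 hx
  have h2 := abs_le.1 hy
  unfold farFrom at hv
  unfold thrLabel
  split_ifs with h
  · left
    rw [abs_of_neg (by linarith)] at hv
    have : n * x < n * (thr k j - α / 64) := by nlinarith
    have := lt_of_mul_lt_mul_left this hn'.le
    exact ⟨rfl, by linarith, by linarith⟩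
  · right
    rw [abs_of_nonneg (by linarith)] at hv
    have : n * (thr k j + α / 64) < n * x := by nlinarith
    have := lt_of_mul_lt_mul_left this hn'.le
    exact ⟨rfl, by linarith, by linarith⟩

/-- Conditioning multiplies densities by the inverse of the mass, which is at most 2/γ. -/
theorem filter_mem_smoothExtension {G : PMF Q} {𝒢 : Set (PMF Q)} (hG : G ∈ 𝒢) {γ : ℝ} (hγ : 0 < γ)
    {S : Set Q} (h : ∃ q ∈ S, q ∈ G.support) (hp : γ / 2 ≤ (prob G S).toReal) :
    G.filter S h ∈ smoothExtension (2 / γ) 𝒢 := by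
  refine ⟨G, hG, fun q => ?_⟩
  rw [filter_apply_eq, mul_comm]
  refine mul_le_mul' ?_ (Set.indicator_le_self _ _ _)
  rw [prob_eq_ofReal, ← ENNReal.ofReal_inv_of_pos (by linarith)]
  refine ENNReal.ofReal_le_ofReal ?_
  rw [inv_le_comm₀ (by linarith) (by positivity), inv_div]
  exact hp

/-- Comparing with a run that keeps no record, through the constant kernel at `a`, shows that the
complementary event has expectation at least one; hence the failure has expectation zero. -/
theorem expect_learnOnce_fixed_state {V : Type*} (a : Q → V) (good : V → Prop) (lab : V → ℝ)
    (p : Prog (Effect LearnOracle)) (M : ℕ → ℝ) (t m r : ℕ) :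
    expect (learnOnce enc G fixedDraw good lab p M t m r a) (fun o => failing (o.2 = a)) = 0 := by
  have hd : DrawTransfer (fun _ : Unit => PMF.pure a) (fun _ => 1) (fun _ => 0)
      (fun q _ => PMF.pure (a q, ())) fixedDraw := fun q r x F _ => by simp [avg, fixedDraw]
  have h := expect_learnOnce_avg hd (fun r => le_rfl) enc G good lab p M t m r ()
    (fun _ a' => failing (¬a' = a)) fun _ _ => failing_le_one _
  simp only [expect_pure, avg, one_mul, add_zero, not_true_eq_false, failing_of_not not_false,
    expect_const] at h
  have hsum : expect (learnOnce enc G fixedDraw good lab p M t m r a)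
      (fun o => failing (o.2 = a) + failing (¬o.2 = a)) = 1 := by
    refine (congrArg _ (funext fun o => ?_)).trans (expect_const _ 1)
    by_cases ho : o.2 = a <;> simp [failing, ho]
  rw [expect_add] at hsum
  by_contra h0
  refine absurd hsum (ne_of_gt (lt_of_lt_of_le ?_ (add_le_add le_rfl h)))
  rw [add_comm]
  exact ENNReal.lt_add_right ENNReal.one_ne_top h0

theorem release_accurate [Fintype Q] {𝒢 : Set (PMF Q)} {b t : ℕ → ℝ → ℝ → ℕ} {π : Params}
    {γ δ : ℝ} (hn : 0 < π.n) (hn' : 0 < π.n') (hα : 0 < π.α) (hα1 : π.α ≤ 1) (hγ : 0 < γ)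
    (hγ1 : γ ≤ 1) (hγ' : 0 < π.γ') (hβ' : 0 < π.β') (hη : 0 ≤ π.η)
    (hk : 8 / π.α ≤ (π.k : ℝ) + 1)
    (hkγ : π.k * π.γ' ≤ γ / 2) (hQ : 2 ≤ Fintype.card Q)
    (hsample : 32768 * Real.log (Fintype.card Q) / π.α ^ 2 ≤ π.n')
    (hl : 1 ≤ Real.log (1 / π.β')) (hm : 16 * Real.log (1 / π.β') / γ ≤ π.m)
    (ht : π.t = t π.n' π.γ' π.β') (hr : π.m * (min (b π.n' π.γ' π.β') π.t + 1) ≤ π.r)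
    (hδ : 2 * Real.exp (-(π.η * (π.α / 64 * π.n))) ≤ δ) (hδ1 : δ < 1)
    (hL : LearnsThresholds L enc (smoothExtension (2 / γ) 𝒢) (Set.range fun u q => P q u) b t)
    (hG : G ∈ 𝒢) (D : Fin π.n → U) :
    expect (release L enc G P π D) (fun o => failing
      (prob G {q | π.α < |releaseValue L enc π o.1 q - countingQuery P D q|} ≤
        ENNReal.ofReal γ)) ≤
      π.k * (4 * ENNReal.ofReal π.β') + π.k * ((π.r + π.m) * ENNReal.ofReal δ) := by
  classical
  have hnR : (0 : ℝ) < π.n := by exact_mod_cast hn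
  set F : (ℕ → ℕ → ℝ) → ℝ≥0∞ := fun S => failing
    (prob G {q | π.α < |releaseValue L enc π S q - countingQuery P D q|} ≤ ENNReal.ofReal γ) with hF
  have hF1 : ∀ S, F S ≤ 1 := fun S => failing_le_one _
  set f : Q → ℝ := fun q => countingQuery P D q with hf
  have hcount : ∀ q, trueCount P D q = π.n * f q := fun q => by
    simp only [hf, countingQuery, trueCount]
    field_simp
  have hf01 : ∀ q, 0 ≤ f q ∧ f q ≤ 1 := by
    intro q
    obtain ⟨c, hc, hc'⟩ := exists_trueCount_eq (P := P) D q
    have hc2 : (c : ℝ) ≤ π.n := by exact_mod_cast hc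
    have hc3 : (0 : ℝ) ≤ c := Nat.cast_nonneg c
    rw [hcount] at hc'
    constructor
    · by_contra! hneg
      nlinarith
    · by_contra! hbig
      nlinarith
  -- conditioning on small noise
  set small : Q → Set (Fin (π.n + 1)) :=
    fun q => {v | |((v : ℕ) : ℝ) - π.n * f q| ≤ π.α / 64 * π.n} with hsmall
  have htail : ∀ q, (noisyAnswer P π D q).toOuterMeasure (small q)ᶜ ≤ ENNReal.ofReal δ := by
    intro q
    obtain ⟨c, hc, hc'⟩ := exists_trueCount_eq (P := P) D q
    have hset : (small q)ᶜ = {v : Fin (π.n + 1) | π.α / 64 * π.n < |((v : ℕ) : ℝ) - c|} := by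
      ext v
      simp only [hsmall, Set.mem_compl_iff, Set.mem_ofPred_eq, not_le, ← hcount, hc']
    rw [hset, noisyAnswer, hc']
    refine (noisyCount_tail hη (by positivity) hc).trans ?_
    rw [show (2 : ℝ≥0∞) = ENNReal.ofReal 2 by simp, ← ENNReal.ofReal_mul (by norm_num)]
    exact ENNReal.ofReal_le_ofReal hδ
  have hex : ∀ q, ∃ v ∈ small q, v ∈ (noisyAnswer P π D q).support := by
    intro q
    refine exists_of_prob_ne_zero (fun h0 => ?_)
    have h1 := prob_add_compl (noisyAnswer P π D q) (small q)
    rw [h0, zero_add, prob_eq] at h1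
    have h2 := htail q
    rw [h1, ENNReal.one_le_ofReal] at h2
    linarith
  set μ' : Q → PMF (Fin (π.n + 1)) := fun q => (noisyAnswer P π D q).filter (small q) (hex q)
    with hμ'
  -- Noise is replaced by noise conditioned to be small; each of the k(r + m) requests costs at most
  -- `δ`.
  have step1 := expect_runAll_le (κ := PMF.pure) (C := 1)
    (D := (π.r + π.m : ℕ) * ENNReal.ofReal δ)
    (runA := releaseStep L enc G π (lazyDraw (noisyAnswer P π D)))
    (runB := releaseStep L enc G π (lazyDraw μ'))
    (fun j x F hF => expect_learnOnce_avg (drawTransfer_of_le_add (δ := ENNReal.ofReal δ)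
      fun q F hF => expect_le_expect_filter _ (small q) (hex q) (htail q) F hF) (fun r => le_rfl)
      enc G (farFrom π.n π.k π.α j) (thrLabel π.n π.k j) L.train (inputMemory (π.input j)) π.t π.m
      π.r x F hF) π.k (fun _ => none) (fun S _ => F S) fun S _ => hF1 S
  -- All noise is drawn in advance, at no cost. A bound that holds for every function of positive
  -- probability then suffices.
  have step2 := expect_runAll_le (κ := completion μ') (C := 1) (D := 0)
    (runA := releaseStep L enc G π (lazyDraw μ'))
    (runB := releaseStep L enc G π fixedDraw)
    (fun j x F hF => expect_learnOnce_avg (drawTransfer_completion μ') (fun r => le_rfl)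
      enc G (farFrom π.n π.k π.α j) (thrLabel π.n π.k j) L.train (inputMemory (π.input j)) π.t π.m
      π.r x F hF) π.k (fun _ => none) (fun S _ => F S) fun S _ => hF1 S
  simp only [expect_pure, one_pow, one_mul, Finset.sum_const, Finset.card_range, nsmul_eq_mul,
    mul_one, mul_zero, add_zero, expect_const] at step1 step2
  refine step1.trans (add_le_add (step2.trans (expect_le_of_support fun a ha => ?_))
    (by push_cast; exact le_rfl))
  -- from now on the noise is fixed
  have ha' : ∀ q, |((a q : ℕ) : ℝ) - π.n * f q| ≤ π.α / 64 * π.n := by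
    intro q
    have := mem_support_of_completion ha q
    rw [hμ', PMF.mem_support_filter_iff] at this
    exact this.1
  -- a small data set
  obtain ⟨g, hg⟩ := exists_sample (n := π.n) (m := π.n') hn hn'
    (fun q i => if P q (D i) = true then (1 : ℝ) else 0) f (fun q => hcount q) (fun q i => by
      have := hf01 q
      rw [abs_le]
      split_ifs <;> constructor <;> linarith) (s := π.α / 128) (by positivity) (by linarith)
      (by omega) (by
      have hc2 : (2 : ℝ) ≤ Fintype.card Q := by exact_mod_cast hQ
      rw [Real.log_mul (by norm_num) (by linarith)]
      have h1 := Real.log_le_log (by norm_num) hc2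
      -- As 32768 = 2 · 128², the number s²n' is at least 2 log|Q|, which exceeds log(2|Q|) because
      -- |Q| ≥ 2.
      rw [div_le_iff₀ (by positivity)] at hsample
      nlinarith)
  set f' : ℕ → Q → Bool := fun j q => decide (thr π.k j ≤
    (∑ i, if P q (D (g i)) = true then (1 : ℝ) else 0) / π.n') with hf'
  have hlabel := fun j q (hq : farFrom π.n π.k π.α j (a q)) =>
    label_eq_thrLabel hn hα hq (ha' q) (y := (∑ i, if P q (D (g i)) = true then (1 : ℝ) else 0)
      / π.n') ((hg q).trans_eq (by ring))
  refine (expect_mono fun o => ?_).trans (expect_runAll_failing_le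
    (fine := fun j M => γ / 2 ≤ (prob G {q | farFrom π.n π.k π.α j (a q)}).toReal →
      prob G {q | farFrom π.n π.k π.α j (a q) ∧
        clockedHypothesis enc L.evaluate π.t M q ≠ f' j q} ≤ ENNReal.ofReal π.γ') π.k
    fun j hj => ?_)
  · by_cases hfine : o.2 = a ∧ ∀ j < π.k,
        γ / 2 ≤ (prob G {q | farFrom π.n π.k π.α j (a q)}).toReal →
        prob G {q | farFrom π.n π.k π.α j (a q) ∧
          clockedHypothesis enc L.evaluate π.t (o.1 j) q ≠ f' j q} ≤ ENNReal.ofReal π.γ'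
    · rw [failing_of hfine, hF]
      refine (failing_of ?_).le
      refine prob_score_le hn hα hγ hγ1 hγ'.le hk hkγ hf01 ha' (f' := f') (fun j q hq => ?_) hfine.2
      simp only [hf', decide_eq_true_eq]
      rcases hlabel j q hq with ⟨-, h1, h2⟩ | ⟨-, h1, h2⟩
      · exact iff_of_false h1 h2
      · exact iff_of_true h1 h2
    · rw [failing_of_not hfine]
      exact hF1 _
  · by_cases hp : γ / 2 ≤ (prob G {q | farFrom π.n π.k π.α j (a q)}).toReal
    · have hex' : ∃ q ∈ {q | farFrom π.n π.k π.α j (a q)}, q ∈ G.support := by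
        refine exists_of_prob_ne_zero fun h0 => ?_
        rw [h0, ENNReal.toReal_zero] at hp
        linarith
      have hmem := filter_mem_smoothExtension hG hγ hex' hp
      have hthr : f' j ∈ nThresholds (Set.range fun u q => P q u) π.n' (thr π.k j) :=
        ⟨fun i q => P q (D (g i)), fun i => ⟨D (g i), rfl⟩, fun q => by simp [hf']⟩
      refine (expect_mono fun o => ?_).trans ((expect_learnOnce_fixed_le (γ' := π.γ')
        (β' := π.β') (f := f' j) (lab := thrLabel π.n π.k j) (input := π.input j) hγ hl hp hm hr
        hex' (fun q hq => ?_) fun c hc => ?_).trans_eq ?_)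
      · simp only [hp, true_imp_iff]
        exact le_rfl
      · rcases hlabel j q hq with ⟨h0, h1, -⟩ | ⟨h0, h1, -⟩
        · rw [h0, show f' j q = false from decide_eq_false h1]; rfl
        · rw [h0, show f' j q = true from decide_eq_true h1]; rfl
      · have := hL π.γ' π.β' π.n' (thr π.k j) hγ' hβ' hn' (thr_mem hj) (f' j) hthr _ hmem c hc
        rw [← ht] at this
        exact this
      -- With l = log(1/β') each exponential is β', so a run fails with probability at most β' +
      -- 3β'.
      · rw [Real.exp_neg, Real.exp_log (by positivity)]
        simp only [one_div, inv_inv]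
        ring
    -- For a light threshold nothing is claimed about the hypothesis; only the fixed noise has to be
    -- passed on unchanged.
    · simp only [hp, false_imp_iff, and_true]
      exact (expect_learnOnce_fixed_state ..).le.trans zero_le

end

/-! ## Programs of the release algorithm

The memory is organized as follows.  The cells below `64` are registers.  The other cells form
`W` interleaved streams.  Registers `0` to `7` hold the input `n`, `ε`, `α`, `β`, `γ`, `n'`, `b`,
`t`; registers `8` and `9` hold the constants `0` and `1`; register `10` holds `W`; register `13`
the address of the stream in use, register `14` the address of the table of noisy counts, register
`15` the threshold for counts, register `16` the estimated mass of the good queries, register `19`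
the required distance of counts from the threshold, register `20` the negative scale of the noise,
register `30` the number of values that may still be requested, and register `31` the clock. -/

section Basic
variable {ι : Type} {O : Oracle ι} {k : ℕ} {Q : State → ℝ≥0∞} {s : State}

@[simp] theorem wp_toss (a x : ℕ) :
    wp (Effect.perform O) k (.act (.toss a x)) Q s = expect (coin (s.mem x)) fun c =>
      Q ⟨Function.update s.mem a (if c = true then 1 else 0), s.time + 1, s.queries⟩ := by
  simp [wp_act, Effect.perform, State.tick, State.write]

@[simp] theorem wp_query (i : ι) (a x y : ℕ) :
    wp (Effect.perform O) k (.act (.query i a x y)) Q s =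
      expect (O i (s.mem x) (s.mem y)) fun r =>
        Q ⟨Function.update (Function.update s.mem a r.1) (a + 1) r.2, s.time + 1,
          s.queries + 1⟩ := by
  simp [wp_act, Effect.perform, State.tick, State.write]

end Basic

theorem decode_enc {Q : Type*} (enc : Q ↪ ℕ) (q : Q) : decode enc (enc q : ℝ) = some q := by
  have h : ∃ q' : Q, (enc q' : ℝ) = (enc q : ℝ) := ⟨q, rfl⟩
  rw [decode, dif_pos h]
  exact congrArg some (enc.injective (Nat.cast_injective h.choose_spec))

theorem enc_of_decode {Q : Type*} {enc : Q ↪ ℕ} {x : ℝ} {q : Q} (h : decode enc x = some q) :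
    (enc q : ℝ) = x := by
  rw [decode] at h
  split_ifs at h with hq
  rw [← Option.some.inj h]
  exact hq.choose_spec

/-- The address of cell `i` of the stream with index `j`. -/
def cell (W j i : ℕ) : ℕ := 64 + (i * W + j)

theorem le_cell (W j i : ℕ) : 64 ≤ cell W j i := Nat.le_add_right _ _

theorem cell_inj {W j i i' : ℕ} (hj : j < W) (h : cell W j i = cell W j i') : i = i' := by
  unfold cell at h
  have : i * W = i' * W := by omega
  exact Nat.eq_of_mul_eq_mul_right (by omega) this

theorem cell_ne {W j j' i i' : ℕ} (hj : j < W) (hj' : j' < W) (h : j ≠ j') :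
    cell W j i ≠ cell W j' i' := by
  unfold cell
  intro he
  have h1 : i * W + j = i' * W + j' := by omega
  have h2 : (i * W + j) % W = (i' * W + j') % W := by rw [h1]
  rw [Nat.mul_add_mod', Nat.mul_add_mod', Nat.mod_eq_of_lt hj, Nat.mod_eq_of_lt hj'] at h2
  exact h h2

theorem ofReal_div_weight {n : ℕ} {η c : ℝ} (i : Fin (n + 1)) :
    noisyCount n η c i = ENNReal.ofReal
      (countWeight η c i / ∑ i ∈ Finset.range (n + 1), countWeight η c i) := by
  have hpos : 0 < ∑ i ∈ Finset.range (n + 1), countWeight η c i :=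
    Finset.sum_pos (fun i _ => countWeight_pos η c i) ⟨0, by simp⟩
  rw [noisyCount_apply, ENNReal.ofReal_div_of_pos hpos, ENNReal.div_eq_inv_mul, mul_comm,
    Finset.sum_range, ENNReal.ofReal_sum_of_nonneg fun (i : Fin (n + 1)) _ =>
      (countWeight_pos η c i).le]

/-! ### Noisy counts -/

section Access
open Prog Arith

/-- Replace the content of a register by its absolute value. -/
def absProg (r : ℕ) : Prog (Effect ReleaseOracle) :=
  .ite r 8 (.arith sub r 8 r) (.arith add r r 8)

theorem wp_absProg {O : Oracle ReleaseOracle} {kk : ℕ} {R : State → ℝ≥0∞} {s : State} (r : ℕ)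
    (h8 : s.mem 8 = 0) : wp (Effect.perform O) kk (absProg r) R s =
      R ⟨Function.update s.mem r |s.mem r|, s.time + 2, s.queries⟩ := by
  simp only [absProg, wp_ite, wp_arith, Arith.apply, h8, zero_sub, add_zero]
  split_ifs with h
  · rw [abs_of_neg h]
  · rw [abs_of_nonneg (not_lt.1 h)]

/-- Count the items that satisfy the query with the code in register `50`. -/
def countLoop : Prog (Effect ReleaseOracle) :=
  .seq (.act (.query .data 55 50 54)) (.seq (.arith add 53 53 55) (.arith add 54 54 9))

/-- One step of drawing a number with probability proportional to its weight. -/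
def reservoirLoop : Prog (Effect ReleaseOracle) :=
  .seq (.arith sub 55 54 53) (.seq (absProg 55)
    (.seq (.arith mul 55 55 20) (.seq (.arith exp 55 55 55) (.seq (.arith add 57 57 55)
      (.seq (.arith div 55 55 57) (.seq (.act (.toss 56 55))
        (.seq (.ite 8 56 (.arith add 52 54 9) (.arith add 52 52 8)) (.arith add 54 54 9))))))))

/-- Draw a new noisy count. -/
def drawProg : Prog (Effect ReleaseOracle) :=
  .seq (.const 53 0) (.seq (.const 54 0) (.seq (.loop 54 0 countLoop)
    (.seq (.const 57 0) (.seq (.const 54 0) (.seq (.arith add 58 0 9)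
      (.seq (.loop 54 58 reservoirLoop) (.store 51 52)))))))

/-- Put the noisy count of the query with the code in register `50` into register `52`. -/
def accessProg : Prog (Effect ReleaseOracle) :=
  .seq (.arith sub 30 30 9) (.seq (.arith mul 51 50 10) (.seq (.arith add 51 51 14)
    (.seq (.load 52 51) (.seq (.ite 52 9 drawProg (.arith add 52 52 8)) (.arith sub 52 52 9)))))

variable {Q U : Type*} {enc : Q ↪ ℕ} {P : Q → U → Bool} {G : PMF Q} {n : ℕ} {D : Fin n → U}
  {kk : ℕ} {R : State → ℝ≥0∞}

/-- The form of all program specifications below: if the continuation is bounded at every state that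
satisfies the postcondition, including its time bound, then so is the weakest precondition. Here `d`
counts the rounds to come, and `j` the tests still allowed. -/
theorem wpLoop_countLoop (q : Q) (g : ℕ → ℝ)
    (hg : ∀ i (h : i < n), g i = if P q (D ⟨i, h⟩) = true then 1 else 0) (L : ℝ≥0∞) (d : ℕ) :
    ∀ (i j : ℕ) (M : ℕ → ℝ) (τ u : ℕ), i + d = n → d + 1 ≤ j → M 54 = i →
      M 53 = ∑ i ∈ Finset.range i, g i → M 0 = n → M 9 = 1 → M 50 = enc q →
      (∀ M' τ' u', (∀ a, a ≠ 53 → a ≠ 54 → a ≠ 55 → a ≠ 56 → M' a = M a) →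
        M' 53 = ∑ i ∈ Finset.range n, g i → τ' ≤ τ + 10 * d + 1 → R ⟨M', τ', u'⟩ ≤ L) →
      wpLoop (Effect.perform (releaseAccess enc P G D)) kk 54 0 countLoop R j ⟨M, τ, u⟩ ≤ L := by
  induction d with
  | zero =>
    intro i j M τ u hi hj h54 h53 h0 h9 h50 hR
    obtain ⟨j, rfl⟩ : ∃ j', j = j' + 1 := ⟨j - 1, by omega⟩
    rw [wpLoop_succ, if_neg (by simp only [h54, h0]; norm_cast; omega)]
    exact hR M _ _ (fun _ _ _ _ _ => rfl) (by rw [h53]; congr 2) (by simp)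
  | succ d ih =>
    intro i j M τ u hi hj h54 h53 h0 h9 h50 hR
    obtain ⟨j, rfl⟩ : ∃ j', j = j' + 1 := ⟨j - 1, by omega⟩
    have hin : i < n := by omega
    rw [wpLoop_succ, if_pos (by simp only [h54, h0]; exact_mod_cast hin)]
    have hans : releaseAccess enc P G D .data (enc q) i = PMF.pure (g i, 0) := by
      simp [releaseAccess, decode_enc, hin, hg i hin]
    simp only [countLoop, wp_seq, wp_query, wp_arith, h50, h54, hans, expect_pure, Arith.apply]
    refine ih (i + 1) j _ _ _ (by omega) (by omega) ?_ ?_ ?_ ?_ ?_ fun M' τ' u' h1 h2 h3 =>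
      hR M' τ' u' (fun a ha1 ha2 ha3 ha4 => ?_) h2 (by omega)
    · simp [h54, h9]
    · simp [h53, Finset.sum_range_succ]
    · simp [h0]
    · simp [h9]
    · simp [h50]
    · rw [h1 a ha1 ha2 ha3 ha4]
      simp [ha1, ha2, ha3, ha4]

theorem wp_reservoirLoop {O : Oracle ReleaseOracle} {η c S : ℝ} {i : ℕ} {M : ℕ → ℝ} {τ u : ℕ}
    {A B : ℝ≥0∞} (hS : 0 ≤ S) (h54 : M 54 = i) (h57 : M 57 = S) (h53 : M 53 = c)
    (h20 : M 20 = -η) (h8 : M 8 = 0) (h9 : M 9 = 1)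
    (hR : ∀ M', (∀ a, a ≠ 52 → a ≠ 54 → a ≠ 55 → a ≠ 56 → a ≠ 57 → M' a = M a) →
      M' 54 = (i : ℝ) + 1 → M' 57 = S + countWeight η c i → ∀ τ' ≤ τ + 29, ∀ u',
      (M' 52 = (i : ℝ) + 1 → R ⟨M', τ', u'⟩ ≤ A) ∧ (M' 52 = M 52 → R ⟨M', τ', u'⟩ ≤ B)) :
    wp (Effect.perform O) kk reservoirLoop R ⟨M, τ, u⟩ ≤
      ENNReal.ofReal (countWeight η c i / (S + countWeight η c i)) * A +
        ENNReal.ofReal (S / (S + countWeight η c i)) * B := by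
  have hw : 0 < countWeight η c i := countWeight_pos η c i
  have hexp : Real.exp (-(|(i : ℝ) - c| * η)) = countWeight η c i := by
    rw [countWeight, mul_comm]
  have hp : max 0 (min 1 (countWeight η c i / (S + countWeight η c i))) =
      countWeight η c i / (S + countWeight η c i) := by
    rw [min_eq_right ((div_le_one (by positivity)).2 (by linarith)), max_eq_right (by positivity)]
  have h1p : 1 - countWeight η c i / (S + countWeight η c i) = S / (S + countWeight η c i) := by
    field_simp; ring
  simp only [reservoirLoop, wp_seq, wp_arith, Arith.apply]
  simp [wp_absProg, Arith.apply, h8, h9, h53, h54, h20, h57, hexp, hp, h1p, expect_coin]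
  gcongr
  · refine (hR _ (fun a h1 h2 h3 h4 h5 => ?_) ?_ ?_ _ ?_ _).1 ?_
    · simp [h1, h2, h3, h4, h5]
    · simp
    · simp
    · omega
    · simp
  · refine (hR _ (fun a h1 h2 h3 h4 h5 => ?_) ?_ ?_ _ ?_ _).2 ?_
    · simp [h1, h2, h3, h4, h5]
    · simp
    · simp
    · omega
    · simp

/-- One step of weighted reservoir sampling: the new item replaces the old one with probability w/(S
+ w), and the old one survives with probability S/(S + w). The term `T` stands for the items still
to come. -/
theorem reservoir_identity {S w Z : ℝ} (hS : 0 ≤ S) (hw : 0 < w) (hZ : 0 < Z) (A B T : ℝ≥0∞) :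
    ENNReal.ofReal (w / (S + w)) * (ENNReal.ofReal ((S + w) / Z) * A + T) +
      ENNReal.ofReal (S / (S + w)) * (ENNReal.ofReal ((S + w) / Z) * B + T) =
    ENNReal.ofReal (S / Z) * B + (ENNReal.ofReal (w / Z) * A + T) := by
  have e1 : ENNReal.ofReal (w / (S + w)) * ENNReal.ofReal ((S + w) / Z) =
      ENNReal.ofReal (w / Z) := by
    rw [← ENNReal.ofReal_mul (by positivity)]; congr 1; field_simp
  have e2 : ENNReal.ofReal (S / (S + w)) * ENNReal.ofReal ((S + w) / Z) =
      ENNReal.ofReal (S / Z) := by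
    rw [← ENNReal.ofReal_mul (by positivity)]; congr 1; field_simp
  have e3 : ENNReal.ofReal (w / (S + w)) + ENNReal.ofReal (S / (S + w)) = 1 := by
    rw [← ENNReal.ofReal_add (by positivity) (by positivity), ← ENNReal.ofReal_one]
    congr 1; field_simp; ring
  calc _ = (ENNReal.ofReal (w / (S + w)) * ENNReal.ofReal ((S + w) / Z)) * A +
        (ENNReal.ofReal (S / (S + w)) * ENNReal.ofReal ((S + w) / Z)) * B +
        (ENNReal.ofReal (w / (S + w)) + ENNReal.ofReal (S / (S + w))) * T := by ring
    _ = _ := by rw [e1, e2, e3, one_mul]; ring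

/-- The item held before round i survives all later rounds with probability S_i/Z, where S_i is the
weight seen so far; each later item is held at the end with its own share of Z. A single pass thus
samples in proportion to the weights by coin tosses alone. -/
theorem wpLoop_reservoirLoop {O : Oracle ReleaseOracle} (η c : ℝ) (bd : ℝ → ℝ≥0∞) (d : ℕ) :
    ∀ (i j : ℕ) (M : ℕ → ℝ) (τ u : ℕ), i + d = n + 1 → d + 1 ≤ j → M 54 = i →
      M 57 = ∑ i ∈ Finset.range i, countWeight η c i → M 58 = n + 1 → M 53 = c → M 20 = -η →
      M 8 = 0 → M 9 = 1 →
      (∀ M' τ' u', (∀ a, a ≠ 52 → a ≠ 54 → a ≠ 55 → a ≠ 56 → a ≠ 57 → M' a = M a) →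
        τ' ≤ τ + 30 * d + 1 → R ⟨M', τ', u'⟩ ≤ bd (M' 52)) →
      wpLoop (Effect.perform O) kk 54 58 reservoirLoop R j ⟨M, τ, u⟩ ≤
        ENNReal.ofReal ((∑ i ∈ Finset.range i, countWeight η c i) /
          ∑ i ∈ Finset.range (n + 1), countWeight η c i) * bd (M 52) +
        ∑ i' ∈ Finset.Ico i (n + 1), ENNReal.ofReal (countWeight η c i' /
          ∑ i ∈ Finset.range (n + 1), countWeight η c i) * bd (i' + 1) := by
  set Z := ∑ i ∈ Finset.range (n + 1), countWeight η c i with hZ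
  have hZpos : 0 < Z := Finset.sum_pos (fun i _ => countWeight_pos η c i) ⟨0, by simp⟩
  induction d with
  | zero =>
    intro i j M τ u hi hj h54 h57 h58 h53 h20 h8 h9 hR
    obtain ⟨j, rfl⟩ : ∃ j', j = j' + 1 := ⟨j - 1, by omega⟩
    obtain rfl : i = n + 1 := by omega
    rw [wpLoop_succ, if_neg (by simp only [h54, h58]; push_cast; linarith)]
    rw [← hZ, div_self hZpos.ne', ENNReal.ofReal_one, one_mul]
    exact (hR M _ _ (fun _ _ _ _ _ _ => rfl) (by simp)).trans le_self_add
  | succ d ih =>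
    intro i j M τ u hi hj h54 h57 h58 h53 h20 h8 h9 hR
    obtain ⟨j, rfl⟩ : ∃ j', j = j' + 1 := ⟨j - 1, by omega⟩
    have hin : i < n + 1 := by omega
    rw [wpLoop_succ, if_pos (by simp only [h54, h58]; exact_mod_cast hin)]
    have hS0 : 0 ≤ ∑ i ∈ Finset.range i, countWeight η c i :=
      Finset.sum_nonneg fun i _ => (countWeight_pos η c i).le
    rw [Finset.sum_eq_sum_Ico_succ_bot hin, ← reservoir_identity hS0 (countWeight_pos η c i) hZpos]
    refine wp_reservoirLoop hS0 h54 h57 h53 h20 h8 h9 fun M₁ hM1 hM2 hM3 τ' hτ' u' => ?_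
    have key := ih (i + 1) j M₁ τ' u' (by omega) (by omega) (by rw [hM2]; push_cast; ring)
      (by rw [hM3, Finset.sum_range_succ]) (by rw [hM1 58] <;> simp [h58])
      (by rw [hM1 53] <;> simp [h53]) (by rw [hM1 20] <;> simp [h20])
      (by rw [hM1 8] <;> simp [h8]) (by rw [hM1 9] <;> simp [h9])
      fun M' τ'' u'' h1 h2 => hR M' τ'' u'' (fun a b1 b2 b3 b4 b5 => by
        rw [h1 a b1 b2 b3 b4 b5, hM1 a b1 b2 b3 b4 b5]) (by dsimp only at hτ'; omega)
    rw [Finset.sum_range_succ] at key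
    exact ⟨fun h => by rwa [h] at key, fun h => by rwa [h] at key⟩

/-- The content of a cell of the table: one more than the noisy count, or zero if there is none. -/
def tableCell {n : ℕ} (v : Option (Fin (n + 1))) : ℝ := v.elim 0 fun v => ((v : ℕ) : ℝ) + 1

theorem wp_drawProg {η : ℝ} {q : Q} {M : ℕ → ℝ} {τ u A : ℕ} {bd : Fin (n + 1) → ℝ≥0∞}
    (hk : n + 2 ≤ kk) (h0 : M 0 = n) (h8 : M 8 = 0) (h9 : M 9 = 1) (h20 : M 20 = -η)
    (h50 : M 50 = enc q) (h51 : M 51 = A) (hA : 64 ≤ A)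
    (hR : ∀ M' τ' u' v, (∀ a, a ≤ 50 ∨ 64 ≤ a → a ≠ A → M' a = M a) →
      M' A = tableCell (some v) → M' 52 = tableCell (some v) → τ' ≤ τ + 40 * n + 60 →
      R ⟨M', τ', u'⟩ ≤ bd v) :
    wp (Effect.perform (releaseAccess enc P G D)) kk drawProg R ⟨M, τ, u⟩ ≤
      expect (noisyCount n η (trueCount P D q)) bd := by
  have hZpos : 0 < ∑ i ∈ Finset.range (n + 1), countWeight η (trueCount P D q) i :=
    Finset.sum_pos (fun i _ => countWeight_pos _ _ i) ⟨0, by simp⟩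
  set g : ℕ → ℝ := fun i => if h : i < n then (if P q (D ⟨i, h⟩) = true then 1 else 0) else 0
    with hg
  have hsum : ∑ i ∈ Finset.range n, g i = trueCount P D q := by
    rw [Finset.sum_range, trueCount]
    exact Finset.sum_congr rfl fun i _ => by simp [hg]
  simp only [drawProg, wp_seq, wp_const, wp_loop]
  refine wpLoop_countLoop q g (fun i h => by simp [hg, h]) _ n 0 kk _ _ _ (by omega) (by omega)
    (by simp) (by simp) (by simp [h0]) (by simp [h9]) (by simp [h50]) fun M₁ τ₁ u₁ h1 h2 h3 => ?_
  have h1' : ∀ a, a < 53 ∨ 57 ≤ a → M₁ a = M a := fun a ha => by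
    rw [h1 a (by omega) (by omega) (by omega) (by omega),
      Function.update_of_ne (by omega), Function.update_of_ne (by omega)]
  simp only [wp_seq, wp_const, wp_arith, wp_loop, Arith.apply]
  refine (wpLoop_reservoirLoop (n := n) η (trueCount P D q)
    -- The register holds one more than the chosen count. Contents that encode no count get the
    -- value infinity; at the start these carry weight zero.
    (fun x => if h : ∃ v : Fin (n + 1), ((v : ℕ) : ℝ) + 1 = x then bd h.choose else ⊤)
    (n + 1) 0 kk _ _ _ (by omega) (by omega) (by simp) (by simp)
    (by simp [h1', h0, h9]) (by simp [h2, hsum]) (by simp [h1', h20]) (by simp [h1', h8])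
    (by simp [h1', h9]) fun M₂ τ₂ u₂ b1 b2 => ?_).trans ?_
  · split_ifs with h
    · have b1' : ∀ a, a ≤ 51 ∨ 64 ≤ a → M₂ a = M a := fun a ha => by
        rw [b1 a (by omega) (by omega) (by omega) (by omega) (by omega),
          Function.update_of_ne (by omega), Function.update_of_ne (by omega),
          Function.update_of_ne (by omega), h1' a (by omega)]
      simp only [wp_store]
      rw [b1' 51 (by omega), h51, Nat.floor_natCast]
      refine hR _ _ _ _ (fun a h1 h2 => ?_) ?_ ?_ ?_
      · rw [Function.update_of_ne h2, b1' a (by omega)]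
      · simp [tableCell, h.choose_spec]
      · rw [Function.update_of_ne (by omega)]; simp [tableCell, h.choose_spec]
      · omega
    · exact le_top
  · simp only [Finset.range_zero, Finset.sum_empty, zero_div, ENNReal.ofReal_zero, zero_mul,
      zero_add, ← Finset.range_eq_Ico]
    rw [Finset.sum_range, expect, tsum_fintype]
    refine Finset.sum_le_sum fun v _ => ?_
    have h : ∃ v' : Fin (n + 1), ((v' : ℕ) : ℝ) + 1 = ((v : ℕ) : ℝ) + 1 := ⟨v, rfl⟩
    have hv : h.choose = v := Fin.ext (by exact_mod_cast add_right_cancel h.choose_spec)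
    rw [dif_pos h, hv, ofReal_div_weight]

end Access

/-! ### Programs for access to the table of noisy counts and for the learner's queries. -/

section Ask
open Prog Arith

/-- The memory during a run of the learning algorithm: the registers below `30` have fixed
contents, the stream with index `k` is the table of noisy counts, and the streams with smaller
index have given contents. -/
structure Layout {Q : Type*} (enc : Q ↪ ℕ) {n : ℕ} (k : ℕ) (ρ : ℕ → ℝ) (S : ℕ → ℕ → ℝ)
    (T : Q → Option (Fin (n + 1))) (M : ℕ → ℝ) : Prop where
  regs : ∀ a < 30, M a = ρ a
  streams : ∀ j < k, ∀ i, M (cell (k + 1) j i) = S j i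
  table : ∀ q, M (cell (k + 1) k (enc q)) = tableCell (T q)

/-- The contents of the registers below `30`. -/
structure Registers (π : Params) (j : ℕ) (ρ : ℕ → ℝ) : Prop where
  size : ρ 0 = π.n
  zero : ρ 8 = 0
  one : ρ 9 = 1
  width : ρ 10 = π.k + 1
  base : ρ 13 = 64 + j
  table : ρ 14 = 64 + π.k
  threshold : ρ 15 = thr π.k j * π.n
  fuel : ρ 17 = π.r
  distance : ρ 19 = π.α / 16 * π.n
  scale : ρ 20 = -π.η

variable {Q U : Type*} {enc : Q ↪ ℕ} {P : Q → U → Bool} {G : PMF Q} {π : Params}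
  {D : Fin π.n → U} {kk j : ℕ} {R : State → ℝ≥0∞} {ρ : ℕ → ℝ} {S : ℕ → ℕ → ℝ}
  {T : Q → Option (Fin (π.n + 1))} {M : ℕ → ℝ}

theorem Layout.congr {n k : ℕ} {T : Q → Option (Fin (n + 1))} (h : Layout enc k ρ S T M)
    {M' : ℕ → ℝ} (h' : ∀ a, a < 30 ∨ 64 ≤ a → M' a = M a) : Layout enc k ρ S T M' :=
  ⟨fun a ha => (h' a (Or.inl ha)).trans (h.regs a ha),
    fun j hj i => (h' _ (Or.inr (le_cell _ _ _))).trans (h.streams j hj i),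
    fun q => (h' _ (Or.inr (le_cell _ _ _))).trans (h.table q)⟩

theorem Layout.update {n k : ℕ} {T : Q → Option (Fin (n + 1))} (h : Layout enc k ρ S T M)
    {a : ℕ} (ha : 30 ≤ a) (ha' : a < 64) (x : ℝ) :
    Layout enc k ρ S T (Function.update M a x) :=
  h.congr fun b hb => Function.update_of_ne (by omega) _ _

/-- The table is the last of the interleaved streams, indexed by codes of queries. Memory starts at
zero and entries are shifted by one, so the test against 1 recognizes the missing ones; only those
cost a draw. -/
theorem wp_accessProg {q : Q} {τ u r : ℕ} {F : Fin (π.n + 1) × (Q → Option (Fin (π.n + 1))) → ℝ≥0∞}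
    (hk : π.n + 2 ≤ kk) (hρ : Registers π j ρ) (hM : Layout enc π.k ρ S T M)
    (h30 : M 30 = (r : ℝ) + 1) (h50 : M 50 = enc q)
    (hR : ∀ M' τ' u' (v : Fin (π.n + 1)) T', Layout enc π.k ρ S T' M' → (∀ a, 30 < a → a ≤ 50 → M' a = M a) →
      M' 30 = r → M' 52 = (v : ℕ) → τ' ≤ τ + 40 * π.n + 75 → R ⟨M', τ', u'⟩ ≤ F (v, T')) :
    wp (Effect.perform (releaseAccess enc P G D)) kk accessProg R ⟨M, τ, u⟩ ≤
      expect (lazyDraw (noisyAnswer P π D) q T) F := by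
  classical
  have h8 : M 8 = 0 := by rw [hM.regs 8 (by omega), hρ.zero]
  have h9 : M 9 = 1 := by rw [hM.regs 9 (by omega), hρ.one]
  have h10 : M 10 = π.k + 1 := by rw [hM.regs 10 (by omega), hρ.width]
  have h14 : M 14 = 64 + π.k := by rw [hM.regs 14 (by omega), hρ.table]
  have h0 : M 0 = π.n := by rw [hM.regs 0 (by omega), hρ.size]
  have h20 : M 20 = -π.η := by rw [hM.regs 20 (by omega), hρ.scale]
  have haddr : (enc q : ℝ) * (π.k + 1) + (64 + π.k) = (cell (π.k + 1) π.k (enc q) : ℕ) := by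
    unfold cell; push_cast; ring
  have hle := le_cell (π.k + 1) π.k (enc q)
  have hload : M (cell (π.k + 1) π.k (enc q)) = tableCell (T q) := hM.table q
  simp only [accessProg, wp_seq, wp_arith, wp_load, wp_ite, Arith.apply]
  simp only [Function.update_self, ne_eq, not_false_eq_true, Nat.reduceEqDiff,
    Function.update_of_ne, h8, h9, h10, h14, h50, h30, haddr, Nat.floor_natCast]
  simp only [Function.update_of_ne (show cell (π.k + 1) π.k (enc q) ≠ 51 by omega),
    Function.update_of_ne (show cell (π.k + 1) π.k (enc q) ≠ 30 by omega), hload]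
  cases hT : T q with
  | some v =>
    rw [if_neg (by simp [tableCell]), lazyDraw_some hT, expect_pure]
    refine hR _ _ _ v T (hM.congr fun a ha => ?_) (fun a h1 h2 => ?_) ?_ ?_ ?_
    · simp [show a ≠ 30 by omega, show a ≠ 51 by omega, show a ≠ 52 by omega]
    · simp [show a ≠ 30 by omega, show a ≠ 51 by omega, show a ≠ 52 by omega]
    · simp
    · simp [tableCell]
    · omega
  | none =>
    rw [if_pos (by simp [tableCell]), lazyDraw_none hT, expect_map]
    refine wp_drawProg (A := cell (π.k + 1) π.k (enc q)) hk (by simp [h0]) (by simp [h8])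
      (by simp [h9]) (by simp [h20]) (by simp [h50]) (by simp) hle fun M' τ' u' v b1 b2 b3 b4 => ?_
    have b1' : ∀ a, (a ≤ 50 ∨ 64 ≤ a) → a ≠ cell (π.k + 1) π.k (enc q) → a ≠ 30 →
        M' a = M a := fun a ha ha' ha'' => by
      rw [b1 a (by omega) ha', Function.update_of_ne (by omega), Function.update_of_ne (by omega),
        Function.update_of_ne (by omega), Function.update_of_ne (by omega)]
    simp only [wp_arith, Arith.apply]
    refine hR _ _ _ v (Function.update T q (some v)) ⟨fun a ha => ?_, fun j hj i => ?_,
      fun q' => ?_⟩ (fun a h1 h2 => ?_) ?_ ?_ ?_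
    · rw [Function.update_of_ne (by omega), b1' a (by omega) (by omega) (by omega), hM.regs a ha]
    · have := le_cell (π.k + 1) j i
      rw [Function.update_of_ne (by omega), b1' _ (by omega) (cell_ne (by omega) (by omega)
        (by omega)) (by omega), hM.streams j hj i]
    · have := le_cell (π.k + 1) π.k (enc q')
      rw [Function.update_of_ne (by omega)]
      by_cases hq : q' = q
      · subst hq; rw [b2, Function.update_self]
      · rw [b1' _ (by omega) (fun h => hq (enc.injective (cell_inj (by omega) h))) (by omega),
          hM.table, Function.update_of_ne hq]
    · rw [Function.update_of_ne (by omega), b1' a (by omega) (by omega) (by omega)]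
    · rw [Function.update_of_ne (by omega), b1 30 (by omega) (by omega)]
      simp
    · rw [Function.update_self, b3, b1' 9 (by omega) (by omega) (by omega), h9]
      simp [tableCell]
    · omega

/-- Ask for the noisy count of the query with the code in register `50`, and continue with `p` or
`p'` depending on whether the count is far from the threshold. -/
def askProg (p p' : Prog (Effect ReleaseOracle)) : Prog (Effect ReleaseOracle) :=
  .seq accessProg (.seq (.arith sub 53 52 15) (.seq (absProg 53) (.ite 53 19 p' p)))

theorem wp_askProg {q : Q} {τ u r : ℕ} {F : Fin (π.n + 1) × (Q → Option (Fin (π.n + 1))) → ℝ≥0∞}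
    {p p' : Prog (Effect ReleaseOracle)}
    (hk : π.n + 2 ≤ kk) (hρ : Registers π j ρ) (hM : Layout enc π.k ρ S T M)
    (h30 : M 30 = (r : ℝ) + 1) (h50 : M 50 = enc q)
    (hR : ∀ M' τ' u' (v : Fin (π.n + 1)) T', Layout enc π.k ρ S T' M' →
      (∀ a, 30 < a → a ≤ 50 → M' a = M a) →
      M' 30 = r → M' 52 = (v : ℕ) → τ' ≤ τ + 40 * π.n + 85 →
      (farFrom π.n π.k π.α j v →
        wp (Effect.perform (releaseAccess enc P G D)) kk p R ⟨M', τ', u'⟩ ≤ F (v, T')) ∧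
      (¬farFrom π.n π.k π.α j v →
        wp (Effect.perform (releaseAccess enc P G D)) kk p' R ⟨M', τ', u'⟩ ≤ F (v, T'))) :
    wp (Effect.perform (releaseAccess enc P G D)) kk (askProg p p') R ⟨M, τ, u⟩ ≤
      expect (lazyDraw (noisyAnswer P π D) q T) F := by
  simp only [askProg, wp_seq]
  refine wp_accessProg hk hρ hM h30 h50 fun M' τ' u' v T' hM' b1 b2 b3 b4 => ?_
  have h15 : M' 15 = thr π.k j * π.n := by rw [hM'.regs 15 (by omega), hρ.threshold]
  have h19 : M' 19 = π.α / 16 * π.n := by rw [hM'.regs 19 (by omega), hρ.distance]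
  have h8 : M' 8 = 0 := by rw [hM'.regs 8 (by omega), hρ.zero]
  simp only [wp_seq, wp_arith, Arith.apply]
  rw [wp_absProg _ (by simp [h8])]
  simp only [wp_ite]
  have key := hR (Function.update (Function.update M' 53 (M' 52 - M' 15)) 53
      |M' 52 - M' 15|) (τ' + 6) u' v T'
    ((hM'.update (by omega) (by omega) _).update (by omega) (by omega) _)
    (fun a h1 h2 => by
      rw [Function.update_of_ne (by omega), Function.update_of_ne (by omega), b1 a h1 h2])
    (by simp [b2]) (by simp [b3]) (by omega)
  split_ifs with h
  · refine le_trans (le_of_eq ?_) (key.2 ?_)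
    · simp
    · simp [h19, b3, h15] at h
      simpa [farFrom] using h
  · refine le_trans (le_of_eq ?_) (key.1 ?_)
    · simp
    · simp [h19, b3, h15] at h
      simpa [farFrom] using h

/-- Put the label of the count in register `52` into register `41`. -/
def labelProg : Prog (Effect ReleaseOracle) := .ite 52 15 (.const 41 0) (.const 41 1)

theorem wp_labelProg {O : Oracle ReleaseOracle} {v : Fin (π.n + 1)} {τ u : ℕ}
    (h15 : M 15 = thr π.k j * π.n) (h52 : M 52 = (v : ℕ)) :
    wp (Effect.perform O) kk labelProg R ⟨M, τ, u⟩ =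
      R ⟨Function.update M 41 (thrLabel π.n π.k j v), τ + 2, u⟩ := by
  simp only [labelProg, wp_ite, wp_const, thrLabel, h15, h52]
  split_ifs <;> simp

/-- One attempt at drawing a query with a good noisy count. -/
def sampleBody : Prog (Effect ReleaseOracle) :=
  .seq (.act (.query .sample 50 8 8)) (askProg
    (.seq (.arith add 40 50 8) (.seq labelProg (.const 42 0))) (.arith add 42 30 8))

/-- Draw queries until one with a good noisy count appears; put its code and its label into the
registers `40` and `41`. -/
def sampleProg : Prog (Effect ReleaseOracle) :=
  .seq (.const 40 0) (.seq (.const 41 (-1)) (.seq (.arith add 42 30 8) (.loop 8 42 sampleBody)))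

/-- The answer to a request for a labeled example. -/
def sampleAnswer {V : Type*} (enc : Q ↪ ℕ) (lab : V → ℝ) : Option (Q × V) → ℝ × ℝ
  | none => (0, -1)
  | some qv => (enc qv.1, lab qv.2)

/-- Register 42 controls the loop: it copies the remaining number of values after a failed attempt
and is set to zero after a success. The time is bounded with the remaining number as a potential,
40n + 100 steps per value, because the number of attempts is random. -/
theorem wpLoop_sampleBody (hk : π.n + 2 ≤ kk) (hρ : Registers π j ρ) (r : ℕ) :
    ∀ (T : Q → Option (Fin (π.n + 1))) (M : ℕ → ℝ) (τ u i : ℕ)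
      (F : Option (Q × Fin (π.n + 1)) × ℕ × (Q → Option (Fin (π.n + 1))) → ℝ≥0∞),
      r + 1 ≤ i → Layout enc π.k ρ S T M → M 30 = r → M 42 = r → M 40 = 0 → M 41 = -1 →
      (∀ M' τ' u' o r' T', Layout enc π.k ρ S T' M' → (∀ a, 30 < a → a < 40 → M' a = M a) →
        M' 30 = (r' : ℕ) → M' 40 = (sampleAnswer enc (thrLabel π.n π.k j) o).1 →
        M' 41 = (sampleAnswer enc (thrLabel π.n π.k j) o).2 →
        r' ≤ r → τ' + (40 * π.n + 100) * r' ≤ τ + (40 * π.n + 100) * r + 2 →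
        R ⟨M', τ', u'⟩ ≤ F (o, r', T')) →
      wpLoop (Effect.perform (releaseAccess enc P G D)) kk 8 42 sampleBody R i ⟨M, τ, u⟩ ≤
        expect (trySample G (lazyDraw (noisyAnswer P π D)) (farFrom π.n π.k π.α j) r T) F := by
  induction r with
  | zero =>
    intro T M τ u i F hi hM h30 h42 h40 h41 hR
    obtain ⟨i, rfl⟩ : ∃ i', i = i' + 1 := ⟨i - 1, by omega⟩
    have h8 : M 8 = 0 := by rw [hM.regs 8 (by omega), hρ.zero]
    rw [wpLoop_succ, if_neg (by simp [h8, h42]), trySample, expect_pure]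
    exact hR M _ _ none 0 T hM (fun _ _ _ => rfl) h30 h40 h41 le_rfl (by simp)
  | succ r ih =>
    intro T M τ u i F hi hM h30 h42 h40 h41 hR
    obtain ⟨i, rfl⟩ : ∃ i', i = i' + 1 := ⟨i - 1, by omega⟩
    have h8 : M 8 = 0 := by rw [hM.regs 8 (by omega), hρ.zero]
    rw [wpLoop_succ, if_pos (by simp only [h8, h42]; positivity), trySample]
    simp only [sampleBody, wp_seq, wp_query, releaseAccess, expect_bind, expect_map]
    refine expect_mono fun q => ?_
    refine wp_askProg hk hρ (r := r) ((hM.update (by omega) (by omega) _).update (by omega)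
      (by omega) _) (by simp [h30]) (by simp) fun M' τ' u' v T' hM' b1 b2 b3 b4 =>
      ⟨fun hv => ?_, fun hv => ?_⟩
    · rw [if_pos hv, expect_pure]
      have h15 : M' 15 = thr π.k j * π.n := by rw [hM'.regs 15 (by omega), hρ.threshold]
      have h8' : M' 8 = 0 := by rw [hM'.regs 8 (by omega), hρ.zero]
      have h50 : M' 50 = enc q := by rw [b1 50 (by omega) le_rfl]; simp
      simp only [wp_seq, wp_arith, Arith.apply]
      rw [wp_labelProg (j := j) (v := v) (by simp [h15]) (by simp [b3])]
      simp only [wp_const]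
      -- After a success one more test is needed to leave the loop.
      obtain ⟨i, rfl⟩ : ∃ i', i = i' + 1 := ⟨i - 1, by omega⟩
      rw [wpLoop_succ, if_neg (by simp [h8'])]
      refine hR _ _ _ (some (q, v)) r T' (((hM'.update (by omega) (by omega) _).update (by omega)
        (by omega) _).update (by omega) (by omega) _) (fun a h1 h2 => ?_) ?_ ?_ ?_ (by omega) ?_
      · dsimp only
        rw [Function.update_of_ne (by omega), Function.update_of_ne (by omega),
          Function.update_of_ne (by omega), b1 a h1 (by omega), Function.update_of_ne (by omega),
          Function.update_of_ne (by omega)]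
      · simp [b2]
      · simp [sampleAnswer, h50, h8']
      · simp [sampleAnswer]
      · linarith
    · rw [if_neg hv]
      have h8' : M' 8 = 0 := by rw [hM'.regs 8 (by omega), hρ.zero]
      simp only [wp_arith, Arith.apply]
      refine ih T' _ _ _ i F (by omega) (hM'.update (by omega) (by omega) _) (by simp [b2])
        (by simp [b2, h8']) ?_ ?_ fun M'' τ'' u'' o r' T'' c1 c2 c3 c4 c5 c0 c6 =>
        hR _ _ _ _ _ _ c1 (fun a h1 h2 => ?_) c3 c4 c5 (by omega) ?_
      · rw [Function.update_of_ne (by omega), b1 40 (by omega) (by omega)]; simp [h40]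
      · rw [Function.update_of_ne (by omega), b1 41 (by omega) (by omega)]; simp [h41]
      · rw [c2 a h1 h2, Function.update_of_ne (by omega), b1 a h1 (by omega),
          Function.update_of_ne (by omega), Function.update_of_ne (by omega)]
      · linarith

theorem wp_sampleProg {r τ u : ℕ}
    {F : Option (Q × Fin (π.n + 1)) × ℕ × (Q → Option (Fin (π.n + 1))) → ℝ≥0∞}
    (hk : π.n + 2 ≤ kk) (hr : r + 1 ≤ kk) (hρ : Registers π j ρ) (hM : Layout enc π.k ρ S T M)
    (h30 : M 30 = r)
    (hR : ∀ M' τ' u' o r' T', Layout enc π.k ρ S T' M' → (∀ a, 30 < a → a < 40 → M' a = M a) →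
      M' 30 = (r' : ℕ) → M' 40 = (sampleAnswer enc (thrLabel π.n π.k j) o).1 →
      M' 41 = (sampleAnswer enc (thrLabel π.n π.k j) o).2 →
      r' ≤ r → τ' + (40 * π.n + 100) * r' ≤ τ + (40 * π.n + 100) * r + 10 →
      R ⟨M', τ', u'⟩ ≤ F (o, r', T')) :
    wp (Effect.perform (releaseAccess enc P G D)) kk sampleProg R ⟨M, τ, u⟩ ≤
      expect (trySample G (lazyDraw (noisyAnswer P π D)) (farFrom π.n π.k π.α j) r T) F := by
  have h8 : M 8 = 0 := by rw [hM.regs 8 (by omega), hρ.zero]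
  simp only [sampleProg, wp_seq, wp_const, wp_arith, Arith.apply, wp_loop]
  refine wpLoop_sampleBody hk hρ r T _ _ _ kk F hr (((hM.update (by omega) (by omega) _).update
    (by omega) (by omega) _).update (by omega) (by omega) _) (by simp [h30]) (by simp [h30, h8])
    (by simp) (by simp) fun M' τ' u' o r' T' c1 c2 c3 c4 c5 c0 c6 =>
    hR M' τ' u' o r' T' c1 (fun a h1 h2 => ?_) c3 c4 c5 c0 (by omega)
  rw [c2 a h1 h2, Function.update_of_ne (by omega), Function.update_of_ne (by omega),
    Function.update_of_ne (by omega)]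

/-- Answer an evaluation query at the code in register `50`: the two components of the answer are
put into the registers `40` and `41`. -/
def evalProg : Prog (Effect ReleaseOracle) :=
  .seq (.act (.query .evaluate 40 50 8)) (.seq (.const 41 (-1)) (.ite 8 40
    (.ite 8 30 (askProg (.seq (.arith div 40 40 16) labelProg) (.const 40 0)) (.const 40 0))
    (.const 40 0)))

/-- The law of the answer to an evaluation query, with the remaining number of values and the new
record. -/
def evalAnswer {V X : Type*} (enc : Q ↪ ℕ) (G : PMF Q) (dr : Q → X → PMF (V × X))
    (good : V → Prop) (lab : V → ℝ) (η x : ℝ) (r : ℕ) (T : X) : PMF ((ℝ × ℝ) × ℕ × X) :=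
  match decode enc x with
  | none => PMF.pure ((0, -1), r, T)
  | some q =>
    open Classical in
    if G q = 0 then PMF.pure ((0, -1), r, T) else
    match r with
    | 0 => PMF.pure ((0, -1), 0, T)
    | r + 1 => (dr q T).map fun o =>
      if good o.1 then (((G q).toReal / η, lab o.1), r, o.2) else ((0, -1), r, o.2)

theorem wp_evalProg {r τ u : ℕ} {η x : ℝ}
    {F : (ℝ × ℝ) × ℕ × (Q → Option (Fin (π.n + 1))) → ℝ≥0∞}
    (hk : π.n + 2 ≤ kk) (hρ : Registers π j ρ) (hM : Layout enc π.k ρ S T M)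
    (h16 : M 16 = η) (h30 : M 30 = r) (h50 : M 50 = x)
    (hR : ∀ M' τ' u' o r' T', Layout enc π.k ρ S T' M' → (∀ a, 30 < a → a < 40 → M' a = M a) →
      M' 30 = (r' : ℕ) → M' 40 = o.1 → M' 41 = o.2 →
      r' ≤ r → τ' + (40 * π.n + 100) * r' ≤ τ + (40 * π.n + 100) * r + 10 →
      R ⟨M', τ', u'⟩ ≤ F (o, r', T')) :
    wp (Effect.perform (releaseAccess enc P G D)) kk evalProg R ⟨M, τ, u⟩ ≤
      expect (evalAnswer enc G (lazyDraw (noisyAnswer P π D)) (farFrom π.n π.k π.α j)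
        (thrLabel π.n π.k j) η x r T) F := by
  classical
  have h8 : M 8 = 0 := by rw [hM.regs 8 (by omega), hρ.zero]
  have hno : ∀ (z : ℝ), ∀ τ' ≤ τ + 10, R ⟨Function.update (Function.update (Function.update (Function.update M 40 z)
      41 0) 41 (-1)) 40 0, τ', u + 1⟩ ≤ F ((0, -1), r, T) := fun z τ' hτ' => by
    refine hR _ _ _ _ _ _ ((((hM.update (by omega) (by omega) _).update (by omega) (by omega)
      _).update (by omega) (by omega) _).update (by omega) (by omega) _) (fun a h1 h2 => ?_) ?_ ?_
      ?_ le_rfl ?_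
    · rw [Function.update_of_ne (by omega), Function.update_of_ne (by omega),
        Function.update_of_ne (by omega), Function.update_of_ne (by omega)]
    · simp [h30]
    · simp
    · simp
    · omega
  simp only [evalProg, wp_seq, wp_query, releaseAccess, expect_pure, wp_const, wp_ite, h50,
    evalAnswer]
  cases hx : decode enc x with
  | none =>
    simp only [expect_pure]
    rw [if_neg (by simp [h8])]
    simpa using hno 0 (τ + 6) (by omega)
  | some q =>
    simp only
    by_cases hG : G q = 0
    · rw [if_neg (by simp [h8, hG]), if_pos hG, expect_pure]
      simpa using hno (G q).toReal (τ + 6) (by omega)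
    · have hG' : 0 < (G q).toReal := ENNReal.toReal_pos hG (PMF.apply_ne_top G q)
      rw [if_pos (by simpa [h8] using hG'), if_neg hG]
      cases r with
      | zero =>
        rw [if_neg (by simp [h8, h30])]
        simp only [expect_pure]
        simpa using hno (G q).toReal (τ + 7) (by omega)
      | succ r =>
        rw [if_pos (by simp [h8, h30]; positivity)]
        simp only [expect_map]
        refine wp_askProg hk hρ (r := r) (((hM.update (by omega) (by omega) _).update (by omega)
          (by omega) _).update (by omega) (by omega) _) (by simp [h30])
          (by simp [h50, enc_of_decode hx]) fun M' τ' u' v T' hM' b1 b2 b3 b4 =>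
          ⟨fun hv => ?_, fun hv => ?_⟩
        · have h15 : M' 15 = thr π.k j * π.n := by rw [hM'.regs 15 (by omega), hρ.threshold]
          have h16' : M' 16 = η := by
            rw [hM'.regs 16 (by omega), ← hM.regs 16 (by omega), h16]
          have h40 : M' 40 = (G q).toReal := by rw [b1 40 (by omega) (by omega)]; simp
          simp only [wp_seq, wp_arith, Arith.apply]
          rw [wp_labelProg (j := j) (v := v) (by simp [h15]) (by simp [b3]), if_pos hv]
          refine hR _ _ _ _ _ _ ((hM'.update (by omega) (by omega) _).update (by omega)
            (by omega) _) (fun a h1 h2 => ?_) ?_ ?_ ?_ (by omega) ?_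
          · rw [Function.update_of_ne (by omega), Function.update_of_ne (by omega),
              b1 a h1 (by omega), Function.update_of_ne (by omega), Function.update_of_ne (by omega),
              Function.update_of_ne (by omega)]
          · simp [b2]
          · simp [h40, h16']
          · simp
          · linarith
        · simp only [wp_const]
          rw [if_neg hv]
          refine hR _ _ _ _ _ _ (hM'.update (by omega) (by omega) _) (fun a h1 h2 => ?_) ?_ ?_ ?_ (by omega) ?_
          · rw [Function.update_of_ne (by omega),
              b1 a h1 (by omega), Function.update_of_ne (by omega), Function.update_of_ne (by omega),
              Function.update_of_ne (by omega)]
          · simp [b2]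
          · simp
          · rw [Function.update_of_ne (by omega), b1 41 (by omega) (by omega)]; simp
          · linarith

/-- Look at the noisy count of one more query of the sample. -/
def estimateBody : Prog (Effect ReleaseOracle) :=
  .seq (.act (.query .sample 50 8 8)) (askProg (.arith add 44 44 9) (.arith add 44 44 8))

/-- Count the good noisy counts in a sample. -/
def estimateProg : Prog (Effect ReleaseOracle) := .seq (.const 44 0) (.loop 17 30 estimateBody)

/-- The supply of values serves as the loop counter: it starts at r + m and the loop stops at r,
which leaves exactly `r` values for the learner. -/
theorem wpLoop_estimateBody (hk : π.n + 2 ≤ kk) (hρ : Registers π j ρ) (m : ℕ) :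
    ∀ (T : Q → Option (Fin (π.n + 1))) (M : ℕ → ℝ) (τ u i c : ℕ)
      (F : ℕ × (Q → Option (Fin (π.n + 1))) → ℝ≥0∞),
      m + 1 ≤ i → Layout enc π.k ρ S T M → M 30 = ((π.r + m : ℕ) : ℝ) → M 44 = c →
      (∀ M' τ' u' c' T', Layout enc π.k ρ S T' M' → (∀ a, 30 < a → a < 40 → M' a = M a) →
        M' 30 = π.r → M' 44 = (c' : ℕ) → τ' ≤ τ + (40 * π.n + 100) * m + 1 →
        R ⟨M', τ', u'⟩ ≤ F (c', T')) →
      wpLoop (Effect.perform (releaseAccess enc P G D)) kk 17 30 estimateBody R i ⟨M, τ, u⟩ ≤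
        expect (countGood G (lazyDraw (noisyAnswer P π D)) (farFrom π.n π.k π.α j) m c T) F := by
  induction m with
  | zero =>
    intro T M τ u i c F hi hM h30 h44 hR
    obtain ⟨i, rfl⟩ : ∃ i', i = i' + 1 := ⟨i - 1, by omega⟩
    have h17 : M 17 = π.r := by rw [hM.regs 17 (by omega), hρ.fuel]
    rw [wpLoop_succ, if_neg (by simp [h17, h30]), countGood, expect_pure]
    exact hR M _ _ c T hM (fun _ _ _ => rfl) h30 h44 (by simp)
  | succ m ih =>
    intro T M τ u i c F hi hM h30 h44 hR
    obtain ⟨i, rfl⟩ : ∃ i', i = i' + 1 := ⟨i - 1, by omega⟩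
    have h17 : M 17 = π.r := by rw [hM.regs 17 (by omega), hρ.fuel]
    rw [wpLoop_succ, if_pos (by simp only [h17, h30]; exact_mod_cast (by omega)), countGood]
    simp only [estimateBody, wp_seq, wp_query, releaseAccess, expect_bind, expect_map]
    refine expect_mono fun q => ?_
    refine wp_askProg hk hρ (r := π.r + m) ((hM.update (by omega) (by omega) _).update (by omega)
      (by omega) _) (by simp [h30, add_assoc]) (by simp) fun M' τ' u' v T' hM' b1 b2 b3 b4 =>
      ⟨fun hv => ?_, fun hv => ?_⟩
    all_goals
      have h8 : M' 8 = 0 := by rw [hM'.regs 8 (by omega), hρ.zero]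
      have h9 : M' 9 = 1 := by rw [hM'.regs 9 (by omega), hρ.one]
      have h44' : M' 44 = c := by rw [b1 44 (by omega) (by omega)]; simp [h44]
      simp only [wp_arith, Arith.apply]
    · rw [if_pos hv]
      refine ih T' _ _ _ i (c + 1) F (by omega) (hM'.update (by omega) (by omega) _) (by simp [b2])
        (by simp [h44', h9]) fun M'' τ'' u'' c' T'' c1 c2 c3 c4 c5 =>
        hR _ _ _ _ _ c1 (fun a h1 h2 => ?_) c3 c4 ?_
      · rw [c2 a h1 h2, Function.update_of_ne (by omega), b1 a h1 (by omega),
          Function.update_of_ne (by omega), Function.update_of_ne (by omega)]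
      · linarith
    · rw [if_neg hv]
      refine ih T' _ _ _ i c F (by omega) (hM'.update (by omega) (by omega) _) (by simp [b2])
        (by simp [h44', h8]) fun M'' τ'' u'' c' T'' c1 c2 c3 c4 c5 =>
        hR _ _ _ _ _ c1 (fun a h1 h2 => ?_) c3 c4 ?_
      · rw [c2 a h1 h2, Function.update_of_ne (by omega), b1 a h1 (by omega),
          Function.update_of_ne (by omega), Function.update_of_ne (by omega)]
      · linarith

theorem wp_estimateProg {τ u : ℕ} {F : ℕ × (Q → Option (Fin (π.n + 1))) → ℝ≥0∞}
    (hk : π.n + 2 ≤ kk) (hm : π.m + 1 ≤ kk) (hρ : Registers π j ρ) (hM : Layout enc π.k ρ S T M)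
    (h30 : M 30 = ((π.r + π.m : ℕ) : ℝ))
    (hR : ∀ M' τ' u' c' T', Layout enc π.k ρ S T' M' → (∀ a, 30 < a → a < 40 → M' a = M a) →
        M' 30 = π.r → M' 44 = (c' : ℕ) → τ' ≤ τ + (40 * π.n + 100) * π.m + 3 →
        R ⟨M', τ', u'⟩ ≤ F (c', T')) :
    wp (Effect.perform (releaseAccess enc P G D)) kk estimateProg R ⟨M, τ, u⟩ ≤
      expect (countGood G (lazyDraw (noisyAnswer P π D)) (farFrom π.n π.k π.α j) π.m 0 T) F := by
  simp only [estimateProg, wp_seq, wp_const, wp_loop]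
  refine wpLoop_estimateBody hk hρ π.m T _ _ _ kk 0 F hm (hM.update (by omega) (by omega) _)
    (by simp [h30]) (by simp) fun M' τ' u' c' T' c1 c2 c3 c4 c5 =>
    hR M' τ' u' c' T' c1 (fun a h1 h2 => ?_) c3 c4 (by omega)
  rw [c2 a h1 h2, Function.update_of_ne (by omega)]

end Ask

/-! ### Clocked simulation of a program inside a stream -/

section Compile
variable {E E' : Type}
open Prog Arith

/-- Load the cell `x` of the stream in use into register `d`. -/
def readCell (x d : ℕ) : Prog E' :=
  .seq (.const d x) (.seq (.arith mul d d 10) (.seq (.arith add d d 13) (.load d d)))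

/-- Store register `v` in the cell `a` of the stream in use. -/
def writeCell (a v : ℕ) : Prog E' :=
  .seq (.const 36 a) (.seq (.arith mul 36 36 10) (.seq (.arith add 36 36 13) (.store 36 v)))

/-- Replace the address in register `36` by the address of the corresponding cell of the stream in
use. -/
def addressProg : Prog E' :=
  .seq (.arith floor 36 36 36) (.seq (.ite 36 8 (.const 36 0) (.arith add 36 36 8))
    (.seq (.arith mul 36 36 10) (.arith add 36 36 13)))

/-- Run a program if the clock has not run out. -/
def guarded (p p' : Prog E') : Prog E' := .ite 8 31 (.seq (.arith sub 31 31 9) p) p'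

/-- Put the outcome of a test, between cells of the stream in use, into register `35`. -/
def testProg (x y : ℕ) : Prog E' :=
  guarded (.seq (readCell x 32) (.seq (readCell y 33) (.ite 32 33 (.const 35 1) (.const 35 0))))
    (.const 35 0)

/-- The program that simulates a given one inside the stream in use, given programs for the
additional instructions. -/
def compile (f : E → Prog E') : Prog E → Prog E'
  | .const a c => guarded (.seq (.const 34 c) (writeCell a 34)) (.const 39 0)
  | .arith o a x y => guarded (.seq (readCell x 32) (.seq (readCell y 33)
      (.seq (.arith o 34 32 33) (writeCell a 34)))) (.const 39 0)
  | .load a x => guarded (.seq (readCell x 36) (.seq addressProg (.seq (.load 34 36)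
      (writeCell a 34)))) (.const 39 0)
  | .store a x => guarded (.seq (readCell x 34) (.seq (readCell a 36) (.seq addressProg
      (.store 36 34)))) (.const 39 0)
  | .act e => guarded (f e) (.const 39 0)
  | .seq p r => guarded (.seq (compile f p) (compile f r)) (.const 39 0)
  | .ite x y p r => guarded (.seq (readCell x 32) (.seq (readCell y 33)
      (.ite 32 33 (compile f p) (compile f r)))) (.const 39 0)
  | .loop x y p => .seq (testProg x y) (.loop 8 35 (.seq (compile f p) (testProg x y)))

/-- The memory `M` simulates a clocked state by its stream with index `j`, out of `W`. -/
structure Simulates {X : Type*} (W j : ℕ) (I : X → (ℕ → ℝ) → Prop) (σ : AS X) (M : ℕ → ℝ) :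
    Prop where
  zero : M 8 = 0
  one : M 9 = 1
  width : M 10 = W
  base : M 13 = 64 + j
  stream : ∀ i, M (cell W j i) = σ.mem i
  clock : M 31 = σ.clock
  inv : I σ.aux M

/-- The property does not depend on the registers `31` to `39` and on the stream with index `j`. -/
def Stable {X : Type*} (W j : ℕ) (I : X → (ℕ → ℝ) → Prop) : Prop :=
  ∀ x M M', I x M → (∀ a, a < 31 ∨ 40 ≤ a → (∀ i, a ≠ cell W j i) → M' a = M a) → I x M'

variable {X : Type*} {W j kk : ℕ} {I : X → (ℕ → ℝ) → Prop} {σ : AS X} {M : ℕ → ℝ}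
  {h : E' → State → PMF State} {R : State → ℝ≥0∞} {τ u : ℕ}

theorem Simulates.update (hM : Simulates W j I σ M) (hI : Stable W j I) {a : ℕ} (ha : 31 < a)
    (ha' : a < 40) (v : ℝ) : Simulates W j I σ (Function.update M a v) := by
  have hu : ∀ b, b ≠ a → Function.update M a v b = M b := fun b hb => Function.update_of_ne hb _ _
  refine ⟨?_, ?_, ?_, ?_, fun i => ?_, ?_, ?_⟩
  · rw [hu _ (by omega), hM.zero]
  · rw [hu _ (by omega), hM.one]
  · rw [hu _ (by omega), hM.width]
  · rw [hu _ (by omega), hM.base]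
  · have := le_cell W j i
    rw [hu _ (by omega), hM.stream]
  · rw [hu _ (by omega), hM.clock]
  · exact hI _ _ _ hM.inv fun b hb _ => hu b (by omega)

theorem Simulates.tick (hM : Simulates W j I σ M) (hI : Stable W j I) (hσ : σ.clock ≠ 0) :
    Simulates W j I ⟨σ.mem, σ.clock - 1, σ.aux⟩ (Function.update M 31 (M 31 - M 9)) := by
  have hu : ∀ b, b ≠ 31 → Function.update M 31 (M 31 - M 9) b = M b :=
    fun b hb => Function.update_of_ne hb _ _
  refine ⟨?_, ?_, ?_, ?_, fun i => ?_, ?_, ?_⟩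
  · rw [hu _ (by omega), hM.zero]
  · rw [hu _ (by omega), hM.one]
  · rw [hu _ (by omega), hM.width]
  · rw [hu _ (by omega), hM.base]
  · have := le_cell W j i
    rw [hu _ (by omega), hM.stream]
  · rw [Function.update_self, hM.clock, hM.one, Nat.cast_sub (by omega), Nat.cast_one]
  · exact hI _ _ _ hM.inv fun b hb _ => hu b (by omega)

theorem Simulates.write (hM : Simulates W j I σ M) (hI : Stable W j I) (hj : j < W) (a : ℕ)
    (v : ℝ) : Simulates W j I (σ.write a v) (Function.update M (cell W j a) v) := by
  have hc := le_cell W j a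
  have hu : ∀ b, b ≠ cell W j a → Function.update M (cell W j a) v b = M b :=
    fun b hb => Function.update_of_ne hb _ _
  refine ⟨?_, ?_, ?_, ?_, fun i => ?_, ?_, ?_⟩
  · rw [hu _ (by omega), hM.zero]
  · rw [hu _ (by omega), hM.one]
  · rw [hu _ (by omega), hM.width]
  · rw [hu _ (by omega), hM.base]
  · by_cases hi : i = a
    · subst hi; simp [AS.write]
    · rw [hu _ fun h => hi (cell_inj hj h), hM.stream]
      exact (Function.update_of_ne hi _ _).symm
  · rw [hu _ (by omega), hM.clock, AS.write]
  · exact hI _ _ _ hM.inv fun b _ hb => hu b (hb a)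

theorem wp_readCell (hM : Simulates W j I σ M) (x : ℕ) {d : ℕ} (h1 : 13 < d) (h2 : d < 64) :
    wp h kk (readCell x d) R ⟨M, τ, u⟩ = R ⟨Function.update M d (σ.mem x), τ + 7, u⟩ := by
  have hc := le_cell W j x
  have haddr : (x : ℝ) * W + (64 + j) = (cell W j x : ℕ) := by unfold cell; push_cast; ring
  simp only [readCell, wp_seq, wp_const, wp_arith, wp_load, Arith.apply]
  simp [Function.update_of_ne (show 10 ≠ d by omega), Function.update_of_ne (show 13 ≠ d by omega),
    Function.update_of_ne (show cell W j x ≠ d by omega), hM.width, hM.base, haddr, hM.stream]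

theorem wp_writeCell_of_eq (h10 : M 10 = W) (h13 : M 13 = 64 + j) (a : ℕ) {v : ℕ} (hv : v ≠ 36) :
    wp h kk (writeCell a v) R ⟨M, τ, u⟩ = R ⟨Function.update (Function.update M 36
      (cell W j a : ℕ)) (cell W j a) (M v), τ + 7, u⟩ := by
  have haddr : (a : ℝ) * W + (64 + j) = (cell W j a : ℕ) := by unfold cell; push_cast; ring
  simp only [writeCell, wp_seq, wp_const, wp_arith, wp_store, Arith.apply]
  simp [h10, h13, haddr, Function.update_of_ne hv]

theorem wp_writeCell (hM : Simulates W j I σ M) (a : ℕ) {v : ℕ} (hv : v ≠ 36) :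
    wp h kk (writeCell a v) R ⟨M, τ, u⟩ = R ⟨Function.update (Function.update M 36
      (cell W j a : ℕ)) (cell W j a) (M v), τ + 7, u⟩ :=
  wp_writeCell_of_eq hM.width hM.base a hv

/-- Indirect addresses are floors, and negative ones mean cell zero. Both have to be settled before
the address is scaled by the number of streams, since scaling does not commute with rounding. -/
theorem wp_addressProg (hM : Simulates W j I σ M) :
    wp h kk addressProg R ⟨M, τ, u⟩ = R ⟨Function.update M 36 (cell W j ⌊M 36⌋₊ : ℕ), τ + 8, u⟩ := by
  simp only [addressProg, wp_seq, wp_const, wp_arith, wp_ite, Arith.apply]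
  simp only [Function.update_self, ne_eq, not_false_eq_true, Nat.reduceEqDiff,
    Function.update_of_ne, Function.update_idem, hM.zero, hM.width, hM.base]
  have key : ∀ z : ℤ, ((z : ℝ) = (⌊M 36⌋₊ : ℝ)) →
      (z : ℝ) * W + (64 + j) = (cell W j ⌊M 36⌋₊ : ℕ) := fun z hz => by
    rw [hz]; unfold cell; push_cast; ring
  by_cases hx : (⌊M 36⌋ : ℝ) < 0
  · have hx' : ⌊M 36⌋ < 0 := by exact_mod_cast hx
    have h0 : ⌊M 36⌋₊ = 0 := Nat.floor_eq_zero.2 (by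
      have := Int.lt_floor_add_one (M 36)
      have h1 : (⌊M 36⌋ : ℝ) ≤ -1 := by exact_mod_cast (by omega : ⌊M 36⌋ ≤ -1)
      linarith)
    rw [if_pos hx]
    simpa using by rw [← key 0 (by simp [h0])]; simp
  · have h0 : 0 ≤ M 36 := Int.floor_nonneg.1 (by exact_mod_cast not_lt.1 hx)
    rw [if_neg hx, add_zero, key _ (natCast_floor_eq_intCast_floor h0).symm]

theorem wp_guarded {p p' : Prog E'} {f : AS X → PMF (AS X)} {F : AS X → ℝ≥0∞}
    (hI : Stable W j I) (hM : Simulates W j I σ M)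
    (h0 : σ.clock = 0 → wp h kk p' R ⟨M, τ + 1, u⟩ ≤ F σ)
    (h1 : ∀ σ' M', Simulates W j I σ' M' → σ'.clock + 1 = σ.clock → σ'.aux = σ.aux →
      wp h kk p R ⟨M', τ + 3, u⟩ ≤ expect (f σ') F) :
    wp h kk (guarded p p') R ⟨M, τ, u⟩ ≤ expect (σ.step f) F := by
  simp only [guarded, wp_ite, wp_seq, wp_arith, hM.zero, Arith.apply, AS.step]
  by_cases hc : σ.clock = 0
  · rw [if_neg (by simp [hM.clock, hc]), if_pos hc, expect_pure]
    exact h0 hc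
  · rw [if_pos (by simp [hM.clock]; omega), if_neg hc]
    exact h1 _ _ (hM.tick hI hc) (by dsimp only; omega) rfl

/-- A program for an additional instruction has the same effect on the simulated state as the
instruction, up to the number of steps. -/
def Implements {X : Type*} (W j kk : ℕ) (I : X → (ℕ → ℝ) → Prop) (pot : X → ℕ)
    (h : E' → State → PMF State) (f : E → Prog E') (g : E → AS X → PMF (AS X)) : Prop :=
  ∀ (e : E) (σ : AS X) (M : ℕ → ℝ) (τ u : ℕ) (R : State → ℝ≥0∞) (F : AS X → ℝ≥0∞),
    Simulates W j I σ M →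
    (∀ σ' M' τ' u', Simulates W j I σ' M' → σ'.clock = σ.clock →
      τ' + pot σ'.aux ≤ τ + pot σ.aux + 90 → R ⟨M', τ', u'⟩ ≤ F σ') →
    wp h kk (f e) R ⟨M, τ, u⟩ ≤ expect (g e σ) F

variable {pot : X → ℕ} {f : E → Prog E'} {g : E → AS X → PMF (AS X)}

/-- The test of a simulated loop concerns cells of the stream, so its outcome is computed into
register 35 before the loop and after each round. An exhausted clock yields a negative outcome,
hence both loops end by then, whatever their bounds. -/
theorem wpLoop_compile (hI : Stable W j I) {x y : ℕ} {p : Prog E}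
    (hp : ∀ (F : AS X → ℝ≥0∞) (R : State → ℝ≥0∞) (σ : AS X) (M : ℕ → ℝ) (τ u : ℕ),
      Simulates W j I σ M → σ.clock + 1 ≤ kk →
      (∀ σ' M' τ' u', Simulates W j I σ' M' → σ'.clock ≤ σ.clock →
        τ' + 100 * σ'.clock + pot σ'.aux ≤ τ + 100 * σ.clock + pot σ.aux + 4 →
        R ⟨M', τ', u'⟩ ≤ F σ') →
      wp h kk (compile f p) R ⟨M, τ, u⟩ ≤ expect (aexec g p σ) F)
    (F : AS X → ℝ≥0∞) (R : State → ℝ≥0∞) (c : ℕ) :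
    ∀ (σ : AS X) (M : ℕ → ℝ) (τ u i : ℕ), Simulates W j I σ M → σ.clock ≤ c → σ.clock + 1 ≤ i →
      σ.clock + 1 ≤ kk →
      (∀ σ' M' τ' u', Simulates W j I σ' M' → σ'.clock ≤ σ.clock →
        τ' + 100 * σ'.clock + pot σ'.aux ≤ τ + 100 * σ.clock + pot σ.aux + 3 →
        R ⟨M', τ', u'⟩ ≤ F σ') →
      wp h kk (testProg x y)
        (wpLoop h kk 8 35 (.seq (compile f p) (testProg x y)) R i) ⟨M, τ, u⟩ ≤
        expect (aloop (fun M => M x < M y) (aexec g p) c σ) F := by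
  classical
  have exhausted : ∀ (σ : AS X) (M : ℕ → ℝ) (τ u i : ℕ), Simulates W j I σ M → 1 ≤ i →
      (∀ M', Simulates W j I σ M' → R ⟨M', τ + 2, u⟩ ≤ F σ) →
      wp h kk (.const 35 0) (wpLoop h kk 8 35 (.seq (compile f p) (testProg x y)) R i)
        ⟨M, τ, u⟩ ≤ F σ := by
    intro σ M τ u i hM hi hR
    obtain ⟨i, rfl⟩ : ∃ i', i = i' + 1 := ⟨i - 1, by omega⟩
    rw [wp_const, wpLoop_succ, if_neg (by simp [hM.zero])]
    exact hR _ (hM.update hI (by omega) (by omega) _)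
  induction c with
  | zero =>
    intro σ M τ u i hM hc hi hk hR
    have hc0 : σ.clock = 0 := by omega
    -- With an exhausted clock the loop without rounds can be written as a guarded step, so that
    -- `wp_guarded` applies.
    have he : aloop (fun M => M x < M y) (aexec g p) 0 σ = σ.step fun σ => PMF.pure σ := by
      simp [aloop, AS.step, hc0]
    rw [he]
    exact wp_guarded hI hM (fun _ => exhausted σ _ _ _ _ hM (by omega) fun M' hM' =>
      hR _ _ _ _ hM' le_rfl (by omega)) fun _ _ _ h => absurd hc0 (by omega)
  | succ c ih =>
    intro σ M τ u i hM hc hi hk hR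
    rw [aloop]
    refine wp_guarded hI hM (fun _ => exhausted σ _ _ _ _ hM (by omega) fun M' hM' =>
      hR _ _ _ _ hM' le_rfl (by omega)) fun σ₁ M₁ hM₁ hσ hx => ?_
    have hpot := congrArg pot hx
    rw [wp_seq, wp_readCell hM₁ x (by omega) (by omega)]
    have hM₂ := hM₁.update hI (a := 32) (by omega) (by omega) (σ₁.mem x)
    rw [wp_seq, wp_readCell hM₂ y (by omega) (by omega)]
    have hM₃ := hM₂.update hI (a := 33) (by omega) (by omega) (σ₁.mem y)
    simp only [wp_ite, Function.update_self, ne_eq, not_false_eq_true, Nat.reduceEqDiff,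
      Function.update_of_ne]
    by_cases ht : σ₁.mem x < σ₁.mem y
    · rw [if_pos ht, if_pos ht, wp_const]
      obtain ⟨i, rfl⟩ : ∃ i', i = i' + 1 := ⟨i - 1, by omega⟩
      have hM₄ := hM₃.update hI (a := 35) (by omega) (by omega) ((1 : ℚ) : ℝ)
      rw [wpLoop_succ, if_pos (by simp [hM₁.zero])]
      rw [wp_seq, expect_bind]
      refine hp _ _ _ _ _ _ hM₄ (by omega) fun σ' M' τ' u' hM' h1 h2 => ?_
      dsimp only at h2
      exact ih σ' M' τ' u' i hM' (by omega) (by omega) (by omega)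
        fun σ'' M'' τ'' u'' hM'' h3 h4 => hR _ _ _ _ hM'' (by omega) (by omega)
    · rw [if_neg ht, if_neg ht, expect_pure]
      exact exhausted _ _ _ _ _ hM₃ (by omega) fun M' hM' =>
        hR _ _ _ _ hM' (by omega) (by omega)

/-- A tick of the clock pays for 100 machine steps, enough for any simulated instruction together
with its overhead; draws of noisy counts are paid from the potential `pot`. The constant 4 covers a
simulated loop whose clock has run out: composition, guard, assignment and final test. -/
theorem wp_compile (hI : Stable W j I) (hj : j < W) (hf : Implements W j kk I pot h f g)
    (p : Prog E) : ∀ (F : AS X → ℝ≥0∞) (R : State → ℝ≥0∞) (σ : AS X) (M : ℕ → ℝ) (τ u : ℕ),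
      Simulates W j I σ M → σ.clock + 1 ≤ kk →
      (∀ σ' M' τ' u', Simulates W j I σ' M' → σ'.clock ≤ σ.clock →
        τ' + 100 * σ'.clock + pot σ'.aux ≤ τ + 100 * σ.clock + pot σ.aux + 4 →
        R ⟨M', τ', u'⟩ ≤ F σ') →
      wp h kk (compile f p) R ⟨M, τ, u⟩ ≤ expect (aexec g p σ) F := by
  classical
  have exhausted : ∀ (F : AS X → ℝ≥0∞) (R : State → ℝ≥0∞) (σ : AS X) (M : ℕ → ℝ) (τ u : ℕ),
      Simulates W j I σ M →
      (∀ σ' M' τ' u', Simulates W j I σ' M' → σ'.clock ≤ σ.clock →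
        τ' + 100 * σ'.clock + pot σ'.aux ≤ τ + 100 * σ.clock + pot σ.aux + 4 →
        R ⟨M', τ', u'⟩ ≤ F σ') →
      wp h kk (.const 39 0) R ⟨M, τ + 1, u⟩ ≤ F σ := by
    intro F R σ M τ u hM hR
    rw [wp_const]
    exact hR _ _ _ _ (hM.update hI (by omega) (by omega) _) le_rfl (by dsimp only; omega)
  induction p with
  | const a c =>
    intro F R σ M τ u hM hk hR
    refine wp_guarded hI hM (fun _ => exhausted F R σ M τ u hM hR) fun σ₁ M₁ hM₁ hσ hx => ?_
    have hpot := congrArg pot hx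
    rw [wp_seq, wp_const, expect_pure, wp_writeCell (hM₁.update hI (by omega) (by omega) _) _ (by omega)]
    refine hR _ _ _ _ ?_ (by dsimp only [AS.write]; omega) (by dsimp only [AS.write]; omega)
    have := ((hM₁.update hI (a := 34) (by omega) (by omega) c).update hI (a := 36) (by omega)
      (by omega) (cell W j a : ℕ)).write hI hj a c
    simpa using this
  | arith o a x y =>
    intro F R σ M τ u hM hk hR
    refine wp_guarded hI hM (fun _ => exhausted F R σ M τ u hM hR) fun σ₁ M₁ hM₁ hσ hx => ?_
    have hpot := congrArg pot hx
    rw [wp_seq, wp_readCell hM₁ x (by omega) (by omega)]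
    have hM₂ := hM₁.update hI (a := 32) (by omega) (by omega) (σ₁.mem x)
    rw [wp_seq, wp_readCell hM₂ y (by omega) (by omega)]
    have hM₃ := hM₂.update hI (a := 33) (by omega) (by omega) (σ₁.mem y)
    simp only [wp_seq, expect_pure, wp_arith, Function.update_self, ne_eq, not_false_eq_true, Nat.reduceEqDiff,
      Function.update_of_ne]
    have hM₄ := hM₃.update hI (a := 34) (by omega) (by omega) (o.apply (σ₁.mem x) (σ₁.mem y))
    rw [wp_writeCell hM₄ _ (by omega), Function.update_self]
    exact hR _ _ _ _ ((hM₄.update hI (by omega) (by omega) _).write hI hj a _)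
      (by dsimp only [AS.write]; omega) (by dsimp only [AS.write]; omega)
  | load a x =>
    intro F R σ M τ u hM hk hR
    refine wp_guarded hI hM (fun _ => exhausted F R σ M τ u hM hR) fun σ₁ M₁ hM₁ hσ hx => ?_
    have hpot := congrArg pot hx
    rw [wp_seq, wp_readCell hM₁ x (by omega) (by omega)]
    have hM₂ := hM₁.update hI (a := 36) (by omega) (by omega) (σ₁.mem x)
    rw [wp_seq, wp_addressProg hM₂]
    have hM₃ := hM₂.update hI (a := 36) (by omega) (by omega) (cell W j ⌊σ₁.mem x⌋₊ : ℕ)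
    simp only [wp_seq, expect_pure, wp_load, Function.update_self, Nat.floor_natCast, hM₃.stream]
    have hM₄ := hM₃.update hI (a := 34) (by omega) (by omega) (σ₁.mem ⌊σ₁.mem x⌋₊)
    rw [wp_writeCell hM₄ _ (by omega), Function.update_self]
    exact hR _ _ _ _ ((hM₄.update hI (by omega) (by omega) _).write hI hj a _)
      (by dsimp only [AS.write]; omega) (by dsimp only [AS.write]; omega)
  | store a x =>
    intro F R σ M τ u hM hk hR
    refine wp_guarded hI hM (fun _ => exhausted F R σ M τ u hM hR) fun σ₁ M₁ hM₁ hσ hx => ?_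
    have hpot := congrArg pot hx
    rw [wp_seq, wp_readCell hM₁ x (by omega) (by omega)]
    have hM₂ := hM₁.update hI (a := 34) (by omega) (by omega) (σ₁.mem x)
    rw [wp_seq, wp_readCell hM₂ a (by omega) (by omega)]
    have hM₃ := hM₂.update hI (a := 36) (by omega) (by omega) (σ₁.mem a)
    rw [wp_seq, wp_addressProg hM₃]
    have hM₄ := hM₃.update hI (a := 36) (by omega) (by omega) (cell W j ⌊σ₁.mem a⌋₊ : ℕ)
    simp only [expect_pure, wp_store, Function.update_self, Nat.floor_natCast, ne_eq, not_false_eq_true,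
      Nat.reduceEqDiff, Function.update_of_ne]
    exact hR _ _ _ _ (hM₄.write hI hj _ _)
      (by dsimp only [AS.write]; omega) (by dsimp only [AS.write]; omega)
  | act e =>
    intro F R σ M τ u hM hk hR
    refine wp_guarded hI hM (fun _ => exhausted F R σ M τ u hM hR) fun σ₁ M₁ hM₁ hσ hx => ?_
    have hpot := congrArg pot hx
    refine hf e _ _ _ _ _ _ hM₁ fun σ' M' τ' u' hM' h1 h2 => ?_
    exact hR _ _ _ _ hM' (by omega) (by omega)
  | seq p r ihp ihr =>
    intro F R σ M τ u hM hk hR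
    refine wp_guarded hI hM (fun _ => exhausted F R σ M τ u hM hR) fun σ₁ M₁ hM₁ hσ hx => ?_
    have hpot := congrArg pot hx
    rw [wp_seq, expect_bind]
    refine ihp _ _ _ _ _ _ hM₁ (by omega) fun σ' M' τ' u' hM' h1 h2 => ?_
    dsimp only at h2
    refine ihr _ _ _ _ _ _ hM' (by omega) fun σ'' M'' τ'' u'' hM'' h3 h4 => ?_
    exact hR _ _ _ _ hM'' (by omega) (by omega)
  | ite x y p r ihp ihr =>
    intro F R σ M τ u hM hk hR
    refine wp_guarded hI hM (fun _ => exhausted F R σ M τ u hM hR) fun σ₁ M₁ hM₁ hσ hx => ?_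
    have hpot := congrArg pot hx
    rw [wp_seq, wp_readCell hM₁ x (by omega) (by omega)]
    have hM₂ := hM₁.update hI (a := 32) (by omega) (by omega) (σ₁.mem x)
    rw [wp_seq, wp_readCell hM₂ y (by omega) (by omega)]
    have hM₃ := hM₂.update hI (a := 33) (by omega) (by omega) (σ₁.mem y)
    simp only [wp_ite, Function.update_self, ne_eq, not_false_eq_true, Nat.reduceEqDiff,
      Function.update_of_ne]
    split_ifs with ht
    · refine ihp _ _ _ _ _ _ hM₃ (by omega) fun σ' M' τ' u' hM' h1 h2 => ?_
      exact hR _ _ _ _ hM' (by omega) (by omega)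
    · refine ihr _ _ _ _ _ _ hM₃ (by omega) fun σ' M' τ' u' hM' h1 h2 => ?_
      exact hR _ _ _ _ hM' (by omega) (by omega)
  | loop x y p ih =>
    intro F R σ M τ u hM hk hR
    rw [compile, wp_seq]
    simp only [aexec]
    have hl : wp h kk (.loop 8 35 (.seq (compile f p) (testProg x y))) R =
        wpLoop h kk 8 35 (.seq (compile f p) (testProg x y)) R kk := funext fun s => wp_loop _ _ _
    rw [hl]
    exact wpLoop_compile hI ih F R σ.clock σ M _ u kk hM le_rfl hk hk
      fun σ' M' τ' u' hM' h1 h2 => hR _ _ _ _ hM' h1 (by omega)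

end Compile

/-! ### Simulation of the learning algorithm -/

section Handler
open Prog Arith

/-- The programs for the additional instructions of the learning algorithm. -/
def effectProg : Effect LearnOracle → Prog (Effect ReleaseOracle)
  | .toss a x => .seq (readCell x 32) (.seq (.act (.toss 34 32)) (writeCell a 34))
  | .query .sample a _ _ => .seq sampleProg (.seq (writeCell a 40) (writeCell (a + 1) 41))
  | .query .evaluate a x _ => .seq (readCell x 50) (.seq evalProg
      (.seq (writeCell a 40) (writeCell (a + 1) 41)))

variable {Q U : Type*} {enc : Q ↪ ℕ} {P : Q → U → Bool} {G : PMF Q} {π : Params}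
  {D : Fin π.n → U} {kk j : ℕ} {R : State → ℝ≥0∞} {ρ : ℕ → ℝ} {S : ℕ → ℕ → ℝ}
  {T : Q → Option (Fin (π.n + 1))} {M : ℕ → ℝ}

/-- The invariant during a run of the learning algorithm in the stream with index `j`; the
auxiliary component is the one of the simulated access. -/
def StreamInv (enc : Q ↪ ℕ) (π : Params) (ρ : ℕ → ℝ) (S : ℕ → ℕ → ℝ) (j : ℕ)
    (x : ℕ × (Q → Option (Fin (π.n + 1)))) (M : ℕ → ℝ) : Prop :=
  (∃ S', (∀ j', j' ≠ j → S' j' = S j') ∧ Layout enc π.k ρ S' x.2 M) ∧ M 30 = x.1 ∧ x.1 ≤ π.r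

/-- The invariant leaves the contents of stream `j` open, so writing there cannot destroy it; the
other streams occupy different cells. -/
theorem stable_streamInv (hj : j < π.k) : Stable (π.k + 1) j (StreamInv enc π ρ S j) := by
  rintro x M M' ⟨⟨S', hS, hM⟩, h30, hr⟩ h
  refine ⟨⟨Function.update S' j fun i => M' (cell (π.k + 1) j i), fun j' hj' => ?_,
    ⟨fun a ha => ?_, fun j' hj' i => ?_, fun q => ?_⟩⟩, ?_, hr⟩
  · rw [Function.update_of_ne hj', hS j' hj']
  · rw [h a (by omega) fun i => by have := le_cell (π.k + 1) j i; omega, hM.regs a ha]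
  · by_cases hjj : j' = j
    · subst hjj; rw [Function.update_self]
    · have := le_cell (π.k + 1) j' i
      rw [Function.update_of_ne hjj, h _ (by omega) fun i => cell_ne (by omega) (by omega) hjj,
        hM.streams j' hj']
  · have := le_cell (π.k + 1) π.k (enc q)
    rw [h _ (by omega) fun i => cell_ne (by omega) (by omega) (by omega), hM.table]
  · rw [h 30 (by omega) fun i => by have := le_cell (π.k + 1) j i; omega, h30]

theorem simulates_iff (hρ : Registers π j ρ) (hj : j < π.k)
    {σ : AS (ℕ × (Q → Option (Fin (π.n + 1))))} :
    Simulates (π.k + 1) j (StreamInv enc π ρ S j) σ M ↔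
      Layout enc π.k ρ (Function.update S j σ.mem) σ.aux.2 M ∧ M 30 = σ.aux.1 ∧ σ.aux.1 ≤ π.r ∧
        M 31 = σ.clock := by
  constructor
  · rintro ⟨_, _, _, _, hs, hc, ⟨S', hS, hM⟩, h30, hr⟩
    have : S' = Function.update S j σ.mem := by
      funext j'
      by_cases hjj : j' = j
      · subst hjj
        funext i
        rw [Function.update_self, ← hs, hM.streams j' hj]
      · rw [Function.update_of_ne hjj, hS j' hjj]
    exact ⟨this ▸ hM, h30, hr, hc⟩
  · rintro ⟨hM, h30, hr, hc⟩
    refine ⟨?_, ?_, ?_, ?_, fun i => ?_, hc, ⟨_, fun j' hj' => Function.update_of_ne hj' _ _, hM⟩,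
      h30, hr⟩
    · rw [hM.regs 8 (by omega), hρ.zero]
    · rw [hM.regs 9 (by omega), hρ.one]
    · rw [hM.regs 10 (by omega), hρ.width, Nat.cast_add, Nat.cast_one]
    · rw [hM.regs 13 (by omega), hρ.base]
    · rw [hM.streams j hj, Function.update_self]

theorem simulate_evaluate {V X : Type*} {dr : Q → X → PMF (V × X)} {good : V → Prop} {lab : V → ℝ}
    {η : ℝ} (a x y : ℕ) (σ : AS (ℕ × X)) :
    simulate enc G dr good lab η (.query .evaluate a x y) σ =
      (evalAnswer enc G dr good lab η (σ.mem x) σ.aux.1 σ.aux.2).map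
        fun o => σ.answer a o.1.1 o.1.2 o.2 := by
  obtain ⟨M, c, r, T⟩ := σ
  simp only [simulate, evalAnswer]
  cases decode enc (M x) with
  | none => simp [PMF.pure_map]
  | some q =>
    by_cases hG : G q = 0
    · simp [hG, PMF.pure_map]
    · cases r with
      | zero => simp [hG, PMF.pure_map]
      | succ r =>
        simp only [hG, if_false, PMF.map_comp]
        congr 1
        funext o
        simp only [Function.comp]
        split_ifs <;> rfl

/-- Each request takes at most 40n + 100 steps, most of them for counting and for the reservoir. The
potential charges these to the supply of values, which keeps the overhead of an instruction below
90. -/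
theorem implements_effectProg (hk : π.n + 2 ≤ kk) (hr : π.r + 1 ≤ kk) (hρ : Registers π j ρ)
    (hj : j < π.k) {η : ℝ} (hη : ρ 16 = η) :
    Implements (π.k + 1) j kk (StreamInv enc π ρ S j) (fun x => (40 * π.n + 100) * x.1)
      (Effect.perform (releaseAccess enc P G D)) effectProg
      (simulate enc G (lazyDraw (noisyAnswer P π D)) (farFrom π.n π.k π.α j) (thrLabel π.n π.k j)
        η) := by
  have hI : Stable (π.k + 1) j (StreamInv enc π ρ S j) := stable_streamInv hj
  intro e σ M τ u R F hM hR
  have answer : ∀ (a : ℕ) (o : ℝ × ℝ) (r' : ℕ) (T' : Q → Option (Fin (π.n + 1))) (M' : ℕ → ℝ)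
      (τ' u' : ℕ), Layout enc π.k ρ (Function.update S j σ.mem) T' M' → M' 30 = r' →
      r' ≤ σ.aux.1 → M' 31 = σ.clock → M' 40 = o.1 → M' 41 = o.2 →
      τ' + (40 * π.n + 100) * r' ≤ τ + (40 * π.n + 100) * σ.aux.1 + 30 →
      wp (Effect.perform (releaseAccess enc P G D)) kk
        (.seq (writeCell a 40) (writeCell (a + 1) 41)) R ⟨M', τ', u'⟩ ≤
        F (σ.answer a o.1 o.2 (r', T')) := by
    intro a o r' T' M' τ' u' b1 b2 b3 b4 b5 b6 b7
    have hr' := ((simulates_iff hρ hj).1 hM).2.2.1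
    have h1 : Simulates (π.k + 1) j (StreamInv enc π ρ S j) ⟨σ.mem, σ.clock, (r', T')⟩ M' :=
      (simulates_iff hρ hj).2 ⟨b1, b2, b3.trans hr', b4⟩
    have h2 := ((h1.update hI (a := 36) (by omega) (by omega)
      (cell (π.k + 1) j a : ℕ)).write hI (by omega) a (M' 40))
    have h3 := ((h2.update hI (a := 36) (by omega) (by omega)
      (cell (π.k + 1) j (a + 1) : ℕ)).write hI (by omega) (a + 1) (M' 41))
    have hc := le_cell (π.k + 1) j a
    rw [wp_seq, wp_writeCell h1 _ (by omega), wp_writeCell h2 _ (by omega),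
      Function.update_of_ne (by omega), Function.update_of_ne (by omega)]
    rw [b5, b6] at h3 ⊢
    exact hR _ _ _ _ h3 rfl (by dsimp only [AS.answer]; omega)
  obtain ⟨hL, h30, hr', hc⟩ := (simulates_iff hρ hj).1 hM
  match e with
  | .toss a x =>
    have h1 := hM.update hI (a := 32) (by omega) (by omega) (σ.mem x)
    simp only [effectProg, simulate, expect_map]
    rw [wp_seq, wp_readCell hM _ (by omega) (by omega), wp_seq, wp_toss]
    simp only [Function.update_self]
    refine expect_mono fun c => ?_
    have h2 := h1.update hI (a := 34) (by omega) (by omega) (if c = true then 1 else 0)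
    rw [wp_writeCell h2 _ (by omega), Function.update_self]
    exact hR _ _ _ _ ((h2.update hI (by omega) (by omega) _).write hI (by omega) a _) rfl
      (by dsimp only [AS.write]; omega)
  | .query .sample a x y =>
    simp only [effectProg, simulate, expect_map]
    rw [wp_seq]
    refine wp_sampleProg hk (by omega) hρ hL h30
      fun M' τ' u' o r' T' b1 b2 b3 b4 b5 b0 b6 => ?_
    have := answer a (sampleAnswer enc (thrLabel π.n π.k j) o) r' T' M' τ' u' b1 b3 b0
      ((b2 31 (by omega) (by omega)).trans hc) b4 b5 (by dsimp only at b6; omega)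
    cases o <;> exact this
  | .query .evaluate a x y =>
    rw [simulate_evaluate, expect_map]
    simp only [effectProg]
    rw [wp_seq, wp_readCell hM _ (by omega) (by omega), wp_seq]
    refine wp_evalProg hk hρ (hL.update (by omega) (by omega) _) ?_ (by simp [h30]) (by simp)
      fun M' τ' u' o r' T' b1 b2 b3 b4 b5 b0 b6 => ?_
    · dsimp only
      rw [Function.update_of_ne (by omega), hL.regs 16 (by omega), hη]
    · refine answer a o r' T' M' τ' u' b1 b3 b0 ?_ b4 b5 (by dsimp only at b6; omega)
      have h31 := b2 31 (by omega) (by omega)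
      dsimp only at h31
      rwa [Function.update_of_ne (by omega), hc] at h31

end Handler

/-! ### The main loop -/

section RunFrom
variable {X : Type*}

/-- Consecutive runs, starting with the one with index `j`. -/
def runFrom (run : ℕ → X → PMF ((ℕ → ℝ) × X)) :
    ℕ → ℕ → (ℕ → ℕ → ℝ) × X → PMF ((ℕ → ℕ → ℝ) × X)
  | 0, _, o => PMF.pure o
  | d + 1, j, o => (run j o.2).bind fun o' => runFrom run d (j + 1) (Function.update o.1 j o'.1, o'.2)

/-- `runAll` splits off the last run, as suits the transfer of inequalities, whereas a program loop
splits off the first one. -/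
theorem runAll_add (run : ℕ → X → PMF ((ℕ → ℝ) × X)) (x : X) (d : ℕ) :
    ∀ j, runAll run (j + d) x = (runAll run j x).bind (runFrom run d j) := by
  induction d with
  | zero => intro j; simp [runFrom, PMF.bind_pure]
  | succ d ih =>
    intro j
    rw [show j + (d + 1) = (j + 1) + d by omega, ih, runAll]
    simp only [PMF.bind_bind, PMF.bind_map]
    rfl

end RunFrom

/-! ### The loop over the thresholds. -/

section Main
open Prog Arith

variable {Q U : Type*} {enc : Q ↪ ℕ} {P : Q → U → Bool} {G : PMF Q} {π : Params}
  {D : Fin π.n → U} {kk j : ℕ} {R : State → ℝ≥0∞} {ρ : ℕ → ℝ} {S : ℕ → ℕ → ℝ}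
  {T : Q → Option (Fin (π.n + 1))} {M : ℕ → ℝ} {L : Algorithm LearnOracle}

theorem Layout.set {n k : ℕ} {T : Q → Option (Fin (n + 1))} (h : Layout enc k ρ S T M)
    {a : ℕ} (ha : a < 64) (v : ℝ) :
    Layout enc k (Function.update ρ a v) S T (Function.update M a v) := by
  refine ⟨fun b hb => ?_, fun j hj i => ?_, fun q => ?_⟩
  · by_cases hab : b = a
    · subst hab; simp
    · rw [Function.update_of_ne hab, Function.update_of_ne hab, h.regs b hb]
  · have := le_cell (k + 1) j i
    rw [Function.update_of_ne (by omega), h.streams j hj]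
  · have := le_cell (k + 1) k (enc q)
    rw [Function.update_of_ne (by omega), h.table]

theorem Layout.writeStream {n k : ℕ} {T : Q → Option (Fin (n + 1))} (h : Layout enc k ρ S T M)
    (hj : j < k) (a : ℕ) (v : ℝ) :
    Layout enc k ρ (Function.update S j (Function.update (S j) a v)) T
      (Function.update M (cell (k + 1) j a) v) := by
  have hc := le_cell (k + 1) j a
  refine ⟨fun b hb => ?_, fun j' hj' i => ?_, fun q => ?_⟩
  · rw [Function.update_of_ne (by omega), h.regs b hb]
  · by_cases hjj : j' = j
    · subst hjj
      rw [Function.update_self]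
      by_cases hi : i = a
      · subst hi; simp
      · rw [Function.update_of_ne hi, Function.update_of_ne fun he => hi (cell_inj (by omega) he),
          h.streams j' hj']
    · rw [Function.update_of_ne hjj, Function.update_of_ne (cell_ne (by omega) (by omega) hjj),
        h.streams j' hj']
  · rw [Function.update_of_ne (cell_ne (by omega) (by omega) (by omega)), h.table]

/-- The contents of the registers between two rounds of the main loop. -/
structure MainRegisters (π : Params) (j : ℕ) (ρ : ℕ → ℝ) : Prop where
  size : ρ 0 = π.n
  degree : ρ 5 = π.n'
  clock : ρ 7 = π.t
  zero : ρ 8 = 0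
  one : ρ 9 = 1
  width : ρ 10 = π.k + 1
  count : ρ 11 = π.k
  index : ρ 12 = j
  table : ρ 14 = 64 + π.k
  fuel : ρ 17 = π.r
  total : ρ 18 = π.m + π.r
  distance : ρ 19 = π.α / 16 * π.n
  scale : ρ 20 = -π.η
  sample : ρ 21 = π.m
  gamma : ρ 22 = π.γ'
  beta : ρ 23 = π.β'

theorem MainRegisters.next (h : MainRegisters π j ρ) :
    MainRegisters π (j + 1) (Function.update ρ 12 ((j + 1 : ℕ) : ℝ)) := by
  obtain ⟨h0, h5, h7, h8, h9, h10, h11, h12, h14, h17, h18, h19, h20, h21, h22, h23⟩ := h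
  constructor <;> simp [*]

/-- Prepare the run for the threshold whose index is in register `12`. -/
def prepareProg : Prog (Effect ReleaseOracle) :=
  .seq (.const 24 64) (.seq (.arith add 13 12 24) (.seq (.arith add 25 12 9)
    (.seq (.arith div 25 25 10) (.seq (.arith mul 15 25 0) (.seq (writeCell 0 5)
      (.seq (writeCell 1 25) (.seq (writeCell 2 22) (.seq (writeCell 3 23)
        (.arith add 30 18 8)))))))))

/-- Run the learning algorithm for the threshold whose index is in register `12`. -/
def roundProg (L : Algorithm LearnOracle) : Prog (Effect ReleaseOracle) :=
  .seq prepareProg (.seq estimateProg (.seq (.arith div 16 44 21) (.seq (.arith add 31 7 8)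
    (.seq (compile effectProg L.train) (.arith add 12 12 9)))))

theorem wp_writeStream {O : Oracle ReleaseOracle} {τ u : ℕ} {B : ℝ≥0∞}
    (hM : Layout enc π.k ρ S T M) (h10 : ρ 10 = π.k + 1) (h13 : ρ 13 = 64 + j) (hj : j < π.k)
    (a : ℕ) {v : ℕ} (hv : v < 30)
    (hR : ∀ M', Layout enc π.k ρ (Function.update S j (Function.update (S j) a (ρ v))) T M' →
      R ⟨M', τ + 7, u⟩ ≤ B) :
    wp (Effect.perform O) kk (writeCell a v) R ⟨M, τ, u⟩ ≤ B := by
  rw [wp_writeCell_of_eq (W := π.k + 1) (j := j) (by rw [hM.regs 10 (by omega), h10]; simp)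
    (by rw [hM.regs 13 (by omega), h13]) a (by omega), hM.regs v hv]
  exact hR _ ((hM.update (by omega) (by omega) _).writeStream hj a _)

theorem inputMemory_four (a b c d : ℝ) :
    Function.update (Function.update (Function.update (Function.update (fun _ => 0) 0 a) 1 b) 2 c) 3 d =
      inputMemory [a, b, c, d] := by
  funext i
  match i with
  | 0 | 1 | 2 | 3 => simp [inputMemory]
  | i + 4 => simp [inputMemory]

theorem wp_prepareProg {O : Oracle ReleaseOracle} {τ u : ℕ} (hj : j < π.k)
    (hρ : MainRegisters π j ρ) (hS : S j = fun _ => 0) (hM : Layout enc π.k ρ S T M)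
    {B : ℝ≥0∞}
    (hR : ∀ M' ρ', Layout enc π.k ρ' (Function.update S j (inputMemory (π.input j))) T M' →
      MainRegisters π j ρ' → Registers π j ρ' → M' 30 = ((π.r + π.m : ℕ) : ℝ) →
      R ⟨M', τ + 43, u⟩ ≤ B) :
    wp (Effect.perform O) kk prepareProg R ⟨M, τ, u⟩ ≤ B := by
  have hr : ∀ a < 30, M a = ρ a := hM.regs
  simp only [prepareProg, wp_seq, wp_const, wp_arith, Arith.apply]
  set ρ₁ : ℕ → ℝ := Function.update (Function.update (Function.update (Function.update ρ 24 64) 13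
    (64 + j)) 25 (thr π.k j)) 15 (thr π.k j * π.n) with hρ₁
  have e : ∀ M₁ : ℕ → ℝ, M₁ = Function.update (Function.update (Function.update (Function.update
      M 24 64) 13 (64 + j)) 25 (thr π.k j)) 15 (thr π.k j * π.n) →
      Layout enc π.k ρ₁ S T M₁ := by
    rintro _ rfl
    exact (((hM.set (by omega) _).set (by omega) _).set (by omega) _).set (by omega) _
  have hm : MainRegisters π j ρ₁ := by
    obtain ⟨h0, h5, h7, h8, h9, h10, h11, h12, h14, h17, h18, h19, h20, h21, h22, h23⟩ := hρ
    constructor <;> simp [*]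
  have hm' : Registers π j ρ₁ := by
    obtain ⟨h0, h5, h7, h8, h9, h10, h11, h12, h14, h17, h18, h19, h20, h21, h22, h23⟩ := hρ
    constructor <;> simp [*]
  have h10 := hm'.width
  have h13 := hm'.base
  refine wp_writeStream (e _ ?_) h10 h13 hj 0 (by omega) fun M₂ h2 => ?_
  · simp [hr, hρ.size, hρ.index, hρ.one, hρ.width, thr, add_comm]
  rw [wp_seq]
  refine wp_writeStream h2 h10 h13 hj 1 (by omega) fun M₃ h3 => ?_
  rw [wp_seq]
  refine wp_writeStream h3 h10 h13 hj 2 (by omega) fun M₄ h4 => ?_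
  rw [wp_seq]
  refine wp_writeStream h4 h10 h13 hj 3 (by omega) fun M₅ h5 => ?_
  simp only [Function.update_idem, Function.update_self, hS, inputMemory_four] at h5
  have h25 : ρ₁ 25 = thr π.k j := by simp [hρ₁]
  rw [hm.degree, h25, hm.gamma, hm.beta] at h5
  rw [wp_arith]
  refine hR _ ρ₁ (h5.update (by omega) (by omega) _) hm hm' ?_
  simp [Arith.apply, h5.regs, hm.total, hm.zero, add_comm]

/-- Stream `j` is still blank, so writing the four input numbers gives the learner precisely its
initial memory. The description of its hypothesis simply stays in the stream. -/
theorem wp_roundProg {τ u : ℕ} {F : (ℕ → ℝ) × (Q → Option (Fin (π.n + 1))) → ℝ≥0∞} (hj : j < π.k)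
    (hkn : π.n + 2 ≤ kk) (hkm : π.m + 1 ≤ kk) (hkr : π.r + 1 ≤ kk) (hkt : π.t + 1 ≤ kk)
    (hρ : MainRegisters π j ρ) (hS : S j = fun _ => 0) (hM : Layout enc π.k ρ S T M)
    (hR : ∀ M' τ' u' ρ' N T', Layout enc π.k ρ' (Function.update S j N) T' M' →
      MainRegisters π (j + 1) ρ' →
      τ' ≤ τ + (40 * π.n + 100) * (π.m + π.r) + 100 * π.t + 70 → R ⟨M', τ', u'⟩ ≤ F (N, T')) :
    wp (Effect.perform (releaseAccess enc P G D)) kk (roundProg L) R ⟨M, τ, u⟩ ≤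
      expect (releaseStep L enc G π (lazyDraw (noisyAnswer P π D)) j T) F := by
  simp only [roundProg, wp_seq]
  refine wp_prepareProg hj hρ hS hM fun M₁ ρ₁ h1 hm hm' h30 => ?_
  rw [wp_seq, releaseStep, learnOnce]
  simp only [expect_bind, expect_map]
  refine wp_estimateProg hkn hkm hm' h1 h30 fun M₂ τ₂ u₂ c T₂ b1 b2 b3 b4 b5 => ?_
  simp only [wp_seq, wp_arith, Arith.apply]
  set ρ₂ : ℕ → ℝ := Function.update ρ₁ 16 (c / π.m) with hρ₂
  have hm₂ : MainRegisters π j ρ₂ := by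
    obtain ⟨h0, h5, h7, h8, h9, h10, h11, h12, h14, h17, h18, h19, h20, h21, h22, h23⟩ := hm
    constructor <;> simp [*]
  have hm₂' : Registers π j ρ₂ := by
    obtain ⟨h0, h8, h9, h10, h13, h14, h15, h17, h19, h20⟩ := hm'
    constructor <;> simp [*]
  have b6 : Layout enc π.k ρ₂ (Function.update S j (inputMemory (π.input j))) T₂
      (Function.update (Function.update M₂ 16 (c / π.m)) 31 π.t) :=
    (b1.set (by omega) _).update (by omega) (by omega) _
  have e : Function.update (Function.update M₂ 16 (M₂ 44 / M₂ 21)) 31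
      (Function.update M₂ 16 (M₂ 44 / M₂ 21) 7 + Function.update M₂ 16 (M₂ 44 / M₂ 21) 8) =
      Function.update (Function.update M₂ 16 (c / π.m)) 31 π.t := by
    simp [b4, b1.regs, hm.sample, hm.clock, hm.zero]
  rw [e]
  refine wp_compile (stable_streamInv hj) (by omega) (implements_effectProg hkn hkr hm₂' hj
    (η := c / π.m) (by simp [hρ₂])) L.train _ _ _ _ _ _
    ((simulates_iff hm₂' hj).2 ⟨b6, by simp [b3], le_rfl, by simp⟩) hkt
    fun σ' M' τ' u' hM' h1 h2 => ?_
  obtain ⟨c1, c2, c3, c4⟩ := (simulates_iff hm₂' hj).1 hM'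
  have h12 : Arith.apply add (M' 12) (M' 9) = ((j + 1 : ℕ) : ℝ) := by
    rw [c1.regs 12 (by omega), c1.regs 9 (by omega), hm₂.index, hm₂.one]
    simp [Arith.apply]
  rw [wp_arith]
  simp only [h12]
  refine hR _ _ _ (Function.update ρ₂ 12 ((j + 1 : ℕ) : ℝ)) _ _ (c1.set (by omega) _) ?_ ?_
  · exact hm₂.next
  · dsimp only at h2
    rw [mul_add]
    omega

/-- The state after the main loop. -/
theorem wpLoop_roundProg {F : (ℕ → ℕ → ℝ) × (Q → Option (Fin (π.n + 1))) → ℝ≥0∞}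
    (hkn : π.n + 2 ≤ kk) (hkm : π.m + 1 ≤ kk) (hkr : π.r + 1 ≤ kk) (hkt : π.t + 1 ≤ kk) (d : ℕ) :
    ∀ (j i : ℕ) (ρ M : ℕ → ℝ) (S : ℕ → ℕ → ℝ) (T : Q → Option (Fin (π.n + 1))) (τ u : ℕ),
      j + d = π.k → d + 1 ≤ i → MainRegisters π j ρ → (∀ j', j ≤ j' → S j' = fun _ => 0) →
      Layout enc π.k ρ S T M →
      (∀ M' τ' u' ρ' S' T', Layout enc π.k ρ' S' T' M' → MainRegisters π π.k ρ' →
        τ' ≤ τ + ((40 * π.n + 100) * (π.m + π.r) + 100 * π.t + 71) * d + 1 →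
        R ⟨M', τ', u'⟩ ≤ F (S', T')) →
      wpLoop (Effect.perform (releaseAccess enc P G D)) kk 12 11 (roundProg L) R i ⟨M, τ, u⟩ ≤
        expect (runFrom (releaseStep L enc G π (lazyDraw (noisyAnswer P π D))) d j (S, T)) F := by
  induction d with
  | zero =>
    intro j i ρ M S T τ u hj hi hρ hS hM hR
    obtain ⟨i, rfl⟩ : ∃ i', i = i' + 1 := ⟨i - 1, by omega⟩
    obtain rfl : j = π.k := by omega
    rw [wpLoop_succ, if_neg (by simp [hM.regs, hρ.index, hρ.count]), runFrom, expect_pure]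
    exact hR _ _ _ _ _ _ hM hρ (by simp)
  | succ d ih =>
    intro j i ρ M S T τ u hj hi hρ hS hM hR
    obtain ⟨i, rfl⟩ : ∃ i', i = i' + 1 := ⟨i - 1, by omega⟩
    have hjk : j < π.k := by omega
    rw [wpLoop_succ, if_pos (by simpa [hM.regs, hρ.index, hρ.count] using hjk), runFrom,
      expect_bind]
    refine wp_roundProg hjk hkn hkm hkr hkt hρ (hS j le_rfl) hM
      fun M' τ' u' ρ' N T' b1 b2 b3 => ?_
    refine ih (j + 1) i ρ' M' _ T' τ' u' (by omega) (by omega) b2 (fun j' hj' => ?_) b1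
      fun M'' τ'' u'' ρ'' S'' T'' c1 c2 c3 => hR _ _ _ _ _ _ c1 c2 ?_
    · exact (Function.update_of_ne (by omega) _ _).trans (hS j' (by omega))
    · dsimp only at b3
      rw [mul_add _ d 1]
      omega

end Main

/-! ### The parameters -/

section Init
open Prog Arith

variable {E : Type} {h : E → State → PMF State} {kk : ℕ} {R : State → ℝ≥0∞} {B : ℝ≥0∞}
  {M : ℕ → ℝ} {τ u : ℕ}

/-- Compute the number of thresholds, the number of streams, and the address of the table. -/
def countProg : Prog E :=
  .seq (.const 9 1) (.seq (.const 24 (1 / 2)) (.seq (.const 25 8)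
    (.seq (.ite 2 24 (.seq (.arith div 25 25 2) (.arith floor 11 25 25)) (.const 11 0))
      (.seq (.arith add 10 11 9) (.seq (.const 24 64) (.arith add 14 11 24))))))

theorem wp_countProg {α : ℝ} (hα : 0 < α) (h2 : M 2 = α)
    (hR : ∀ (M' : ℕ → ℝ) τ', (∀ a, a ≠ 9 → a ≠ 10 → a ≠ 11 → a ≠ 14 → a ≠ 24 → a ≠ 25 → M' a = M a) →
      M' 9 = 1 → M' 11 = (numThresholds α : ℝ) → M' 10 = (numThresholds α : ℝ) + 1 →
      M' 14 = 64 + (numThresholds α : ℝ) → τ' ≤ τ + 20 → R ⟨M', τ', u⟩ ≤ B) :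
    wp h kk countProg R ⟨M, τ, u⟩ ≤ B := by
  simp only [countProg, wp_seq, wp_const, wp_arith, wp_ite, Arith.apply]
  have hlt : (α < ((1 / 2 : ℚ) : ℝ)) ↔ α < 1 / 2 := by norm_num
  simp only [Function.update_self, ne_eq, not_false_eq_true, Nat.reduceEqDiff,
    Function.update_of_ne, h2, hlt]
  split_ifs with hc
  · have hk : (⌊((8 : ℚ) : ℝ) / α⌋ : ℝ) = numThresholds α := by
      rw [numThresholds, if_pos hc, natCast_floor_eq_intCast_floor (by positivity)]
      norm_num
    simp only [hk]
    refine hR _ _ (fun a h1 h2 h3 h4 h5 h6 => ?_) ?_ ?_ ?_ ?_ ?_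
    · simp [h1, h2, h3, h4, h5, h6]
    · simp
    · simp
    · simp
    · simp [add_comm]
    · omega
  · have hk : numThresholds α = 0 := by rw [numThresholds, if_neg hc]
    refine hR _ _ (fun a h1 h2 h3 h4 h5 h6 => ?_) ?_ ?_ ?_ ?_ ?_
    · simp [h1, h2, h3, h4, h5, h6]
    · simp
    · simp [hk]
    · simp [hk]
    · simp [hk]
    · omega

/-- Compute the accuracy and the confidence for the learning algorithm, and the number of queries
used for estimation. -/
def sampleSizeProg (c₂ c₃ : ℚ) : Prog E :=
  .seq (.arith mul 22 4 2) (.seq (.const 24 c₂) (.seq (.arith mul 22 24 22)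
    (.seq (.arith mul 23 3 2) (.seq (.const 24 c₃) (.seq (.arith mul 23 24 23)
      (.seq (.arith div 24 9 23) (.seq (.arith log 24 24 24) (.seq (.const 25 16)
        (.seq (.arith mul 24 25 24) (.seq (.arith div 24 24 4) (.seq (.arith floor 24 24 24)
          (.arith add 21 24 9))))))))))))

theorem wp_sampleSizeProg {c₂ c₃ : ℚ} {α β γ γ' β' : ℝ} (hγ : 0 < γ) (hβ : 0 < β') (hβ1 : β' ≤ 1)
    (h2 : M 2 = α) (h3 : M 3 = β) (h4 : M 4 = γ) (h9 : M 9 = 1)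
    (hγ' : γ' = c₂ * (γ * α)) (hβ' : β' = c₃ * (β * α))
    (hR : ∀ (M' : ℕ → ℝ) τ', (∀ a, a ≠ 21 → a ≠ 22 → a ≠ 23 → a ≠ 24 → a ≠ 25 → M' a = M a) →
      M' 21 = (sampleSize γ β' : ℝ) → M' 22 = γ' → M' 23 = β' → τ' ≤ τ + 30 → R ⟨M', τ', u⟩ ≤ B) :
    wp h kk (sampleSizeProg c₂ c₃) R ⟨M, τ, u⟩ ≤ B := by
  simp only [sampleSizeProg, wp_seq, wp_const, wp_arith, Arith.apply]
  have hk : (⌊((16 : ℚ) : ℝ) * Real.log (1 / β') / γ⌋ : ℝ) + 1 = sampleSize γ β' := by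
    have hlog : 0 ≤ Real.log (1 / β') := Real.log_nonneg ((one_le_div hβ).2 hβ1)
    rw [sampleSize, Nat.cast_add, natCast_floor_eq_intCast_floor (by positivity)]
    norm_num
  simp only [Function.update_self, ne_eq, not_false_eq_true, Nat.reduceEqDiff,
    Function.update_of_ne, h2, h3, h4, h9, ← hγ', ← hβ', hk]
  refine hR _ _ (fun a h1 h2 h3 h4 h5 => ?_) ?_ ?_ ?_ ?_
  · simp [h1, h2, h3, h4, h5]
  · simp
  · simp
  · simp
  · omega

/-- Compute the numbers of values that may be requested, the required distance of counts from
thresholds, and the scale of the noise. -/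
def scaleProg : Prog E :=
  .seq (.ite 6 7 (.arith add 24 6 8) (.arith add 24 7 8)) (.seq (.arith add 25 24 9)
    (.seq (.arith mul 17 21 25) (.seq (.arith add 18 21 17) (.seq (.const 25 16)
      (.seq (.arith div 25 2 25) (.seq (.arith mul 19 25 0) (.seq (.arith add 24 24 9)
        (.seq (.arith add 24 24 9) (.seq (.arith mul 24 21 24) (.seq (.arith mul 24 11 24)
          (.seq (.const 25 2) (.seq (.arith mul 24 25 24) (.seq (.arith div 24 1 24)
            (.arith sub 20 8 24))))))))))))))

theorem wp_scaleProg {n b t k m : ℕ} {ε α : ℝ} (h0 : M 0 = n) (h1 : M 1 = ε) (h2 : M 2 = α)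
    (h6 : M 6 = b) (h7 : M 7 = t) (h8 : M 8 = 0) (h9 : M 9 = 1) (h11 : M 11 = k) (h21 : M 21 = m)
    (hR : ∀ (M' : ℕ → ℝ) τ', (∀ a, a ≠ 17 → a ≠ 18 → a ≠ 19 → a ≠ 20 → a ≠ 24 → a ≠ 25 → M' a = M a) →
      M' 17 = ((m * (min b t + 1) : ℕ) : ℝ) → M' 18 = m + ((m * (min b t + 1) : ℕ) : ℝ) →
      M' 19 = α / 16 * n → M' 20 = -(ε / (2 * (k * (m * (((min b t : ℕ) : ℝ) + 2))))) → τ' ≤ τ + 40 →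
      R ⟨M', τ', u⟩ ≤ B) :
    wp h kk scaleProg R ⟨M, τ, u⟩ ≤ B := by
  -- Both branches of the conditional leave the minimum of `b` and `t` in register 24 and share the
  -- remaining computation.
  have key : ∀ (s : ℝ) (τ₁ : ℕ), s = ((min b t : ℕ) : ℝ) → τ₁ ≤ τ + 5 →
      wp h kk (.seq (.arith add 25 24 9)
        (.seq (.arith mul 17 21 25) (.seq (.arith add 18 21 17) (.seq (.const 25 16)
          (.seq (.arith div 25 2 25) (.seq (.arith mul 19 25 0) (.seq (.arith add 24 24 9)
            (.seq (.arith add 24 24 9) (.seq (.arith mul 24 21 24) (.seq (.arith mul 24 11 24)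
              (.seq (.const 25 2) (.seq (.arith mul 24 25 24) (.seq (.arith div 24 1 24)
                (.arith sub 20 8 24)))))))))))))) R ⟨Function.update M 24 s, τ₁, u⟩ ≤ B := by
    intro s τ₁ hs hτ
    simp only [wp_seq, wp_const, wp_arith, Arith.apply]
    simp only [Function.update_self, ne_eq, not_false_eq_true, Nat.reduceEqDiff,
      Function.update_of_ne, h0, h1, h2, h8, h9, h11, h21]
    refine hR _ _ (fun a h1 h2 h3 h4 h5 h6 => ?_) ?_ ?_ ?_ ?_ ?_
    · simp [h1, h2, h3, h4, h5, h6]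
    · simp [hs]
    · simp [hs]
    · simp
    · simp [hs, add_assoc, one_add_one_eq_two]
    · omega
  rw [scaleProg, wp_seq]
  simp only [wp_ite, wp_arith, Arith.apply, h6, h7, h8, add_zero, Nat.cast_lt]
  split_ifs with hbt
  · exact key _ _ (by rw [min_eq_left hbt.le]) (by omega)
  · exact key _ _ (by rw [min_eq_right (not_lt.1 hbt)]) (by omega)

/-- The training program of the release algorithm. -/
def releaseProg (c₂ c₃ : ℚ) (L : Algorithm LearnOracle) : Prog (Effect ReleaseOracle) :=
  .seq countProg (.seq (sampleSizeProg c₂ c₃) (.seq scaleProg (.loop 12 11 (roundProg L))))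

end Init

/-! ### The training program as a whole. -/

section Train

variable {Q U : Type*} {enc : Q ↪ ℕ} {P : Q → U → Bool} {G : PMF Q} {L : Algorithm LearnOracle}

/-- The number of steps of the training program. -/
def trainTime (π : Params) : ℕ :=
  ((40 * π.n + 100) * (π.m + π.r) + 100 * π.t + 71) * π.k + 110

/-- The parameters are chosen by the rules of the release algorithm. -/
structure Params.Chosen (π : Params) (b : ℕ) (ε γ : ℝ) : Prop where
  count : π.k = numThresholds π.α
  sample : π.m = sampleSize γ π.β'
  fuel : π.r = π.m * (min b π.t + 1)
  scale : π.η = ε / (2 * (π.k * (π.m * (((min b π.t : ℕ) : ℝ) + 2))))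

/-- Only an upper bound is shown, for arbitrary `F`; this is enough to recover the law of the output
later on. -/
theorem wp_releaseProg {π : Params} {b : ℕ} {c₂ c₃ : ℚ} {ε β γ : ℝ} {D : Fin π.n → U} {kk : ℕ}
    {R : State → ℝ≥0∞}
    {F : (ℕ → ℕ → ℝ) × (Q → Option (Fin (π.n + 1))) → ℝ≥0∞} (hα : 0 < π.α) (hγ : 0 < γ)
    (hβ : 0 < π.β') (hβ1 : π.β' ≤ 1) (hγ' : π.γ' = c₂ * (γ * π.α)) (hβ' : π.β' = c₃ * (β * π.α))
    (hπ : π.Chosen b ε γ)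
    (hkn : π.n + 2 ≤ kk) (hkm : π.m + 1 ≤ kk) (hkr : π.r + 1 ≤ kk) (hkt : π.t + 1 ≤ kk)
    (hkk : π.k + 1 ≤ kk)
    (hR : ∀ (M' : ℕ → ℝ) (τ' u' : ℕ) (ρ' : ℕ → ℝ) S' T', Layout enc π.k ρ' S' T' M' →
      MainRegisters π π.k ρ' → τ' ≤ trainTime π → R ⟨M', τ', u'⟩ ≤ F (S', T')) :
    wp (Effect.perform (releaseAccess enc P G D)) kk (releaseProg c₂ c₃ L) R
      (State.init (inputMemory [π.n, ε, π.α, β, γ, π.n', b, π.t])) ≤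
      expect (release L enc G P π D) F := by
  obtain ⟨hcount, hsample, hfuel, hscale⟩ := hπ
  have h0 : ∀ a, 8 ≤ a → inputMemory [(π.n : ℝ), ε, π.α, β, γ, π.n', b, π.t] a = 0 := by
    intro a ha
    simp [inputMemory, List.getD, ha]
  simp only [releaseProg, wp_seq, State.init]
  refine wp_countProg hα rfl fun M₁ τ₁ a1 a2 a3 a4 a5 a6 => ?_
  rw [wp_seq]
  have i1 : ∀ a, a < 9 → M₁ a = inputMemory [(π.n : ℝ), ε, π.α, β, γ, π.n', b, π.t] a :=
    fun a ha => a1 a (by omega) (by omega) (by omega) (by omega) (by omega) (by omega)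
  refine wp_sampleSizeProg hγ hβ hβ1 (i1 2 (by omega)) (i1 3 (by omega)) (i1 4 (by omega)) a2 hγ' hβ'
    fun M₂ τ₂ b1 b2 b3 b4 b5 => ?_
  have i2 : ∀ a, a < 21 → M₂ a = M₁ a :=
    fun a ha => b1 a (by omega) (by omega) (by omega) (by omega) (by omega)
  have i3 : ∀ a, a < 9 → M₂ a = inputMemory [(π.n : ℝ), ε, π.α, β, γ, π.n', b, π.t] a :=
    fun a ha => (i2 a (by omega)).trans (i1 a ha)
  rw [wp_seq]
  refine wp_scaleProg (n := π.n) (b := b) (t := π.t) (k := π.k) (m := π.m) (ε := ε) (α := π.α)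
    (i3 0 (by omega)) (i3 1 (by omega)) (i3 2 (by omega)) (i3 6 (by omega)) (i3 7 (by omega))
    ((i3 8 (by omega)).trans (h0 8 le_rfl)) ((i2 9 (by omega)).trans a2)
    ((i2 11 (by omega)).trans (by rw [a3, hcount])) (b2.trans (by rw [hsample]))
    fun M₃ τ₃ d1 d2 d3 d4 d5 d6 => ?_
  dsimp only at b1 b5 d1 d6
  have i4 : ∀ a, a < 17 → M₃ a = M₁ a := fun a ha =>
    (d1 a (by omega) (by omega) (by omega) (by omega) (by omega) (by omega)).trans (i2 a (by omega))
  have i5 : ∀ a, a < 9 → M₃ a = inputMemory [(π.n : ℝ), ε, π.α, β, γ, π.n', b, π.t] a :=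
    fun a ha => (i4 a (by omega)).trans (i1 a ha)
  have i6 : ∀ a, 25 < a → M₃ a = 0 := fun a ha => by
    rw [d1 a (by omega) (by omega) (by omega) (by omega) (by omega) (by omega),
      b1 a (by omega) (by omega) (by omega) (by omega) (by omega),
      a1 a (by omega) (by omega) (by omega) (by omega) (by omega) (by omega), h0 a (by omega)]
  have hregs : MainRegisters π 0 M₃ := by
    refine ⟨i5 0 (by omega), i5 5 (by omega), i5 7 (by omega), (i5 8 (by omega)).trans (h0 8 le_rfl),
      (i4 9 (by omega)).trans a2, ?_, ?_, ?_, ?_, ?_, ?_, d4, ?_, ?_, ?_, ?_⟩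
    · rw [i4 10 (by omega), a4, hcount]
    · rw [i4 11 (by omega), a3, hcount]
    · rw [i4 12 (by omega), a1 12 (by omega) (by omega) (by omega) (by omega) (by omega) (by omega),
        h0 12 (by omega), Nat.cast_zero]
    · rw [i4 14 (by omega), a5, hcount]
    · rw [d2, hfuel]
    · rw [d3, hfuel]
    · rw [d5, hscale]
    · rw [d1 21 (by omega) (by omega) (by omega) (by omega) (by omega) (by omega), b2, hsample]
    · rw [d1 22 (by omega) (by omega) (by omega) (by omega) (by omega) (by omega), b3]
    · rw [d1 23 (by omega) (by omega) (by omega) (by omega) (by omega) (by omega), b4]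
  have hlayout : Layout enc π.k M₃ (fun _ _ => 0)
      (fun _ => none : Q → Option (Fin (π.n + 1))) M₃ := by
    refine ⟨fun _ _ => rfl, fun j _ i => ?_, fun q => ?_⟩
    · have := le_cell (π.k + 1) j i
      exact i6 _ (by omega)
    · have := le_cell (π.k + 1) π.k (enc q)
      exact i6 _ (by omega)
  have hrun : release L enc G P π D = runFrom (releaseStep L enc G π
      (lazyDraw (noisyAnswer P π D))) π.k 0 (fun _ _ => 0, fun _ => none) := by
    have := runAll_add (releaseStep L enc G π (lazyDraw (noisyAnswer P π D))) (fun _ => none) π.k 0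
    rw [zero_add] at this
    rw [release, this, runAll, PMF.pure_bind]
  rw [hrun, wp_loop]
  refine wpLoop_roundProg hkn hkm hkr hkt π.k 0 kk M₃ M₃ _ _ _ _ (by omega) hkk hregs
    (fun _ _ => rfl) hlayout fun M' τ' u' ρ' S' T' e1 e2 e3 => hR _ _ _ _ _ _ e1 e2 ?_
  rw [trainTime]
  omega

end Train

/-! ### Evaluation of the synopsis -/

section Evaluate
open Prog Arith

/-- The memory during the evaluation: the streams from `lo` on hold the descriptions of
hypotheses, register `46` the code of the query, and register `47` the number of positive
answers. -/
structure EvalLayout (k t lo j : ℕ) (x c : ℝ) (S : ℕ → ℕ → ℝ) (M : ℕ → ℝ) : Prop where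
  clock : M 7 = t
  zero : M 8 = 0
  one : M 9 = 1
  width : M 10 = k + 1
  count : M 11 = k
  index : M 12 = j
  base : M 13 = 64 + j
  code : M 46 = x
  sum : M 47 = c
  streams : ∀ j', lo ≤ j' → j' < k → ∀ i, M (cell (k + 1) j' i) = S j' i

variable {k t lo j : ℕ} {x c : ℝ} {S : ℕ → ℕ → ℝ} {M : ℕ → ℝ} {h : Empty → State → PMF State}
  {kk : ℕ} {R : State → ℝ≥0∞} {B : ℝ≥0∞} {τ u : ℕ}

theorem EvalLayout.congr (h : EvalLayout k t lo j x c S M) {M' : ℕ → ℝ} {lo' : ℕ} (hlo : lo ≤ lo')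
    (h' : ∀ a, a < 31 ∨ 40 ≤ a → (∀ i, ∀ j' < lo', j' < k → a ≠ cell (k + 1) j' i) → a ≠ 49 →
      M' a = M a) :
    EvalLayout k t lo' j x c S M' := by
  have hr : ∀ a, a < 31 ∨ 40 ≤ a → a < 64 → a ≠ 49 → M' a = M a := fun a ha ha' h49 =>
    h' a ha (fun i j' _ _ => by have := le_cell (k + 1) j' i; omega) h49
  obtain ⟨h1, h2, h3, h4, h5, h6, h7, h8, h9, h11⟩ := h
  refine ⟨?_, ?_, ?_, ?_, ?_, ?_, ?_, ?_, ?_, fun j' hj1 hj2 i => ?_⟩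
  · rw [hr _ (by omega) (by omega) (by omega), h1]
  · rw [hr _ (by omega) (by omega) (by omega), h2]
  · rw [hr _ (by omega) (by omega) (by omega), h3]
  · rw [hr _ (by omega) (by omega) (by omega), h4]
  · rw [hr _ (by omega) (by omega) (by omega), h5]
  · rw [hr _ (by omega) (by omega) (by omega), h6]
  · rw [hr _ (by omega) (by omega) (by omega), h7]
  · rw [hr _ (by omega) (by omega) (by omega), h8]
  · rw [hr _ (by omega) (by omega) (by omega), h9]
  · have := le_cell (k + 1) j' i
    rw [h' _ (by omega) (fun i' j'' h1 h2 => cell_ne (by omega) (by omega) (by omega)) (by omega),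
      h11 j' (by omega) hj2]

theorem stable_evalLayout (hj : j < k) :
    Stable (k + 1) j fun (_ : Unit) M => EvalLayout k t (j + 1) j x c S M := by
  intro _ M M' hM h'
  have hr : ∀ a, a < 31 ∨ 40 ≤ a → a < 64 → M' a = M a := fun a ha ha' =>
    h' a ha fun i => by have := le_cell (k + 1) j i; omega
  obtain ⟨h1, h2, h3, h4, h5, h6, h7, h8, h9, h11⟩ := hM
  refine ⟨?_, ?_, ?_, ?_, ?_, ?_, ?_, ?_, ?_, fun j' hj1 hj2 i => ?_⟩
  · rw [hr _ (by omega) (by omega), h1]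
  · rw [hr _ (by omega) (by omega), h2]
  · rw [hr _ (by omega) (by omega), h3]
  · rw [hr _ (by omega) (by omega), h4]
  · rw [hr _ (by omega) (by omega), h5]
  · rw [hr _ (by omega) (by omega), h6]
  · rw [hr _ (by omega) (by omega), h7]
  · rw [hr _ (by omega) (by omega), h8]
  · rw [hr _ (by omega) (by omega), h9]
  · have := le_cell (k + 1) j' i
    rw [h' _ (by omega) fun i' => cell_ne (by omega) (by omega) (by omega), h11 j' (by omega) hj2]

/-- Evaluate the hypothesis whose index is in register `12`. -/
def evalRound (p : Prog Empty) : Prog Empty :=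
  .seq (writeCell 0 46) (.seq (.arith add 31 7 8) (.seq (compile (fun e => e.elim) p)
    (.seq (readCell 0 49) (.seq (.ite 8 49 (.arith add 47 47 9) (.arith add 47 47 8))
      (.seq (.arith add 12 12 9) (.arith add 13 13 9))))))

/-- The hypothesis is evaluated in place, which spoils stream `j`. Later rounds need only the
streams with larger index, as `EvalLayout` records by its lower bound. -/
theorem wp_evalRound {p : Prog Empty} (hj : j < k) (hkt : t + 1 ≤ kk)
    (hM : EvalLayout k t j j x c S M)
    (hR : ∀ M' τ' u', EvalLayout k t (j + 1) (j + 1) x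
      (c + if 0 < clockedRun p t (Function.update (S j) 0 x) 0 then 1 else 0) S M' →
      τ' ≤ τ + 100 * t + 40 → R ⟨M', τ', u'⟩ ≤ B) :
    wp h kk (evalRound p) R ⟨M, τ, u⟩ ≤ B := by
  classical
  have hc := le_cell (k + 1) j 0
  rw [evalRound, wp_seq, wp_writeCell_of_eq (W := k + 1) (j := j) (by rw [hM.width]; simp) hM.base 0
    (by omega), wp_seq, wp_arith, wp_seq]
  set M₁ : ℕ → ℝ := Function.update (Function.update (Function.update M 36
    (cell (k + 1) j 0 : ℕ)) (cell (k + 1) j 0) (M 46)) 31 t with hM₁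
  have e : ∀ v : ℝ, v = t → Function.update (Function.update (Function.update M 36
    (cell (k + 1) j 0 : ℕ)) (cell (k + 1) j 0) (M 46)) 31 v = M₁ := fun v hv => by rw [hv]
  have hu : ∀ a, a ≠ 31 → a ≠ 36 → a ≠ cell (k + 1) j 0 → M₁ a = M a := fun a h1 h2 h3 => by
    rw [hM₁, Function.update_of_ne h1, Function.update_of_ne h3, Function.update_of_ne h2]
  dsimp only
  rw [e _ (by
    rw [Function.update_of_ne (by omega), Function.update_of_ne (by omega),
      Function.update_of_ne (by omega), Function.update_of_ne (by omega)]
    simp [Arith.apply, hM.clock, hM.zero])]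
  have h1 : EvalLayout k t (j + 1) j x c S M₁ := hM.congr (by omega) fun a h1 h2 _ =>
    hu a (by omega) (by omega) (h2 0 j (by omega) hj)
  have hs : Simulates (k + 1) j (fun (_ : Unit) M => EvalLayout k t (j + 1) j x c S M)
      (⟨Function.update (S j) 0 x, t, ()⟩ : AS Unit) M₁ := by
    refine ⟨h1.zero, h1.one, by rw [h1.width]; simp, h1.base, fun i => ?_, by simp [hM₁], h1⟩
    by_cases hi : i = 0
    · subst hi
      simp only [hM₁]
      rw [Function.update_of_ne (by omega), Function.update_self, Function.update_self, hM.code]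
    · have := le_cell (k + 1) j i
      dsimp only
      rw [hu _ (by omega) (by omega) fun he => hi (cell_inj (by omega) he),
        Function.update_of_ne hi, hM.streams j le_rfl hj]
  -- The test function is infinite off the memory reached by the clocked run, so the final contents
  -- of the stream are known exactly.
  have hB := expect_aexec_empty p t (Function.update (S j) 0 x)
    fun M' => if M' = clockedRun p t (Function.update (S j) 0 x) then B else ⊤
  rw [if_pos rfl] at hB
  rw [← hB]
  refine wp_compile (pot := fun _ => 0) (stable_evalLayout hj) (by omega) (fun e => e.elim) p _ _ _
    _ _ _ hs hkt fun σ' M' τ' u' hM' h2 h3 => ?_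
  split_ifs with hm
  swap
  · exact le_top
  have h4 : EvalLayout k t (j + 1) j x c S M' := hM'.inv
  rw [wp_seq, wp_readCell hM' 0 (by omega) (by omega), wp_seq]
  simp only [wp_ite, wp_seq, wp_arith, Arith.apply, hm]
  simp only [Function.update_self, ne_eq, not_false_eq_true, Nat.reduceEqDiff,
    Function.update_of_ne, h4.zero, h4.one, h4.sum, h4.index, h4.base]
  have fin : ∀ (b : ℝ) (τ₁ : ℕ), b = c +
      (if 0 < clockedRun p t (Function.update (S j) 0 x) 0 then 1 else 0) → τ₁ ≤ τ + 100 * t + 40 →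
      R ⟨Function.update (Function.update (Function.update (Function.update M' 49
        (clockedRun p t (Function.update (S j) 0 x) 0)) 47 b) 12 (j + 1)) 13 (64 + j + 1), τ₁, u'⟩ ≤
        B := by
    intro b τ₁ hb hτ
    refine hR _ _ _ ?_ hτ
    obtain ⟨g1, g2, g3, g4, g5, g6, g7, g8, g9, g11⟩ := h4
    refine ⟨?_, ?_, ?_, ?_, ?_, ?_, ?_, ?_, ?_, fun j' hj1 hj2 i => ?_⟩
    · simp [g1]
    · simp [g2]
    · simp [g3]
    · simp [g4]
    · simp [g5]
    · simp
    · simp [add_assoc]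
    · simp [g8]
    · simp [hb]
    · have := le_cell (k + 1) j' i
      rw [Function.update_of_ne (by omega), Function.update_of_ne (by omega),
        Function.update_of_ne (by omega), Function.update_of_ne (by omega), g11 j' hj1 hj2]
  dsimp only at h3
  split_ifs with hpos
  · exact fin _ _ (by rw [if_pos hpos]) (by omega)
  · exact fin _ _ (by rw [if_neg hpos]) (by omega)

/-- The number of positive answers. -/
def positives (p : Prog Empty) (t : ℕ) (x : ℝ) (S : ℕ → ℕ → ℝ) (j : ℕ) : ℝ :=
  open Classical in
  ∑ j' ∈ Finset.range j, if 0 < clockedRun p t (Function.update (S j') 0 x) 0 then 1 else 0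

theorem wpLoop_evalRound {p : Prog Empty} (hkt : t + 1 ≤ kk) (d : ℕ) :
    ∀ (j i : ℕ) (M : ℕ → ℝ) (τ u : ℕ), j + d = k → d + 1 ≤ i →
      EvalLayout k t j j x (positives p t x S j) S M →
      (∀ M' τ' u', EvalLayout k t k k x (positives p t x S k) S M' →
        τ' ≤ τ + (100 * t + 41) * d + 1 → R ⟨M', τ', u'⟩ ≤ B) →
      wpLoop h kk 12 11 (evalRound p) R i ⟨M, τ, u⟩ ≤ B := by
  classical
  induction d with
  | zero =>
    intro j i M τ u hj hi hM hR
    obtain ⟨i, rfl⟩ : ∃ i', i = i' + 1 := ⟨i - 1, by omega⟩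
    obtain rfl : j = k := by omega
    rw [wpLoop_succ, if_neg (by simp [hM.index, hM.count])]
    exact hR _ _ _ hM (by simp)
  | succ d ih =>
    intro j i M τ u hj hi hM hR
    obtain ⟨i, rfl⟩ : ∃ i', i = i' + 1 := ⟨i - 1, by omega⟩
    have hjk : j < k := by omega
    rw [wpLoop_succ, if_pos (by simpa [hM.index, hM.count] using hjk)]
    refine wp_evalRound hjk hkt hM fun M' τ' u' b1 b2 => ?_
    refine ih (j + 1) i M' τ' u' (by omega) (by omega) ?_ fun M'' τ'' u'' c1 c2 =>
      hR _ _ _ c1 ?_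
    · rw [positives, Finset.sum_range_succ]
      exact b1
    · dsimp only at b2
      rw [mul_add _ d 1]
      omega

/-- The evaluation program of the release algorithm. -/
def synopsisProg (p : Prog Empty) : Prog Empty :=
  .seq (.arith add 46 0 8) (.seq (.const 12 0) (.seq (.const 13 64) (.seq (.const 47 0)
    (.seq (.loop 12 11 (evalRound p)) (.seq (.const 49 (1 / 2))
      (.seq (.arith add 47 47 49) (.arith div 0 47 10)))))))

/-- The number of steps of the evaluation program. -/
def evalTime (k t : ℕ) : ℕ := (100 * t + 41) * k + 20

theorem wp_synopsisProg {p : Prog Empty} (hkt : t + 1 ≤ kk) (hkk : k + 1 ≤ kk)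
    (h0 : M 0 = x) (h7 : M 7 = t) (h8 : M 8 = 0) (h9 : M 9 = 1) (h10 : M 10 = k + 1)
    (h11 : M 11 = k) (hs : ∀ j < k, ∀ i, M (cell (k + 1) j i) = S j i)
    (hR : ∀ M' τ' u', M' 0 = (positives p t x S k + 1 / 2) / (k + 1) → τ' ≤ τ + evalTime k t →
      R ⟨M', τ', u'⟩ ≤ B) :
    wp h kk (synopsisProg p) R ⟨M, τ, u⟩ ≤ B := by
  simp only [synopsisProg, wp_seq, wp_const, wp_arith, wp_loop, Arith.apply]
  refine wpLoop_evalRound (k := k) (S := S) (x := x) (t := t) hkt k 0 kk _ _ _ (by omega) hkk ?_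
    fun M' τ' u' b1 b2 => ?_
  · refine ⟨?_, ?_, ?_, ?_, ?_, ?_, ?_, ?_, ?_, fun j' hj1 hj2 i => ?_⟩
    · simp [h7]
    · simp [h8]
    · simp [h9]
    · simp [h10]
    · simp [h11]
    · simp
    · simp
    · simp [h0, h8]
    · simp [positives]
    · have := le_cell (k + 1) j' i
      rw [Function.update_of_ne (by omega), Function.update_of_ne (by omega),
        Function.update_of_ne (by omega), Function.update_of_ne (by omega), hs j' hj2]
  · simp only [wp_seq, wp_const, wp_arith, Arith.apply]
    refine hR _ _ _ ?_ (by rw [evalTime]; omega)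
    simp [b1.sum, b1.width]

end Evaluate

/-! ### The law of the synopsis -/

section Law
variable {Q U : Type*} {enc : Q ↪ ℕ} {P : Q → U → Bool} {G : PMF Q} {L : Algorithm LearnOracle}
  {π : Params} {D : Fin π.n → U}

/-- The release algorithm. -/
def releaseAlgorithm (c₂ c₃ : ℚ) (L : Algorithm LearnOracle) : Algorithm ReleaseOracle where
  train := releaseProg c₂ c₃ L
  evaluate := synopsisProg L.evaluate

/-- A time limit for the release algorithm. -/
def totalTime (π : Params) : ℕ := trainTime π + evalTime π.k π.t + π.n + π.m + π.r + π.t + π.k + 2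

/-- A deterministic run in which failure has weakest precondition zero must halt in time with the
right value. The code of the query overwrites register 0, which held the size of the data set and is
not needed any more. -/
theorem exists_runDet_synopsisProg {T : ℕ} (hT : totalTime π ≤ T) {ρ : ℕ → ℝ} {S : ℕ → ℕ → ℝ}
    {V : Q → Option (Fin (π.n + 1))} {M : ℕ → ℝ} (hM : Layout enc π.k ρ S V M)
    (hρ : MainRegisters π π.k ρ) (q : Q) :
    ∃ s' : State, runDet T (synopsisProg L.evaluate) (Function.update M 0 (enc q : ℝ)) = some s' ∧
      s'.time ≤ T ∧ s'.mem 0 = releaseValue L enc π S q := by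
  rw [totalTime] at hT
  have hu : ∀ a, a ≠ 0 → Function.update M 0 (enc q : ℝ) a = M a :=
    fun a ha => Function.update_of_ne ha _ _
  have hval : releaseValue L enc π S q =
      (positives L.evaluate π.t (enc q) S π.k + 1 / 2) / (π.k + 1) := by
    simp [releaseValue, score, clockedHypothesis, positives]
  have key : wp (fun (e : Empty) _ => e.elim) T (synopsisProg L.evaluate)
      (fun s => failing (s.time ≤ T ∧ s.mem 0 = releaseValue L enc π S q))
      ⟨Function.update M 0 (enc q : ℝ), 0, 0⟩ ≤ 0 := by
    refine wp_synopsisProg (k := π.k) (t := π.t) (x := (enc q : ℝ)) (S := S) (by omega) (by omega)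
      (Function.update_self ..) ?_ ?_ ?_ ?_ ?_ (fun j hj i => ?_) fun M' τ' u' h1 h2 => ?_
    · rw [hu _ (by omega), hM.regs 7 (by omega), hρ.clock]
    · rw [hu _ (by omega), hM.regs 8 (by omega), hρ.zero]
    · rw [hu _ (by omega), hM.regs 9 (by omega), hρ.one]
    · rw [hu _ (by omega), hM.regs 10 (by omega), hρ.width]
    · rw [hu _ (by omega), hM.regs 11 (by omega), hρ.count]
    · have := le_cell (π.k + 1) j i
      rw [hu _ (by omega), hM.streams j hj]
    · exact (failing_of ⟨by dsimp only; omega, by rw [hval]; exact h1⟩).le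
  rw [wp, exec_eq_pure, expect_pure] at key
  rw [runDet, State.init]
  cases hs : Id.run (exec (m := Id) (fun (e : Empty) _ => e.elim) T (synopsisProg L.evaluate)
    ⟨Function.update M 0 (enc q : ℝ), 0, 0⟩) with
  | none => rw [hs] at key; simp at key
  | some s' =>
    rw [hs] at key
    refine ⟨s', rfl, ?_⟩
    by_contra hne
    simp [failing_of_not hne] at key

theorem value_synopsisProg {c₂ c₃ : ℚ} {T : ℕ} (hT : totalTime π ≤ T) {ρ : ℕ → ℝ} {S : ℕ → ℕ → ℝ}
    {V : Q → Option (Fin (π.n + 1))} {M : ℕ → ℝ} (hM : Layout enc π.k ρ S V M)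
    (hρ : MainRegisters π π.k ρ) (q : Q) :
    (releaseAlgorithm c₂ c₃ L).value T M (enc q) = releaseValue L enc π S q := by
  obtain ⟨s', h1, -, h2⟩ := exists_runDet_synopsisProg (L := L) hT hM hρ q
  simp only [Algorithm.value, releaseAlgorithm, h1, h2]

/-- The synopsis described by the given streams. -/
def streamSynopsis (L : Algorithm LearnOracle) (enc : Q ↪ ℕ) (π : Params) (S : ℕ → ℕ → ℝ) :
    Q → unitInterval :=
  fun q => Set.projIcc 0 1 zero_le_one (releaseValue L enc π S q)

theorem expect_indicator_add_compl {α β : Type*} (μ : PMF α) (f : α → β) (E : Set β) :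
    expect μ (fun x => E.indicator 1 (f x)) + expect μ (fun x => Eᶜ.indicator 1 (f x)) = 1 := by
  rw [← expect_add, ← expect_const μ 1]
  congr 1
  funext x
  by_cases hx : f x ∈ E <;> simp [hx]

variable {b : ℕ} {c₂ c₃ : ℚ} {ε β γ : ℝ} {T : ℕ}

/-- The requirements on the parameters and the inputs of the release algorithm. -/
structure Params.Admissible (π : Params) (c₂ c₃ : ℚ) (b : ℕ) (ε β γ : ℝ) : Prop where
  alpha_pos : 0 < π.α
  gamma_pos : 0 < γ
  beta_pos : 0 < π.β'
  beta_le : π.β' ≤ 1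
  gamma_eq : π.γ' = c₂ * (γ * π.α)
  beta_eq : π.β' = c₃ * (β * π.α)
  chosen : π.Chosen b ε γ

theorem wp_releaseAlgorithm (hπ : π.Admissible c₂ c₃ b ε β γ) (hT : totalTime π ≤ T)
    {R : State → ℝ≥0∞} {F : (ℕ → ℕ → ℝ) × (Q → Option (Fin (π.n + 1))) → ℝ≥0∞}
    (hR : ∀ (M' : ℕ → ℝ) (τ' u' : ℕ) (ρ' : ℕ → ℝ) S' T', Layout enc π.k ρ' S' T' M' →
      MainRegisters π π.k ρ' → τ' ≤ T → R ⟨M', τ', u'⟩ ≤ F (S', T')) :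
    expect (run (releaseAccess enc P G D) T (releaseAlgorithm c₂ c₃ L).train
      (inputMemory [π.n, ε, π.α, β, γ, π.n', b, π.t])) (fun o => o.elim ⊤ R) ≤
      expect (release L enc G P π D) F := by
  -- The limit also bounds the number of tests of each loop; the summands n, m, r, t and k in
  -- `totalTime` make it large enough for all of them.
  rw [totalTime] at hT
  exact wp_releaseProg hπ.alpha_pos hπ.gamma_pos hπ.beta_pos hπ.beta_le hπ.gamma_eq hπ.beta_eq
    hπ.chosen (by omega) (by omega) (by omega) (by omega) (by omega)
    fun M' τ' u' ρ' S' T' h1 h2 h3 => hR M' τ' u' ρ' S' T' h1 h2 (by omega)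

/-- The indicator of a bad outcome has expectation zero, so no outcome of positive probability is
bad. -/
theorem runsWithin_releaseAlgorithm (hπ : π.Admissible c₂ c₃ b ε β γ) (hT : totalTime π ≤ T) :
    (releaseAlgorithm c₂ c₃ L).RunsWithin enc (releaseAccess enc P G D)
      [π.n, ε, π.α, β, γ, π.n', b, π.t] T ⊤ := by
  have key := wp_releaseAlgorithm (L := L) (enc := enc) (P := P) (G := G) (D := D) hπ hT
    (R := fun s => failing (s.time ≤ T ∧ ∀ q : Q, ∃ s' : State,
      runDet T (synopsisProg L.evaluate) (Function.update s.mem 0 (enc q : ℝ)) = some s' ∧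
        s'.time ≤ T)) (F := fun _ => 0)
    fun M' τ' u' ρ' S' T' h1 h2 h3 => (failing_of ⟨h3, fun q => by
      obtain ⟨s', e1, e2, -⟩ := exists_runDet_synopsisProg (L := L) hT h1 h2 q
      exact ⟨s', e1, e2⟩⟩).le
  rw [expect_const, nonpos_iff_eq_zero, expect, ENNReal.tsum_eq_zero] at key
  intro r hr
  have h := (mul_eq_zero.1 (key r)).resolve_left ((PMF.mem_support_iff _ _).1 hr)
  cases r with
  | none => simp at h
  | some s =>
    have hs : s.time ≤ T ∧ ∀ q : Q, ∃ s' : State,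
      runDet T (synopsisProg L.evaluate) (Function.update s.mem 0 (enc q : ℝ)) = some s' ∧
        s'.time ≤ T := by
      by_contra hne
      simp [failing_of_not hne] at h
    exact ⟨s, rfl, hs.1, le_top, hs.2⟩

theorem synopsis_le (hπ : π.Admissible c₂ c₃ b ε β γ) (hT : totalTime π ≤ T)
    (E : Set (Q → unitInterval)) :
    ((releaseAlgorithm c₂ c₃ L).synopsis enc (releaseAccess enc P G D)
      [π.n, ε, π.α, β, γ, π.n', b, π.t] T).toOuterMeasure E ≤
      expect (release L enc G P π D) fun o => E.indicator 1 (streamSynopsis L enc π o.1) := by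
  rw [← expect_indicator, Algorithm.synopsis, expect_map]
  refine le_trans (expect_mono fun o => ?_) (wp_releaseAlgorithm hπ hT
    (R := fun s => E.indicator 1 fun q => Set.projIcc 0 1 zero_le_one
      ((releaseAlgorithm c₂ c₃ L).value T s.mem (enc q)))
    fun M' τ' u' ρ' S' T' h1 h2 h3 => ?_)
  · cases o with
    | none => exact le_top
    | some s => exact le_rfl
  · have : (fun q => Set.projIcc 0 1 zero_le_one
        ((releaseAlgorithm c₂ c₃ L).value T M' (enc q))) = streamSynopsis L enc π S' :=
      funext fun q => by rw [streamSynopsis, value_synopsisProg hT h1 h2]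
    dsimp only
    rw [this]

/-- The law of the synopsis. -/
theorem synopsis_eq (hπ : π.Admissible c₂ c₃ b ε β γ) (hT : totalTime π ≤ T)
    (E : Set (Q → unitInterval)) :
    ((releaseAlgorithm c₂ c₃ L).synopsis enc (releaseAccess enc P G D)
      [π.n, ε, π.α, β, γ, π.n', b, π.t] T).toOuterMeasure E =
      expect (release L enc G P π D) fun o => E.indicator 1 (streamSynopsis L enc π o.1) := by
  refine le_antisymm (synopsis_le hπ hT E) ?_
  -- Both laws have total mass one, so the inequality for the complement turns into the reverse
  -- inequality for `E`.
  have h1 := expect_indicator_add_compl (release L enc G P π D)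
    (fun o => streamSynopsis L enc π o.1) E
  have h2 := expect_indicator_add_compl ((releaseAlgorithm c₂ c₃ L).synopsis enc
    (releaseAccess enc P G D) [π.n, ε, π.α, β, γ, π.n', b, π.t] T) (fun S => S) E
  rw [expect_indicator, expect_indicator] at h2
  have h3 := synopsis_le (L := L) (enc := enc) (P := P) (G := G) (D := D) hπ hT Eᶜ
  have hfin : expect (release L enc G P π D)
      (fun o => Eᶜ.indicator 1 (streamSynopsis L enc π o.1)) ≠ ⊤ :=
    ne_top_of_le_ne_top ENNReal.one_ne_top (h1 ▸ le_add_self)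
  refine (ENNReal.add_le_add_iff_right hfin).1 ?_
  rw [h1, ← h2]
  exact add_le_add le_rfl h3

/-- The synopsis is a function of the released descriptions, so their privacy carries over. -/
theorem differentiallyPrivate_releaseAlgorithm (hπ : π.Admissible c₂ c₃ b ε β γ)
    (hT : totalTime π ≤ T) (hη : 0 ≤ π.η) (hε : 2 * π.η * (π.k * (π.r + π.m)) ≤ ε) :
    DifferentiallyPrivate ε fun D : Fin π.n → U => (releaseAlgorithm c₂ c₃ L).synopsis enc
      (releaseAccess enc P G D) [π.n, ε, π.α, β, γ, π.n', b, π.t] T := by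
  intro D D' hD E
  dsimp only
  rw [synopsis_eq hπ hT, synopsis_eq hπ hT]
  refine (release_private hη hD (fun S => E.indicator 1 (streamSynopsis L enc π S))
    fun S => ?_).trans ?_
  · exact Set.indicator_le_self' (fun _ _ => zero_le) _
  · gcongr

end Law

/-! ### Choice of the constants -/

section Numerics

/-- With `N` the total number of requests and X = b/(αγβ), the size of the data makes the tail at
most X^(-20), while `N` is bounded by lX up to a constant and l by 4X. -/
theorem noise_total_le {α β γ ε n l b N : ℝ} (hα : 0 < α) (hα2 : α < 1 / 2) (hβ : 0 < β)
    (hβ1 : β ≤ 1) (hγ : 0 < γ) (hγ1 : γ ≤ 1) (hε : 0 < ε) (hb : 1 ≤ b) (hl0 : 0 < l)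
    (hl : l ≤ 5 + b / (α * γ * β)) (hN0 : 0 < N) (hN : N ≤ 408 * b * l / (α * γ))
    (hn : 1044480 * b * Real.log (b / (α * γ * β)) * l / (ε * α ^ 2 * γ) ≤ n) :
    N * (2 * Real.exp (-(ε / (2 * N) * (α / 64 * n)))) ≤ β / 4 := by
  set X : ℝ := b / (α * γ * β) with hX
  have hX2 : 2 ≤ X := by
    rw [hX, le_div_iff₀ (by positivity)]
    have : α * γ * β ≤ 1 / 2 * 1 * 1 := by gcongr
    linarith
  have hlog : 0 ≤ Real.log X := Real.log_nonneg (by linarith)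
  -- The constant is 1044480 = 20 · 128 · 408: the chosen power of X, the product of 2 and 64 from
  -- the exponent, and the constant in the bound for `N`.
  have h1 : 20 * Real.log X ≤ ε / (2 * N) * (α / 64 * n) := by
    have e1 : ε / (2 * N) * (α / 64 * n) = ε * α * n / (128 * N) := by field_simp; ring
    rw [e1, le_div_iff₀ (by positivity)]
    have e2 : 20 * Real.log X * (128 * N) ≤ 20 * Real.log X * (128 * (408 * b * l / (α * γ))) := by
      gcongr
    have e3 : ε * α * (1044480 * b * Real.log X * l / (ε * α ^ 2 * γ)) ≤ ε * α * n := by gcongr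
    refine e2.trans (le_trans (le_of_eq ?_) e3)
    field_simp
    ring
  have h2 : Real.exp (-(ε / (2 * N) * (α / 64 * n))) ≤ (X ^ 20)⁻¹ := by
    have : Real.exp (-(20 * Real.log X)) = (X ^ 20)⁻¹ := by
      rw [Real.exp_neg, mul_comm, Real.exp_mul, Real.exp_log (by linarith)]
      norm_cast
    rw [← this]
    exact Real.exp_le_exp.2 (neg_le_neg h1)
  have h3 : 3264 * l * X ≤ X ^ 20 := by
    have e1 : l ≤ 4 * X := by linarith
    have e2 : (2 : ℝ) ^ 18 ≤ X ^ 18 := pow_le_pow_left₀ (by norm_num) hX2 18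
    calc 3264 * l * X ≤ 3264 * (4 * X) * X := by gcongr
      _ = 13056 * X ^ 2 := by ring
      _ ≤ 2 ^ 18 * X ^ 2 := by gcongr; norm_num
      _ ≤ X ^ 18 * X ^ 2 := by gcongr
      _ = X ^ 20 := by ring
  have hXp : 0 < X ^ 20 := by positivity
  calc N * (2 * Real.exp (-(ε / (2 * N) * (α / 64 * n))))
      ≤ 408 * b * l / (α * γ) * (2 * (X ^ 20)⁻¹) := by gcongr
    _ = (3264 * l * X) * (β / 4) / X ^ 20 := by rw [hX]; field_simp; ring
    _ ≤ X ^ 20 * (β / 4) / X ^ 20 := by gcongr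
    _ = β / 4 := by field_simp

theorem log_confidence_le {α β : ℝ} (hα : 0 < α) (hβ : 0 < β) :
    Real.log (1 / (1 / 64 * (β * α))) ≤ 5 + Real.log (1 / (α * β)) := by
  have e : 1 / (1 / 64 * (β * α)) = 64 * (1 / (α * β)) := by field_simp
  rw [e, Real.log_mul (by norm_num) (by positivity)]
  have : Real.log 64 ≤ 5 := by
    rw [show (64 : ℝ) = 2 ^ 6 by norm_num, Real.log_pow]
    have := Real.log_two_lt_d9
    norm_num
    linarith
  linarith

theorem one_le_log_confidence {α β : ℝ} (hα : 0 < α) (hα1 : α ≤ 1) (hβ : 0 < β) (hβ1 : β ≤ 1) :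
    1 ≤ Real.log (1 / (1 / 64 * (β * α))) := by
  rw [Real.le_log_iff_exp_le (by positivity)]
  have h1 : β * α ≤ 1 := mul_le_one₀ hβ1 hα.le hα1
  have h2 : (64 : ℝ) ≤ 1 / (1 / 64 * (β * α)) := by
    rw [le_div_iff₀ (by positivity)]; linarith
  have := Real.exp_one_lt_d9
  linarith

theorem numThresholds_le {α : ℝ} (hα : 0 < α) : (numThresholds α : ℝ) ≤ 8 / α := by
  rw [numThresholds]
  split_ifs
  · exact Nat.floor_le (by positivity)
  · simp; positivity

theorem sampleSize_le {γ β' : ℝ} (hγ : 0 < γ) (hl : 0 ≤ Real.log (1 / β')) :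
    (sampleSize γ β' : ℝ) ≤ 16 * Real.log (1 / β') / γ + 1 := by
  rw [sampleSize, Nat.cast_add, Nat.cast_one]
  gcongr
  exact Nat.floor_le (by positivity)

theorem le_sampleSize (γ β' : ℝ) : 16 * Real.log (1 / β') / γ ≤ sampleSize γ β' := by
  rw [sampleSize, Nat.cast_add, Nat.cast_one]
  exact (Nat.lt_floor_add_one _).le

/-- In terms of X, k is at most 8X, m at most 65X² and r at most 130X³, so the leading term n(m +
r)k has degree 5. The minimum with `t` in `r` keeps `b` out of the bound. -/
theorem totalTime_le {n n' b t : ℕ} {ε α β γ γ' : ℝ} {K : ℕ} (hK : 150000 ≤ K) (hα : 0 < α)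
    (hα1 : α ≤ 1) (hβ : 0 < β) (hβ1 : β ≤ 1) (hγ : 0 < γ) (hγ1 : γ ≤ 1) :
    (totalTime (chooseParams n n' b t ε α γ γ' (1 / 64 * (β * α))) : ℝ) ≤
      K * (t + n + 1 / α + Real.log (1 / β) + 1 / γ) ^ K := by
  set X : ℝ := t + n + 1 / α + Real.log (1 / β) + 1 / γ with hX
  have a1 : 1 ≤ 1 / α := (one_le_div hα).2 hα1
  have a2 : 1 ≤ 1 / γ := (one_le_div hγ).2 hγ1
  have a3 : 0 ≤ Real.log (1 / β) := Real.log_nonneg ((one_le_div hβ).2 hβ1)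
  have a4 : (0 : ℝ) ≤ t := Nat.cast_nonneg t
  have a5 : (0 : ℝ) ≤ n := Nat.cast_nonneg n
  have hX2 : 2 ≤ X := by linarith
  have hk : (numThresholds α : ℝ) ≤ 8 * X := (numThresholds_le hα).trans (by
    rw [show 8 / α = 8 * (1 / α) by ring]; linarith)
  have hl1 := one_le_log_confidence hα hα1 hβ hβ1
  have hl : Real.log (1 / (1 / 64 * (β * α))) ≤ 4 * X := by
    have e1 := log_confidence_le hα hβ
    have e2 : Real.log (1 / (α * β)) = Real.log (1 / α) + Real.log (1 / β) := by
      rw [← Real.log_mul (by positivity) (by positivity)]; congr 1; field_simp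
    have e3 := Real.log_le_sub_one_of_pos (show 0 < 1 / α by positivity)
    linarith
  have hm : (sampleSize γ (1 / 64 * (β * α)) : ℝ) ≤ 65 * X ^ 2 := by
    refine (sampleSize_le hγ (by linarith)).trans ?_
    have e1 : 16 * Real.log (1 / (1 / 64 * (β * α))) / γ ≤ 16 * (4 * X) * X := by
      rw [div_eq_mul_one_div]
      gcongr
      linarith
    nlinarith
  have hB : ((min b t : ℕ) : ℝ) + 1 ≤ 2 * X := by
    have : ((min b t : ℕ) : ℝ) ≤ t := by exact_mod_cast min_le_right b t
    linarith
  have hr : (sampleSize γ (1 / 64 * (β * α)) : ℝ) * (((min b t : ℕ) : ℝ) + 1) ≤ 130 * X ^ 3 := by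
    calc _ ≤ 65 * X ^ 2 * (2 * X) := by gcongr
      _ = 130 * X ^ 3 := by ring
  set k : ℝ := ((numThresholds α : ℕ) : ℝ) with hk'
  set m : ℝ := ((sampleSize γ (1 / 64 * (β * α)) : ℕ) : ℝ) with hm'
  have hk0 : 0 ≤ k := Nat.cast_nonneg _
  have hm0 : 0 ≤ m := Nat.cast_nonneg _
  have hX1 : 1 ≤ X := by linarith
  have p1 : X ≤ X ^ 5 := le_self_pow₀ hX1 (by norm_num)
  have p2 : X ^ 2 ≤ X ^ 5 := pow_le_pow_right₀ hX1 (by norm_num)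
  have p3 : X ^ 3 ≤ X ^ 5 := pow_le_pow_right₀ hX1 (by norm_num)
  have q2 : X ^ 2 ≤ X ^ 3 := pow_le_pow_right₀ hX1 (by norm_num)
  have q1 : X ≤ X ^ 4 := le_self_pow₀ hX1 (by norm_num)
  have htot : (totalTime (chooseParams n n' b t ε α γ γ' (1 / 64 * (β * α))) : ℝ) =
      ((40 * n + 100) * (m + m * (((min b t : ℕ) : ℝ) + 1)) + 100 * t + 71) * k + 110 +
        ((100 * t + 41) * k + 20) + n + m + m * (((min b t : ℕ) : ℝ) + 1) + t + k + 2 := by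
    simp [totalTime, trainTime, evalTime, chooseParams, hk', hm']
  rw [htot]
  set r : ℝ := m * (((min b t : ℕ) : ℝ) + 1) with hr'
  have hr0 : 0 ≤ r := by positivity
  have s1 : (40 * n + 100) * (m + r) ≤ 17550 * X ^ 4 := by
    calc (40 * n + 100) * (m + r) ≤ (90 * X) * (195 * X ^ 3) := by gcongr <;> linarith
      _ = 17550 * X ^ 4 := by ring
  have s2 : ((40 * n + 100) * (m + r) + 100 * t + 71) * k ≤ 141488 * X ^ 5 := by
    calc _ ≤ (17686 * X ^ 4) * (8 * X) := by gcongr; linarith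
      _ = 141488 * X ^ 5 := by ring
  have s3 : (100 * t + 41) * k ≤ 968 * X ^ 2 := by
    calc _ ≤ (121 * X) * (8 * X) := by gcongr; linarith
      _ = 968 * X ^ 2 := by ring
  have hfin : ((40 * n + 100) * (m + r) + 100 * t + 71) * k + 110 +
        ((100 * t + 41) * k + 20) + n + m + r + t + k + 2 ≤ 150000 * X ^ 5 := by linarith
  refine hfin.trans ?_
  gcongr
  · exact_mod_cast hK
  · omega

end Numerics

/-! ### Accuracy with the chosen constants. -/

section Final
variable {Q U : Type*} {enc : Q ↪ ℕ} {P : Q → U → Bool} {L : Algorithm LearnOracle}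

theorem countingQuery_mem {n : ℕ} (D : Fin n → U) (q : Q) :
    countingQuery P D q ∈ Set.Icc (0 : ℝ) 1 := by
  obtain ⟨c, hc, hc'⟩ := exists_trueCount_eq (P := P) D q
  have hc2 : (c : ℝ) ≤ n := by exact_mod_cast hc
  have : countingQuery P D q = c / n := by rw [← hc']; rfl
  rw [this]
  exact ⟨by positivity, div_le_one_of_le₀ hc2 (Nat.cast_nonneg n)⟩

theorem coe_streamSynopsis {π : Params} (S : ℕ → ℕ → ℝ) (q : Q) :
    (streamSynopsis L enc π S q : ℝ) = releaseValue L enc π S q := by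
  rw [streamSynopsis, releaseValue, Set.projIcc_of_mem zero_le_one (score_mem _ _)]

theorem accuracy_failure_le {π : Params} (G : PMF Q) (D : Fin π.n → U) (γ : ℝ) :
    expect (release L enc G P π D) (fun o => Set.indicator {S : Q → unitInterval |
      ENNReal.ofReal γ < G.toOuterMeasure {q | π.α < |(S q : ℝ) - countingQuery P D q|}} 1
        (streamSynopsis L enc π o.1)) ≤
      expect (release L enc G P π D) fun o => failing
        (prob G {q | π.α < |releaseValue L enc π o.1 q - countingQuery P D q|} ≤
          ENNReal.ofReal γ) := by
  refine expect_mono fun o => ?_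
  by_cases h : prob G {q | π.α < |releaseValue L enc π o.1 q - countingQuery P D q|} ≤
      ENNReal.ofReal γ
  · rw [failing_of h, Set.indicator_of_notMem]
    simpa [coe_streamSynopsis, ← prob_eq] using h
  · rw [failing_of_not h]
    exact Set.indicator_le_self' (fun _ _ => zero_le) _

theorem chosen_chooseParams (n n' b t : ℕ) (ε α γ γ' β' : ℝ) :
    (chooseParams n n' b t ε α γ γ' β').Chosen b ε γ :=
  ⟨rfl, rfl, rfl, rfl⟩

theorem release_accurate_of_large {π : Params} {b : ℕ} {ε β γ : ℝ} [Fintype Q] {𝒢 : Set (PMF Q)}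
    {bf tf : ℕ → ℝ → ℝ → ℕ} {G : PMF Q} (hπ : π.Chosen b ε γ) (hb : b = bf π.n' π.γ' π.β')
    (ht : π.t = tf π.n' π.γ' π.β') (hQ : 2 ≤ Fintype.card Q) (hε : 0 < ε) (hα : 0 < π.α)
    (hα1 : π.α ≤ 1) (hβ : 0 < β) (hβ1 : β ≤ 1) (hγ : 0 < γ) (hγ1 : γ ≤ 1)
    (hn' : π.n' = ⌈32768 * Real.log (Fintype.card Q) / π.α ^ 2⌉₊)
    (hγ' : π.γ' = 1 / 16 * (γ * π.α)) (hβ' : π.β' = 1 / 64 * (β * π.α))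
    (hL : LearnsThresholds L enc (smoothExtension (2 / γ) 𝒢) (Set.range fun u q => P q u) bf tf)
    (hb1 : 0 < b)
    (hn : 1044480 * b * Real.log (b / (π.α * γ * β)) * Real.log (1 / π.β')
        / (ε * π.α ^ 2 * γ) ≤ π.n) (hG : G ∈ 𝒢) (D : Fin π.n → U) :
    expect (release L enc G P π D) (fun o => failing
      (prob G {q | π.α < |releaseValue L enc π o.1 q - countingQuery P D q|} ≤
        ENNReal.ofReal γ)) < ENNReal.ofReal β := by
  obtain ⟨hk, hm, hr, hη⟩ := hπ
  by_cases hα2 : π.α < 1 / 2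
  swap
  -- Without thresholds the score is constantly 1/2, which is accurate enough for α ≥ 1/2.
  · have hk0 : π.k = 0 := by rw [hk, numThresholds, if_neg hα2]
    have : ∀ o : (ℕ → ℕ → ℝ) × (Q → Option (Fin (π.n + 1))),
        {q | π.α < |releaseValue L enc π o.1 q - countingQuery P D q|} = ∅ := by
      intro o
      ext q
      obtain ⟨h1, h2⟩ := countingQuery_mem (P := P) D q
      simp only [Set.mem_ofPred_eq, Set.mem_empty_iff_false, iff_false, not_lt, releaseValue, score,
        hk0, Finset.range_zero, Finset.sum_empty, abs_le]
      push_cast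
      constructor <;> linarith
    simp only [this, prob_eq]
    simp [failing_of, hβ]
  have hl := one_le_log_confidence hα hα1 hβ hβ1
  have hl' := log_confidence_le hα hβ
  rw [← hβ'] at hl hl'
  have hbR : (1 : ℝ) ≤ b := by exact_mod_cast hb1
  have hX : 1 / (π.α * β) ≤ b / (π.α * γ * β) := by
    rw [div_le_div_iff₀ (by positivity) (by positivity)]
    have : γ ≤ b := hγ1.trans hbR
    nlinarith [mul_pos hα hβ]
  have hX1 : 2 ≤ (b : ℝ) / (π.α * γ * β) := by
    rw [le_div_iff₀ (by positivity)]
    have : π.α * γ * β ≤ 1 / 2 * 1 * 1 := by gcongr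
    linarith
  have hlX : Real.log (1 / π.β') ≤ 5 + b / (π.α * γ * β) := by
    have h1 := Real.log_le_sub_one_of_pos (show 0 < 1 / (π.α * β) by positivity)
    linarith
  have hβ'0 : 0 < π.β' := by rw [hβ']; positivity
  have hnpos : 0 < π.n := by
    have h1 : 0 < Real.log (b / (π.α * γ * β)) := Real.log_pos (by linarith)
    have h2 : 0 < 1044480 * b * Real.log (b / (π.α * γ * β)) * Real.log (1 / π.β')
        / (ε * π.α ^ 2 * γ) := by positivity
    exact_mod_cast h2.trans_le hn
  have hn'pos : 0 < π.n' := by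
    rw [hn', Nat.ceil_pos]
    have : 0 < Real.log (Fintype.card Q) := Real.log_pos (by exact_mod_cast hQ)
    positivity
  have hkR : 8 / π.α ≤ (π.k : ℝ) + 1 := by
    rw [hk, numThresholds, if_pos hα2]
    exact (Nat.lt_floor_add_one _).le
  have hkle : (π.k : ℝ) ≤ 8 / π.α := by rw [hk]; exact numThresholds_le hα
  have hk1 : 1 ≤ (π.k : ℝ) := by
    have : 16 ≤ 8 / π.α := by rw [le_div_iff₀ hα]; linarith
    linarith
  have hm1 : 1 ≤ (π.m : ℝ) := by
    rw [hm, sampleSize]; push_cast; linarith [Nat.cast_nonneg (α := ℝ) ⌊16 * Real.log (1 / π.β') / γ⌋₊]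
  set B : ℝ := ((min b π.t : ℕ) : ℝ) with hB
  have hB0 : 0 ≤ B := Nat.cast_nonneg _
  have hBb : B ≤ b := by rw [hB]; exact_mod_cast min_le_left b π.t
  set N : ℝ := π.k * (π.m * (B + 2)) with hN
  have hN1 : 1 ≤ N := by
    have : 1 ≤ π.m * (B + 2) := by nlinarith
    rw [hN]; nlinarith
  have hrm : (π.k : ℝ) * (π.r + π.m) = N := by
    rw [hN, hr, Nat.cast_mul, Nat.cast_add, ← hB]; push_cast; ring
  have hmle : (π.m : ℝ) ≤ 17 * Real.log (1 / π.β') / γ := by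
    have h1 := sampleSize_le (β' := π.β') hγ (by linarith)
    rw [← hm] at h1
    have h2 : 1 ≤ Real.log (1 / π.β') / γ := by rw [le_div_iff₀ hγ]; linarith
    calc (π.m : ℝ) ≤ 16 * Real.log (1 / π.β') / γ + Real.log (1 / π.β') / γ := by linarith
      _ = _ := by ring
  -- Here 408 = 8 · 17 · 3, from the bounds 8/α for the thresholds, 17l/γ for the sample size and 3b
  -- for B + 2.
  have hNle : N ≤ 408 * b * Real.log (1 / π.β') / (π.α * γ) := by
    calc N ≤ 8 / π.α * (17 * Real.log (1 / π.β') / γ * (3 * b)) := by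
          rw [hN]; gcongr; linarith
      _ = _ := by field_simp; ring
  have hηN : π.η = ε / (2 * N) := by rw [hη]
  have hη0 : 0 ≤ π.η := by rw [hηN]; positivity
  have hnoise := noise_total_le hα hα2 hβ hβ1 hγ hγ1 hε hbR (by linarith) hlX (by linarith) hNle hn
  rw [← hηN] at hnoise
  set δ : ℝ := 2 * Real.exp (-(π.η * (π.α / 64 * π.n))) with hδ
  have hδ0 : 0 < δ := by positivity
  have hδ1 : δ < 1 := by nlinarith
  clear_value δ
  refine (release_accurate hnpos hn'pos hα hα1 hγ hγ1 (by rw [hγ']; positivity) hβ'0 hη0 hkR ?_ hQ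
    ?_ hl ?_ ht ?_ hδ.ge hδ1 hL hG D).trans_lt ?_
  · calc (π.k : ℝ) * π.γ' ≤ 8 / π.α * π.γ' := by
          gcongr; rw [hγ']; positivity
      _ = γ / 2 := by rw [hγ']; field_simp; norm_num
  · rw [hn']; exact Nat.le_ceil _
  · rw [hm]; exact le_sampleSize _ _
  · rw [hr, hb]
  · have e : (π.k : ℝ≥0∞) * (4 * ENNReal.ofReal π.β') +
        π.k * ((π.r + π.m) * ENNReal.ofReal δ) =
        ENNReal.ofReal (π.k * (4 * π.β') + π.k * (π.r + π.m) * δ) := by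
      rw [ENNReal.ofReal_add (by positivity) (by positivity), ENNReal.ofReal_mul (by positivity),
        ENNReal.ofReal_mul (by positivity), ENNReal.ofReal_mul (by positivity),
        ENNReal.ofReal_mul (by positivity), ENNReal.ofReal_add (by positivity) (by positivity),
        ENNReal.ofReal_natCast, ENNReal.ofReal_natCast, ENNReal.ofReal_natCast]
      norm_num [mul_assoc]
    rw [e, ENNReal.ofReal_lt_ofReal_iff hβ, hrm]
    -- The learner's failures take up β/2 and the conditioning of the noise at most β/4, which
    -- leaves the strict inequality.
    have h1 : (π.k : ℝ) * (4 * π.β') ≤ β / 2 := by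
      calc (π.k : ℝ) * (4 * π.β') ≤ 8 / π.α * (4 * π.β') := by gcongr
        _ = β / 2 := by rw [hβ']; field_simp; norm_num
    linarith

theorem accurate_releaseAlgorithm {π : Params} {c₂ c₃ : ℚ} {b T : ℕ} {ε β γ : ℝ} {𝒢 : Set (PMF Q)}
    (hπ : π.Admissible c₂ c₃ b ε β γ) (hT : totalTime π ≤ T)
    (h : ∀ G ∈ 𝒢, ∀ D : Fin π.n → U, expect (release L enc G P π D) (fun o => failing
      (prob G {q | π.α < |releaseValue L enc π o.1 q - countingQuery P D q|} ≤
        ENNReal.ofReal γ)) < ENNReal.ofReal β) :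
    Accurate P 𝒢 π.n π.α β γ fun G D => (releaseAlgorithm c₂ c₃ L).synopsis enc
      (releaseAccess enc P G D) [π.n, ε, π.α, β, γ, π.n', b, π.t] T := by
  intro G hG D
  dsimp only
  rw [synopsis_eq hπ hT]
  exact (accuracy_failure_le G D γ).trans_lt (h G hG D)

end Final

end DataRelease

end

/-! ### The theorem. -/

open DataRelease
theorem theorem3p6 :
    ∃ (c₁ c₂ c₃ C : ℝ) (K : ℕ), 0 < c₁ ∧ 0 < c₂ ∧ 0 < c₃ ∧ 0 < C ∧
    ∀ L : Algorithm LearnOracle, ∃ A : Algorithm ReleaseOracle,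
    ∀ {U : Type*} {Q : Type*} [Fintype Q] (enc : Q ↪ ℕ) (𝒢 : Set (PMF Q)) (P : Q → U → Bool)
      (b t : ℕ → ℝ → ℝ → ℕ) (ε α β γ : ℝ) (n n' : ℕ) (γ' β' : ℝ),
      2 ≤ Fintype.card Q →
      0 < ε → 0 < α → α ≤ 1 → 0 < β → β ≤ 1 → 0 < γ → γ ≤ 1 →
      n' = ⌈c₁ * Real.log (Fintype.card Q) / α ^ 2⌉₊ → γ' = c₂ * (γ * α) → β' = c₃ * (β * α) →
      LearnsThresholds L enc (smoothExtension (2 / γ) 𝒢) (Set.range fun u q => P q u) b t →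
      0 < b n' γ' β' →
      C * b n' γ' β' * Real.log (b n' γ' β' / (α * γ * β)) * Real.log (1 / β')
        / (ε * α ^ 2 * γ) ≤ n →
      ∃ T : ℕ,
        (T : ℝ) ≤ K * (t n' γ' β' + n + 1 / α + Real.log (1 / β) + 1 / γ) ^ K ∧
        (∀ G ∈ 𝒢, ∀ D : Fin n → U,
          A.RunsWithin enc (releaseAccess enc P G D)
            [n, ε, α, β, γ, n', b n' γ' β', t n' γ' β'] T ⊤) ∧
        (∀ G ∈ 𝒢, DifferentiallyPrivate ε fun D : Fin n → U =>
          A.synopsis enc (releaseAccess enc P G D)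
            [n, ε, α, β, γ, n', b n' γ' β', t n' γ' β'] T) ∧
        Accurate P 𝒢 n α β γ fun G (D : Fin n → U) =>
          A.synopsis enc (releaseAccess enc P G D)
            [n, ε, α, β, γ, n', b n' γ' β', t n' γ' β'] T := by
  -- With at most 8/α thresholds, 1/16 makes the errors of the hypotheses sum to at most γ/2, and
  -- 1/64 makes four failures per threshold sum to at most β/2. The first constant is 2 · 128², for
  -- a sampling error of α/64.
  refine ⟨32768, 1 / 16, 1 / 64, 1044480, 150000, by norm_num, by norm_num, by norm_num,
    by norm_num, fun L => ⟨releaseAlgorithm (1 / 16) (1 / 64) L, ?_⟩⟩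
  intro U Q _ enc 𝒢 P b t ε α β γ n n' γ' β' hQ hε hα hα1 hβ hβ1 hγ hγ1 hn' hγ' hβ' hL hb hn
  set π : Params := chooseParams n n' (b n' γ' β') (t n' γ' β') ε α γ γ' β' with hπ
  have hchosen : π.Chosen (b n' γ' β') ε γ := chosen_chooseParams ..
  have hadm : π.Admissible (1 / 16) (1 / 64) (b n' γ' β') ε β γ := by
    refine ⟨hα, hγ, ?_, ?_, ?_, ?_, hchosen⟩
    · change 0 < β'
      rw [hβ']; positivity
    · change β' ≤ 1
      rw [hβ']
      have := mul_le_one₀ hβ1 hα.le hα1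
      linarith
    · change γ' = _
      rw [hγ']; push_cast; rfl
    · change β' = _
      rw [hβ']; push_cast; rfl
  have hη : 0 ≤ π.η := by
    change 0 ≤ ε / _
    positivity
  refine ⟨totalTime π, ?_, fun G _ D => runsWithin_releaseAlgorithm (π := π) hadm le_rfl,
    fun G _ => differentiallyPrivate_releaseAlgorithm (π := π) hadm le_rfl hη ?_,
    accurate_releaseAlgorithm (π := π) hadm le_rfl fun G hG D => ?_⟩
  · have := totalTime_le (n := n) (n' := n') (b := b n' γ' β') (t := t n' γ' β') (ε := ε)
      (γ' := γ') (le_refl 150000) hα hα1 hβ hβ1 hγ hγ1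
    rwa [← hβ'] at this
  · obtain ⟨-, -, h3, h4⟩ := hchosen
    rw [h3, h4]
    -- Without thresholds no values are requested. Otherwise r + m = m(B + 2) for B the minimum of
    -- `b` and `t`, and the total exponent is exactly ε.
    rcases Nat.eq_zero_or_pos π.k with hk | hk
    · rw [hk]; simpa using hε.le
    · have hm : 0 < π.m := Nat.succ_pos _
      push_cast
      have hk' : (0 : ℝ) < π.k := by exact_mod_cast hk
      have hm' : (0 : ℝ) < π.m := by exact_mod_cast hm
      have hB : (0 : ℝ) ≤ min (b n' γ' β' : ℝ) (π.t : ℝ) := by positivity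
      generalize min (b n' γ' β' : ℝ) (π.t : ℝ) = B at hB ⊢
      generalize (π.k : ℝ) = k at hk' ⊢
      generalize (π.m : ℝ) = m at hm' ⊢
      field_simp
      linarith
  · exact release_accurate_of_large hchosen rfl rfl hQ hε hα hα1 hβ hβ1 hγ hγ1 hn' hγ' hβ' hL hb hn
      hG D
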